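/- **Setting.** Let $\Bbbk$ be an algebraically closed field of characteristic zero and let $\Sigma$ be a compact oriented surface, possibly with boundary, with a cell decomposition with vertices $\Sigma^0$, oriented edges $\Sigma^1$ and plaquettes $\Sigma^2$, such that every vertex lies on an edge and $\partial\Sigma$ is contained in the $1$-skeleton. Every plaquette $p$ is labelled by a semisimple Hopf algebra $H_p$ (over $\Bbbk$), with antipode $S$; the side of an edge that faces outside of $\Sigma$ gets the label $\Bbbk$. Every edge $e$, with plaquette $p$ on its left and $p'$ on its right, is labelled by a finite-dimensional semisimple $H_p$-$H_{p'}$-bicomodule algebra $K_e$, with coaction $x\mapsto x_{(-1)}\otimes x_{(0)}\otimes x_{(1)}$. For a sign $\varepsilon$ put $K^{+1}=K$, $K^{-1}=K^{\mathrm{op}}$ for algebras and $H^{+1}=H$, $H^{-1}=H^{\mathrm{op\,cop}}$, $a^{\langle +1\rangle}=a$, $a^{\langle -1\rangle}=S(a)$ for Hopf algebras. For a vertex $v$ let $\Sigma_v$ be the set of half-edges at $v$; a half-edge has sign $+1$ if it is directed away from $v$, and $-1$ if it is directed towards $v$. A *site* is an incidence $(p,v)$ of a plaquette with a vertex; seen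 from $v$ it is bounded by a half-edge $e'_p$ on the left and a half-edge $e_p$ on the right, with signs $\varepsilon'$ and $\varepsilon$. Let $$K_{\Sigma_v}=\bigotimes_{e\in\Sigma_v}K_e^{\varepsilon(e)},$$ and for each site $(p,v)$ at $v$ let the dual algebra $H_p^*$ (with convolution product) be the left $(H_p^{\varepsilon'})^{\mathrm{cop}}\otimes H_p^{\varepsilon}$-module algebra with action $(a'\otimes a).f=f(a'^{\langle-\varepsilon'\rangle}\cdot ?\cdot a^{\langle\varepsilon\rangle})$. The algebra $K_{\Sigma_v}$ is a left comodule algebra over $(H_p^{\varepsilon'})^{\mathrm{cop}}\otimes H_p^{\varepsilon}$ through the coactions of $H_p$ on the factors $K_{e'_p}^{\varepsilon'}$ and $K_{e_p}^{\varepsilon}$, and over the tensor product of these bialgebras over all sites at $v$. For a left module algebra $A$ and a left comodule algebra $K$ over the same bialgebra, the crossed product $A\ltimes K$ is $A\otimes K$ with $(a\otimes x)(a'\otimes x')=a\,(x_{(-1)}.a')\otimes x_{(0)}x'$. The vertex algebra is $C_v=\big(\bigotimes_{(p,v)}H_p^*\big)\ltimes K_{\Sigma_v}$. Every vertex $v$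 is labelled by a left $C_v$-module $Z_v$. The state space is $$\mathscr H=\operatorname{Hom}_{\Bbbk}\Big(\bigotimes_{e\in\Sigma^1}K_e,\ \bigotimes_{v\in\Sigma^0}Z_v\Big).$$ * For a vertex $v$, the $K_{\Sigma_v}$-bimodule structure $\tilde A_v$ on $\mathscr H$ is as follows. The left action is post-composition with the action of $K_{\Sigma_v}\subseteq C_v$ on $Z_v$. The right action is pre-composition with the left action of $K_{\Sigma_v}$ on $\bigotimes_e K_e$ in which $K_e^{+1}$ acts on $K_e$ by left multiplication and $K_e^{-1}$ acts on $K_e$ by right multiplication. * For a site $(p,v)$, the $H_p^*$-bimodule structure $\tilde B_{(p,v)}$ on $\mathscr H$ is as follows. The left action is post-composition with the action on $Z_v$ of the factor $H_p^*\subseteq C_v$ belonging to this site. For the right action, list the edges of $p$ and the sites of $p$ other than $(p,v)$ in clockwise order around $p$, starting right after $(p,v)$; let $f\in H_p^*$ act by $f_{(1)}$ at the first entry, then by $f_{(2)}$ at the second entry, and so on, where $f(xy)=f_{(1)}(x)f_{(2)}(y)$. At an edge $e$ that is directed clockwise around $p$, $f$ acts by pre-composition with $x\mapsto x_{(0)}f(x_{(1)})$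 on $K_e$; at an edge $e$ that is directed counter-clockwise, by pre-composition with $x\mapsto f(S(x_{(-1)}))x_{(0)}$ on $K_e$; at a site $(p,w)$, by post-composition with the action on $Z_w$ of $f\circ S$ in the factor $H_p^*\subseteq C_w$ belonging to this site. Write $\tilde A_v^{k\otimes k'}(x)=k.x.k'$ and $\tilde B_{(p,v)}^{f\otimes f'}(x)=f.x.f'$ for the operators of these bimodule structures. The cell decomposition is called *regular* if neither it nor its Poincaré dual has an edge that is a loop. **Theorem.** 1. For vertices $v_1\neq v_2$, the actions $\tilde A_{v_1}$ and $\tilde A_{v_2}$ commute with each other: all operators of the one commute with all operators of the other. 2. For sites $(p_1,v_1)$ and $(p_2,v_2)$ with $p_1\neq p_2$, the actions $\tilde B_{(p_1,v_1)}$ and $\tilde B_{(p_2,v_2)}$ commute with each other. 3. Assume that the cell decomposition is regular, and let $(p,v)$ be a site such that $p$ has no other incidence with $v$. Then $\tilde A_v$ and $\tilde B_{(p,v)}$ compose to a bimodule structure on $\mathscr H$ over the crossed product algebra $H_p^*\ltimes K_{\Sigma_v}$: there is such a bimodule structure with $$(f\otimes k).x.\big((1\otimes k')(f'\otimes 1)\big)=\tilde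 B_{(p,v)}^{f\otimes f'}\,\tilde A_v^{k\otimes k'}(x)\qquad\text{for all } f,f'\in H_p^*,\ k,k'\in K_{\Sigma_v},\ x\in\mathscr H .$$ -/

import Mathlib

open scoped TensorProduct

namespace Kitaev

/-- A copy of `H`, with opposite multiplication if `opp` is `true`, and with opposite comultiplication
if `cop` is `true`. -/
def Tw (_opp _cop : Bool) (H : Type*) : Type _ := H

namespace Tw

instance (o c : Bool) (H : Type*) [Ring H] : Ring (Tw o c H) :=
  { (inferInstanceAs (AddCommGroup H) : AddCommGroup H) with
    mul := fun x y => show H from bif o then (show H from y) * (show H from x)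
      else (show H from x) * (show H from y)
    one := (1 : H)
    one_mul := fun x => by cases o; exacts [one_mul (M := H) x, mul_one (M := H) x]
    mul_one := fun x => by cases o; exacts [mul_one (M := H) x, one_mul (M := H) x]
    zero_mul := fun x => by cases o; exacts [zero_mul (M₀ := H) x, mul_zero (M₀ := H) x]
    mul_zero := fun x => by cases o; exacts [mul_zero (M₀ := H) x, zero_mul (M₀ := H) x]
    mul_assoc := fun x y z => by
      cases o; exacts [mul_assoc (G := H) x y z, (mul_assoc (G := H) z y x).symm]
    left_distrib := fun x y z => by
      cases o; exacts [mul_add (R := H) x y z, add_mul (R := H) y z x]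
    right_distrib := fun x y z => by
      cases o; exacts [add_mul (R := H) x y z, mul_add (R := H) z x y] }

instance (o c : Bool) (k H : Type*) [CommRing k] [Ring H] [Algebra k H] :
    Algebra k (Tw o c H) where
  smul r x := (r • (show H from x) : H)
  algebraMap :=
    { toFun := fun r => (algebraMap k H r : H)
      map_one' := map_one (algebraMap k H)
      map_mul' := fun r s => by
        cases o
        · exact map_mul (algebraMap k H) r s
        · exact (congrArg _ (mul_comm r s)).trans (map_mul (algebraMap k H) s r)
      map_zero' := map_zero (algebraMap k H)
      map_add' := map_add (algebraMap k H) }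
  commutes' r x := by
    cases o; exacts [Algebra.commutes (A := H) r x, (Algebra.commutes (A := H) r x).symm]
  smul_def' r x := by
    cases o
    · exact Algebra.smul_def (A := H) r x
    · exact (Algebra.smul_def (A := H) r x).trans (Algebra.commutes (A := H) r x)

/-- The identity map, as a linear equivalence. -/
def tw (k : Type*) (o c : Bool) {H : Type*} [CommRing k] [Ring H] [Algebra k H] :
    H ≃ₗ[k] Tw o c H where
  toFun := fun x => x
  invFun := fun x => x
  map_add' _ _ := rfl
  map_smul' _ _ := rfl
  left_inv _ := rfl
  right_inv _ := rfl

section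
variable {k : Type*} [CommRing k] {H : Type*} [Ring H] [Bialgebra k H]

theorem cop_coassoc (x : H) :
    TensorProduct.assoc k H H H ((((TensorProduct.comm k H H).toLinearMap ∘ₗ
      Coalgebra.comul).rTensor H) (TensorProduct.comm k H H (Coalgebra.comul x))) =
    ((TensorProduct.comm k H H).toLinearMap ∘ₗ Coalgebra.comul).lTensor H
      (TensorProduct.comm k H H (Coalgebra.comul x)) := by
  let σ : H ⊗[k] (H ⊗[k] H) →ₗ[k] H ⊗[k] (H ⊗[k] H) :=
    (TensorProduct.assoc k H H H).toLinearMap ∘ₗ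
      (TensorProduct.comm k H H).toLinearMap.rTensor H ∘ₗ
        (TensorProduct.comm k H (H ⊗[k] H)).toLinearMap
  have h1 : ∀ t : H ⊗[k] H, TensorProduct.assoc k H H H ((((TensorProduct.comm k H H).toLinearMap
      ∘ₗ Coalgebra.comul).rTensor H) (TensorProduct.comm k H H t)) =
        σ (Coalgebra.comul.lTensor H t) := by
    intro t
    induction t with
    | zero => simp
    | add a b ha hb => simp only [map_add, ha, hb]
    | tmul a b => simp [σ]
  have h2 : ∀ t : H ⊗[k] H, ((TensorProduct.comm k H H).toLinearMap ∘ₗ Coalgebra.comul).lTensor H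
      (TensorProduct.comm k H H t) =
        σ (TensorProduct.assoc k H H H (Coalgebra.comul.rTensor H t)) := by
    intro t
    induction t with
    | zero => simp
    | add a b ha hb => simp only [map_add, ha, hb]
    | tmul a b =>
      simp only [LinearMap.rTensor_tmul, LinearMap.lTensor_tmul, TensorProduct.comm_tmul,
        LinearMap.comp_apply, LinearEquiv.coe_coe]
      generalize Coalgebra.comul (R := k) a = s
      induction s with
      | zero => simp
      | add a b ha hb => simp only [map_add, TensorProduct.tmul_add, TensorProduct.add_tmul, ha, hb]
      | tmul a b => simp [σ]
  rw [h1, h2, Coalgebra.coassoc_apply]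

/-- The comultiplication of `H`, with its tensor factors exchanged when `c` is `true`. -/
noncomputable def twComul (c : Bool) : H →ₗ[k] H ⊗[k] H :=
  bif c then (TensorProduct.comm k H H).toLinearMap ∘ₗ Coalgebra.comul else Coalgebra.comul

theorem twComul_coassoc (c : Bool) : TensorProduct.assoc k H H H ∘ₗ (twComul c).rTensor H ∘ₗ
    (twComul c : H →ₗ[k] _) = (twComul c).lTensor H ∘ₗ twComul c := by
  cases c
  · exact Coalgebra.coassoc
  · exact LinearMap.ext fun x => cop_coassoc x

theorem twComul_rTensor (c : Bool) : (Coalgebra.counit (R := k)).rTensor H ∘ₗ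
    (twComul c : H →ₗ[k] _) = TensorProduct.mk k _ _ 1 := by
  cases c
  · exact Coalgebra.rTensor_counit_comp_comul
  · ext x
    have h : ∀ t : H ⊗[k] H, (Coalgebra.counit (R := k)).rTensor H (TensorProduct.comm k H H t) =
        TensorProduct.comm k H k ((Coalgebra.counit (R := k)).lTensor H t) := by
      intro t
      induction t with
      | zero => simp
      | add a b ha hb => simp only [map_add, ha, hb]
      | tmul a b => simp
    exact (h _).trans (by rw [Coalgebra.lTensor_counit_comul]; rfl)

theorem twComul_lTensor (c : Bool) : (Coalgebra.counit (R := k)).lTensor H ∘ₗ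
    (twComul c : H →ₗ[k] _) = (TensorProduct.mk k _ _).flip 1 := by
  cases c
  · exact Coalgebra.lTensor_counit_comp_comul
  · ext x
    have h : ∀ t : H ⊗[k] H, (Coalgebra.counit (R := k)).lTensor H (TensorProduct.comm k H H t) =
        TensorProduct.comm k k H ((Coalgebra.counit (R := k)).rTensor H t) := by
      intro t
      induction t with
      | zero => simp
      | add a b ha hb => simp only [map_add, ha, hb]
      | tmul a b => simp
    exact (h _).trans (by rw [Coalgebra.rTensor_counit_comul]; rfl)

theorem twComul_one (c : Bool) : twComul c (1 : H) = (1 ⊗ₜ[k] 1 : H ⊗[k] H) := by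
  cases c
  · exact Bialgebra.comul_one
  · change TensorProduct.comm k H H (Coalgebra.comul 1) = _
    rw [Bialgebra.comul_one, Algebra.TensorProduct.one_def, TensorProduct.comm_tmul]

theorem twComul_mul (c : Bool) (x y : H) :
    twComul (k := k) c (x * y) = twComul c x * twComul c y := by
  cases c
  · exact Bialgebra.comul_mul x y
  · change Algebra.TensorProduct.comm k H H (Coalgebra.comul (x * y)) =
      Algebra.TensorProduct.comm k H H _ * Algebra.TensorProduct.comm k H H _
    rw [Bialgebra.comul_mul, map_mul]

noncomputable instance (o c : Bool) : Coalgebra k (Tw o c H) where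
  comul := (twComul c : H →ₗ[k] H ⊗[k] H)
  counit := (Coalgebra.counit : H →ₗ[k] k)
  coassoc := twComul_coassoc (k := k) (H := H) c
  rTensor_counit_comp_comul := twComul_rTensor (k := k) (H := H) c
  lTensor_counit_comp_comul := twComul_lTensor (k := k) (H := H) c

/-- `H ⊗ K`, with the componentwise twisted multiplication, for the opposite multiplications. -/
theorem tmul_op {H K : Type*} [Ring H] [Algebra k H] [Ring K] [Algebra k K] (c c' : Bool)
    (s t : H ⊗[k] K) :
    (show Tw true c H ⊗[k] Tw true c' K from s * t) =
      (show Tw true c H ⊗[k] Tw true c' K from t) * (show Tw true c H ⊗[k] Tw true c' K from s) := by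
  induction s with
  | zero => rw [zero_mul]; exact (mul_zero _).symm
  | add a b ha hb => rw [add_mul]; exact (congrArg₂ (· + ·) ha hb).trans (mul_add _ _ _).symm
  | tmul a b =>
    induction t with
    | zero => rw [mul_zero]; exact (zero_mul _).symm
    | add a b ha hb => rw [mul_add]; exact (congrArg₂ (· + ·) ha hb).trans (add_mul _ _ _).symm
    | tmul d e =>
      have h1 := Algebra.TensorProduct.tmul_mul_tmul (R := k) a d b e
      have h2 := Algebra.TensorProduct.tmul_mul_tmul (R := k) (tw k true c d) (tw k true c a)
        (tw k true c' e) (tw k true c' b)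
      exact h1.trans h2.symm

theorem tmul_nop {H K : Type*} [Ring H] [Algebra k H] [Ring K] [Algebra k K] (c c' : Bool)
    (s t : H ⊗[k] K) :
    (show Tw false c H ⊗[k] Tw false c' K from s * t) =
      (show Tw false c H ⊗[k] Tw false c' K from s) * (show Tw false c H ⊗[k] Tw false c' K from t) := by
  induction s with
  | zero => rw [zero_mul]; exact (zero_mul _).symm
  | add a b ha hb => rw [add_mul]; exact (congrArg₂ (· + ·) ha hb).trans (add_mul _ _ _).symm
  | tmul a b =>
    induction t with
    | zero => rw [mul_zero]; exact (mul_zero _).symm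
    | add a b ha hb => rw [mul_add]; exact (congrArg₂ (· + ·) ha hb).trans (mul_add _ _ _).symm
    | tmul c d => rfl

noncomputable instance (o c : Bool) : Bialgebra k (Tw o c H) :=
  Bialgebra.mk' k (Tw o c H) (Bialgebra.counit_one (R := k) (A := H))
    (fun {a b} => by
      cases o
      · exact Bialgebra.counit_mul (R := k) (A := H) a b
      · exact (Bialgebra.counit_mul (R := k) (A := H) b a).trans (mul_comm _ _))
    (twComul_one (k := k) (H := H) c)
    (fun {a b} => by
      cases o
      · exact (twComul_mul (k := k) (H := H) c a b).trans (tmul_nop c c _ _)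
      · exact (twComul_mul (k := k) (H := H) c b a).trans (tmul_op c c _ _))

end
end Tw

section PiLift
variable {k ι : Type*} [CommRing k] [DecidableEq ι] {A : ι → Type*}
  [∀ i, Ring (A i)] [∀ i, Algebra k (A i)] {S : Type*} [Ring S] [Algebra k S]

theorem pairwise_commute (f : ∀ i, A i →ₐ[k] S)
    (h : ∀ i j, i ≠ j → ∀ a b, Commute (f i a) (f j b)) (s : Finset ι) (x : ∀ i, A i) :
    (s : Set ι).Pairwise (Function.onFun Commute fun i => f i (x i)) :=
  fun i _ j _ hij => h i j hij _ _

theorem noncommProd_update [Fintype ι] (f : ∀ i, A i →ₐ[k] S)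
    (h : ∀ i j, i ≠ j → ∀ a b, Commute (f i a) (f j b)) (x : ∀ i, A i) (i : ι) (c : A i) :
    Finset.univ.noncommProd (fun j => f j (Function.update x i c j)) (pairwise_commute f h _ _) =
      f i c * (Finset.univ.erase i).noncommProd (fun j => f j (x j))
        (pairwise_commute f h _ _) := by
  refine (Finset.mul_noncommProd_erase Finset.univ (Finset.mem_univ i) _ _).symm.trans ?_
  refine congrArg₂ (· * ·) (by simp) (Finset.noncommProd_congr rfl (fun j hj => ?_) _)
  rw [Function.update_of_ne (Finset.ne_of_mem_erase hj)]

/-- The multilinear map underlying `piLift`. -/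
noncomputable def piLiftAux [Fintype ι] (f : ∀ i, A i →ₐ[k] S)
    (h : ∀ i j, i ≠ j → ∀ a b, Commute (f i a) (f j b)) : MultilinearMap k A S where
  toFun := fun x => Finset.univ.noncommProd (fun i => f i (x i)) (pairwise_commute f h _ _)
  map_update_add' := fun {inst} x i a b => by
    rw [Subsingleton.elim inst ‹DecidableEq ι›, noncommProd_update f h, noncommProd_update f h,
      noncommProd_update f h, map_add, add_mul]
  map_update_smul' := fun {inst} x i r a => by
    rw [Subsingleton.elim inst ‹DecidableEq ι›, noncommProd_update f h, noncommProd_update f h,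
      map_smul, smul_mul_assoc]

/-- The algebra morphism out of a tensor product of algebras determined by pairwise commuting
algebra morphisms out of its factors. -/
noncomputable def piLift [Fintype ι] (f : ∀ i, A i →ₐ[k] S)
    (h : ∀ i j, i ≠ j → ∀ a b, Commute (f i a) (f j b)) : (⨂[k] i, A i) →ₐ[k] S :=
  PiTensorProduct.liftAlgHom (piLiftAux f h)
    ((Finset.noncommProd_eq_pow_card _ _ (pairwise_commute f h _ 1) 1
      (fun i _ => map_one (f i))).trans (one_pow _))
    (fun x y => (Finset.noncommProd_congr rfl (fun i _ => map_mul (f i) _ _)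
        (pairwise_commute f h _ (x * y))).trans
        (Finset.noncommProd_mul_distrib _ _ (pairwise_commute f h _ x) (pairwise_commute f h _ y)
          (fun i _ j _ hij => h i j hij _ _)))

theorem piLift_single [Fintype ι] (f : ∀ i, A i →ₐ[k] S)
    (h : ∀ i j, i ≠ j → ∀ a b, Commute (f i a) (f j b)) (i : ι) (a : A i) :
    piLift f h (PiTensorProduct.singleAlgHom i a) = f i a := by
  rw [PiTensorProduct.singleAlgHom_apply]
  refine (PiTensorProduct.lift.tprod (φ := piLiftAux f h) (Pi.mulSingle i a)).trans ?_
  refine (noncommProd_update f h 1 i a).trans ?_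
  exact (congrArg (f i a * ·) ((Finset.noncommProd_eq_pow_card _ _ (pairwise_commute f h _ 1) 1
    (fun j _ => map_one (f j))).trans (one_pow _))).trans (mul_one _)

theorem piLift_comp_single [Fintype ι] (f : ∀ i, A i →ₐ[k] S)
    (h : ∀ i j, i ≠ j → ∀ a b, Commute (f i a) (f j b)) (i : ι) :
    (piLift f h).comp (PiTensorProduct.singleAlgHom i) = f i :=
  AlgHom.ext fun a => piLift_single f h i a

theorem commute_single {i j : ι} (hij : i ≠ j) (a : A i) (b : A j) :
    Commute (PiTensorProduct.singleAlgHom (R := k) (A := A) i a) 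
      (PiTensorProduct.singleAlgHom j b) := by
  rw [PiTensorProduct.singleAlgHom_apply, PiTensorProduct.singleAlgHom_apply]
  exact (Pi.mulSingle_commute hij a b).tprod

theorem pi_induction [Fintype ι] (P : Subalgebra k (⨂[k] i, A i))
    (hP : ∀ i a, PiTensorProduct.singleAlgHom i a ∈ P) (x : ⨂[k] i, A i) : x ∈ P := by
  let g : (⨂[k] i, A i) →ₐ[k] P := piLift
    (fun i => (PiTensorProduct.singleAlgHom i).codRestrict P (hP i))
    (fun i j hij a b => Subtype.ext (commute_single hij a b))
  have hg : P.val.comp g = AlgHom.id k _ := by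
    refine PiTensorProduct.algHom_ext fun i => AlgHom.ext fun a => ?_
    exact congrArg P.val (piLift_single _ _ i a)
  have := DFunLike.congr_fun hg x
  rw [AlgHom.id_apply] at this
  rw [← this]
  exact (g x).2

theorem commute_piLift [Fintype ι] (f : ∀ i, A i →ₐ[k] S)
    (h : ∀ i j, i ≠ j → ∀ a b, Commute (f i a) (f j b)) (s : S) (hs : ∀ i a, Commute s (f i a))
    (x : ⨂[k] i, A i) : Commute s (piLift f h x) := by
  have := pi_induction ((Subalgebra.centralizer k {s}).comap (piLift f h)) (fun i a => by
    rw [Subalgebra.mem_comap, piLift_single, Subalgebra.mem_centralizer_iff]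
    rintro _ rfl
    exact hs i a) x
  rw [Subalgebra.mem_comap, Subalgebra.mem_centralizer_iff] at this
  exact this s rfl

end PiLift

section OnFactor
variable {k ι : Type*} [CommRing k] [DecidableEq ι] {M : ι → Type*} [∀ i, AddCommGroup (M i)]
    [∀ i, Module k (M i)]

/-- An endomorphism of one factor acts on a tensor product through that factor. -/
noncomputable def onFactor (i : ι) : Module.End k (M i) →ₐ[k] Module.End k (⨂[k] i, M i) :=
  AlgHom.ofLinearMap
    { toFun := fun T => PiTensorProduct.map (Pi.mulSingle i T)
      map_add' := fun S T => PiTensorProduct.map_update_add _ _ _ _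
      map_smul' := fun r T => PiTensorProduct.map_update_smul _ _ _ _ }
    (by
      change PiTensorProduct.map (Pi.mulSingle i 1) = 1
      rw [Pi.mulSingle_one]; exact PiTensorProduct.map_one)
    (fun S T => by
      change PiTensorProduct.map (Pi.mulSingle i (S * T)) = _
      rw [Pi.mulSingle_mul]; exact PiTensorProduct.map_mul _ _)

theorem onFactor_tprod (i : ι) (T : Module.End k (M i)) (x : ∀ i, M i) :
    onFactor i T (PiTensorProduct.tprod k x) =
      PiTensorProduct.tprod k (Function.update x i (T (x i))) := by
  refine (PiTensorProduct.map_tprod _ _).trans (congrArg _ (funext fun j => ?_))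
  by_cases hj : j = i
  · subst hj; simp
  · simp [Pi.mulSingle_eq_of_ne hj, Function.update_of_ne hj]

theorem onFactor_commute {i j : ι} (hij : i ≠ j) (S : Module.End k (M i))
    (T : Module.End k (M j)) : Commute (onFactor i S) (onFactor j T) := by
  change PiTensorProduct.map _ * PiTensorProduct.map _ =
    PiTensorProduct.map _ * PiTensorProduct.map _
  rw [← PiTensorProduct.map_mul, ← PiTensorProduct.map_mul]
  exact congrArg _ (Pi.mulSingle_commute (f := fun i => Module.End k (M i)) hij S T)

end OnFactor

section Pi
variable {k ι : Type*} [CommRing k] [DecidableEq ι] [Fintype ι] {A : ι → Type*}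
  [∀ i, Ring (A i)] [∀ i, Bialgebra k (A i)]

/-- The comultiplication on a tensor product of bialgebras. -/
noncomputable def piComul : (⨂[k] i, A i) →ₐ[k] (⨂[k] i, A i) ⊗[k] (⨂[k] i, A i) :=
  piLift (fun i => (Algebra.TensorProduct.map (PiTensorProduct.singleAlgHom i)
      (PiTensorProduct.singleAlgHom i)).comp (Bialgebra.comulAlgHom k (A i)))
    (fun i j hij a b => by
      have key : ∀ (s : A i ⊗[k] A i) (t : A j ⊗[k] A j),
          Commute (Algebra.TensorProduct.map (PiTensorProduct.singleAlgHom (R := k) (A := A) i)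
            (PiTensorProduct.singleAlgHom (R := k) (A := A) i) s)
          (Algebra.TensorProduct.map (PiTensorProduct.singleAlgHom (R := k) (A := A) j)
            (PiTensorProduct.singleAlgHom (R := k) (A := A) j) t) := by
        intro s t
        induction s with
        | zero => rw [map_zero]; exact Commute.zero_left _
        | add x y hx hy => rw [map_add]; exact hx.add_left hy
        | tmul x y =>
          induction t with
          | zero => rw [map_zero]; exact Commute.zero_right _
          | add x y hx hy => rw [map_add]; exact hx.add_right hy
          | tmul z w =>
            rw [Algebra.TensorProduct.map_tmul, Algebra.TensorProduct.map_tmul]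
            exact (commute_single hij x z).tmul (commute_single hij y w)
      exact key _ _)

/-- The counit on a tensor product of bialgebras. -/
noncomputable def piCounit : (⨂[k] i, A i) →ₐ[k] k :=
  piLift (fun i => Bialgebra.counitAlgHom k (A i)) (fun _ _ _ _ _ => Commute.all _ _)

theorem piComul_single (i : ι) (a : A i) :
    piComul (k := k) (PiTensorProduct.singleAlgHom i a) =
      Algebra.TensorProduct.map (PiTensorProduct.singleAlgHom i)
        (PiTensorProduct.singleAlgHom i) (Coalgebra.comul a) :=
  piLift_single _ _ i a

theorem piCounit_single (i : ι) (a : A i) :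
    piCounit (k := k) (PiTensorProduct.singleAlgHom i a) = Coalgebra.counit a :=
  piLift_single _ _ i a

/-- The tensor product of a finite family of bialgebras. -/
noncomputable instance piBialgebra : Bialgebra k (⨂[k] i, A i) :=
  Bialgebra.ofAlgHom piComul piCounit
    (by
      refine PiTensorProduct.algHom_ext fun i => AlgHom.ext fun a => ?_
      let s := PiTensorProduct.singleAlgHom (R := k) (A := A) i
      have h1 : ∀ t : A i ⊗[k] A i, Algebra.TensorProduct.assoc k k k _ _ _
          (Algebra.TensorProduct.map piComul (.id k _) (Algebra.TensorProduct.map s s t)) =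
          Algebra.TensorProduct.map s (Algebra.TensorProduct.map s s)
            (TensorProduct.assoc k _ _ _ (Coalgebra.comul.rTensor _ t)) := by
        intro t
        induction t with
        | zero => simp
        | add x y hx hy => simp only [map_add, hx, hy]
        | tmul x y =>
          simp only [s, Algebra.TensorProduct.map_tmul, piComul_single, LinearMap.rTensor_tmul, AlgHom.id_apply]
          generalize Coalgebra.comul (R := k) x = u
          induction u with
          | zero => simp
          | add x y hx hy => simp only [map_add, TensorProduct.add_tmul, hx, hy]
          | tmul x y => simp
      have h2 : ∀ t : A i ⊗[k] A i, 
          (Algebra.TensorProduct.map (.id k _) piComul (Algebra.TensorProduct.map s s t)) =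
          Algebra.TensorProduct.map s (Algebra.TensorProduct.map s s)
            (Coalgebra.comul.lTensor _ t) := by
        intro t
        induction t with
        | zero => simp
        | add x y hx hy => simp only [map_add, hx, hy]
        | tmul x y =>
          simp only [s, Algebra.TensorProduct.map_tmul, piComul_single, LinearMap.lTensor_tmul, AlgHom.id_apply]
      change Algebra.TensorProduct.assoc k k k _ _ _
          (Algebra.TensorProduct.map piComul (.id k _) (piComul (k := k) (A := A) (s a))) =
        Algebra.TensorProduct.map (.id k _) piComul (piComul (k := k) (A := A) (s a))
      rw [piComul_single, h1, h2, Coalgebra.coassoc_apply])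
    (by
      refine PiTensorProduct.algHom_ext fun i => AlgHom.ext fun a => ?_
      let s := PiTensorProduct.singleAlgHom (R := k) (A := A) i
      have h1 : ∀ t : A i ⊗[k] A i, Algebra.TensorProduct.map piCounit (.id k _)
            (Algebra.TensorProduct.map s s t) =
          Algebra.TensorProduct.map (.id k k) s (Coalgebra.counit.rTensor _ t) := by
        intro t
        induction t with
        | zero => simp
        | add x y hx hy => simp only [map_add, hx, hy]
        | tmul x y => simp only [s, Algebra.TensorProduct.map_tmul, piCounit_single, LinearMap.rTensor_tmul, AlgHom.id_apply]
      change Algebra.TensorProduct.map piCounit (.id k _) (piComul (k := k) (A := A) (s a)) = 1 ⊗ₜ s a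
      rw [piComul_single, h1, Coalgebra.rTensor_counit_comul]
      rfl)
    (by
      refine PiTensorProduct.algHom_ext fun i => AlgHom.ext fun a => ?_
      let s := PiTensorProduct.singleAlgHom (R := k) (A := A) i
      have h1 : ∀ t : A i ⊗[k] A i, Algebra.TensorProduct.map (.id k _) piCounit
            (Algebra.TensorProduct.map s s t) =
          Algebra.TensorProduct.map s (.id k k) (Coalgebra.counit.lTensor _ t) := by
        intro t
        induction t with
        | zero => simp
        | add x y hx hy => simp only [map_add, hx, hy]
        | tmul x y => simp only [s, Algebra.TensorProduct.map_tmul, piCounit_single, LinearMap.lTensor_tmul, AlgHom.id_apply]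
      change Algebra.TensorProduct.map (.id k _) piCounit (piComul (k := k) (A := A) (s a)) = s a ⊗ₜ 1
      rw [piComul_single, h1, Coalgebra.lTensor_counit_comul]
      rfl)

noncomputable instance piCoalgebra : Coalgebra k (⨂[k] i, A i) :=
  piBialgebra.toCoalgebra

end Pi

/-- A left `B`-comodule algebra. -/
structure LeftComoduleAlgebra (k B K : Type*) [CommRing k] [Ring B] [Bialgebra k B] [Ring K]
    [Algebra k K] where
  coact : K →ₐ[k] B ⊗[k] K
  coassoc : ∀ x, TensorProduct.assoc k B B K
      (TensorProduct.map Coalgebra.comul LinearMap.id (coact x)) =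
    TensorProduct.map LinearMap.id coact.toLinearMap (coact x)
  counit : ∀ x, TensorProduct.lid k K
      (TensorProduct.map Coalgebra.counit LinearMap.id (coact x)) = x

/-- A right `B`-comodule algebra. -/
structure RightComoduleAlgebra (k B K : Type*) [CommRing k] [Ring B] [Bialgebra k B] [Ring K]
    [Algebra k K] where
  coact : K →ₐ[k] K ⊗[k] B
  coassoc : ∀ x, TensorProduct.assoc k K B B
      (TensorProduct.map coact.toLinearMap LinearMap.id (coact x)) =
    TensorProduct.map LinearMap.id Coalgebra.comul (coact x)
  counit : ∀ x, TensorProduct.rid k K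
      (TensorProduct.map LinearMap.id Coalgebra.counit (coact x)) = x

/-- A `B₁`-`B₂`-bicomodule algebra. -/
structure BicomoduleAlgebra (k B₁ B₂ K : Type*) [CommRing k] [Ring B₁] [Bialgebra k B₁]
    [Ring B₂] [Bialgebra k B₂] [Ring K] [Algebra k K] where
  left : LeftComoduleAlgebra k B₁ K
  right : RightComoduleAlgebra k B₂ K
  comm : ∀ x, TensorProduct.assoc k B₁ K B₂
      (TensorProduct.map left.coact.toLinearMap LinearMap.id (right.coact x)) =
    TensorProduct.map LinearMap.id right.coact.toLinearMap (left.coact x)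

/-- A left `B`-module algebra. -/
structure LeftModuleAlgebra (k B A : Type*) [CommRing k] [Ring B] [Bialgebra k B] [Ring A]
    [Algebra k A] where
  act : B →ₐ[k] Module.End k A
  act_one : ∀ b, act b 1 = algebraMap k A (Coalgebra.counit b)
  act_mul : ∀ b x y, act b (x * y) = LinearMap.mul' k A (TensorProduct.map
    (act.toLinearMap.flip x) (act.toLinearMap.flip y) (Coalgebra.comul b))

section Crossed
variable {k B A K : Type*} [CommRing k] [Ring B] [Bialgebra k B] [Ring A] [Algebra k A] [Ring K]
  [Algebra k K]

/-- The crossed product algebra of a left `B`-module algebra `A` and a left `B`-comodule algebra `K`,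
with underlying vector space `A ⊗ K`. -/
def CrossedProduct (_M : LeftModuleAlgebra k B A) (_N : LeftComoduleAlgebra k B K) : Type _ :=
  A ⊗[k] K

namespace CrossedProduct
variable (M : LeftModuleAlgebra k B A) (N : LeftComoduleAlgebra k B K)

noncomputable instance : AddCommGroup (CrossedProduct M N) :=
  inferInstanceAs (AddCommGroup (A ⊗[k] K))

noncomputable instance instModule : Module k (CrossedProduct M N) :=
  inferInstanceAs (Module k (A ⊗[k] K))

/-- `x ↦ k₍₋₁₎.a' ⊗ k₍₀₎ k'` for `k` in `K`, as an algebra morphism into endomorphisms. -/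
noncomputable def straighten : K →ₐ[k] Module.End k (A ⊗[k] K) :=
  ((Module.endTensorEndAlgHom (R := k) (S := k) (A := k) (M := A) (N := K)).comp
    (Algebra.TensorProduct.map M.act (Algebra.lmul k K))).comp N.coact

/-- Left multiplication by `a ⊗ k`, namely `a' ⊗ k' ↦ a (k₍₋₁₎.a') ⊗ k₍₀₎ k'`. -/
noncomputable def mulL : A ⊗[k] K →ₗ[k] Module.End k (A ⊗[k] K) :=
  TensorProduct.lift ((LinearMap.mul k (Module.End k (A ⊗[k] K))).compl₁₂
    ((Module.endTensorEndAlgHom (R := k) (S := k) (A := k) (M := A) (N := K)).toLinearMap ∘ₗ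
      (TensorProduct.mk k _ _).flip 1 ∘ₗ (Algebra.lmul k A).toLinearMap)
    (straighten M N).toLinearMap)

theorem straighten_apply (x : K) (a' : A) (x' : K) :
    straighten M N x (a' ⊗ₜ x') = TensorProduct.map (M.act.toLinearMap.flip a')
      (LinearMap.mulRight k x') (N.coact x) := by
  change Module.endTensorEndAlgHom (Algebra.TensorProduct.map M.act (Algebra.lmul k K) (N.coact x))
    (a' ⊗ₜ x') = _
  generalize N.coact x = t
  induction t with
  | zero => simp
  | add x y hx hy => simp only [map_add, LinearMap.add_apply, hx, hy]
  | tmul b y => rfl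

theorem mulL_apply (a : A) (x : K) (z : A ⊗[k] K) :
    mulL M N (a ⊗ₜ x) z = TensorProduct.map (LinearMap.mulLeft k a) LinearMap.id
      (straighten M N x z) := rfl

theorem mulL_mulLeft (a : A) (z w : A ⊗[k] K) :
    mulL M N (TensorProduct.map (LinearMap.mulLeft k a) LinearMap.id z) w =
      TensorProduct.map (LinearMap.mulLeft k a) LinearMap.id (mulL M N z w) := by
  induction z with
  | zero => simp
  | add x y hx hy => simp only [map_add, LinearMap.add_apply, hx, hy]
  | tmul b y =>
    have h := TensorProduct.map_comp (LinearMap.mulLeft k a) (LinearMap.id (R := k) (M := K))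
      (LinearMap.mulLeft k b) LinearMap.id
    rw [LinearMap.id_comp, ← LinearMap.mulLeft_mul] at h
    rw [TensorProduct.map_tmul, mulL_apply, mulL_apply, LinearMap.mulLeft_apply,
      LinearMap.id_apply, h, LinearMap.comp_apply]

theorem mulL_straighten_one (x : K) (a : A) (w : A ⊗[k] K) :
    mulL M N (straighten M N x (a ⊗ₜ 1)) w =
      straighten M N x (TensorProduct.map (LinearMap.mulLeft k a) LinearMap.id w) := by
  induction w with
  | zero => simp
  | add x y hx hy => simp only [map_add, hx, hy]
  | tmul a' y =>
    let G : B ⊗[k] (B ⊗[k] K) →ₗ[k] A ⊗[k] K :=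
      TensorProduct.map (LinearMap.mul' k A) LinearMap.id ∘ₗ
        (TensorProduct.assoc k A A K).symm.toLinearMap ∘ₗ
          TensorProduct.map (M.act.toLinearMap.flip a)
            (TensorProduct.map (M.act.toLinearMap.flip a') (LinearMap.mulRight k y))
    have h1 : ∀ t : B ⊗[k] K, TensorProduct.map (M.act.toLinearMap.flip (a * a'))
        (LinearMap.mulRight k y) t = G (TensorProduct.assoc k B B K
          (TensorProduct.map Coalgebra.comul LinearMap.id t)) := by
      intro t
      induction t with
      | zero => simp
      | add x y hx hy => simp only [map_add, hx, hy]
      | tmul b z =>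
        rw [TensorProduct.map_tmul, TensorProduct.map_tmul, LinearMap.flip_apply,
          AlgHom.toLinearMap_apply, M.act_mul]
        generalize Coalgebra.comul (R := k) b = u
        induction u with
        | zero => simp
        | add x y hx hy => simp only [map_add, TensorProduct.add_tmul, hx, hy]
        | tmul b b' => simp [G]
    have h2 : ∀ t : B ⊗[k] K, mulL M N (TensorProduct.map (M.act.toLinearMap.flip a)
        (LinearMap.mulRight k 1) t) (a' ⊗ₜ y) =
          G (TensorProduct.map LinearMap.id N.coact.toLinearMap t) := by
      intro t
      induction t with
      | zero => simp
      | add x y hx hy => simp only [map_add, LinearMap.add_apply, hx, hy]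
      | tmul b z =>
        rw [TensorProduct.map_tmul, TensorProduct.map_tmul, mulL_apply,
          LinearMap.mulRight_apply, mul_one, straighten_apply, AlgHom.toLinearMap_apply]
        generalize N.coact z = u
        induction u with
        | zero => simp
        | add x y hx hy => simp only [map_add, TensorProduct.tmul_add, hx, hy]
        | tmul b b' => simp [G]
    rw [TensorProduct.map_tmul, LinearMap.mulLeft_apply, LinearMap.id_apply, straighten_apply,
      straighten_apply, h1, h2, N.coassoc]

theorem mulL_mulRight (y : K) (z w : A ⊗[k] K) :
    mulL M N (TensorProduct.map LinearMap.id (LinearMap.mulRight k y) z) w =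
      mulL M N z (straighten M N y w) := by
  induction z with
  | zero => simp
  | add x y hx hy => simp only [map_add, LinearMap.add_apply, hx, hy]
  | tmul a x =>
    rw [TensorProduct.map_tmul, mulL_apply, mulL_apply, LinearMap.mulRight_apply, map_mul]
    rfl

theorem mulL_straighten (x : K) (z w : A ⊗[k] K) :
    mulL M N (straighten M N x z) w = straighten M N x (mulL M N z w) := by
  induction z with
  | zero => simp
  | add x y hx hy => simp only [map_add, LinearMap.add_apply, hx, hy]
  | tmul a y =>
    have h : straighten M N x (a ⊗ₜ y) = TensorProduct.map LinearMap.id (LinearMap.mulRight k y)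
        (straighten M N x (a ⊗ₜ 1)) := by
      rw [straighten_apply, straighten_apply, ← LinearMap.comp_apply, ← TensorProduct.map_comp]
      simp
    rw [h, mulL_mulRight, mulL_straighten_one, mulL_apply]

theorem mulL_assoc (z z' w : A ⊗[k] K) :
    mulL M N (mulL M N z z') w = mulL M N z (mulL M N z' w) := by
  induction z with
  | zero => simp
  | add x y hx hy => simp only [map_add, LinearMap.add_apply, hx, hy]
  | tmul a x => rw [mulL_apply, mulL_mulLeft, mulL_straighten, mulL_apply]

theorem one_mulL (z : A ⊗[k] K) : mulL M N (1 ⊗ₜ 1) z = z := by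
  rw [mulL_apply, map_one, LinearMap.mulLeft_one, TensorProduct.map_id]
  rfl

theorem straighten_one (x : K) : straighten M N x (1 ⊗ₜ 1) = 1 ⊗ₜ x := by
  rw [straighten_apply]
  have h : ∀ t : B ⊗[k] K, TensorProduct.map (M.act.toLinearMap.flip 1)
      (LinearMap.mulRight k (1 : K)) t = (1 : A) ⊗ₜ[k] TensorProduct.lid k K
        (TensorProduct.map Coalgebra.counit LinearMap.id t) := by
    intro t
    induction t with
    | zero => simp
    | add x y hx hy => simp only [map_add, TensorProduct.tmul_add, hx, hy]
    | tmul b y =>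
      simp [M.act_one, Algebra.algebraMap_eq_smul_one, TensorProduct.smul_tmul]
  rw [h, N.counit]

theorem mulL_one (z : A ⊗[k] K) : mulL M N z (1 ⊗ₜ 1) = z := by
  induction z with
  | zero => simp
  | add x y hx hy => simp only [map_add, LinearMap.add_apply, hx, hy]
  | tmul a x => rw [mulL_apply, straighten_one]; simp

noncomputable instance : Ring (CrossedProduct M N) :=
  { (inferInstance : AddCommGroup (CrossedProduct M N)) with
    mul := fun z w => mulL M N z w
    one := (1 ⊗ₜ[k] 1 : A ⊗[k] K)
    one_mul := one_mulL M N
    mul_one := mulL_one M N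
    zero_mul := fun z => LinearMap.map_zero₂ (mulL M N) z
    mul_zero := fun z => map_zero (mulL M N z)
    left_distrib := fun z w w' => map_add (mulL M N z) w w'
    right_distrib := fun z z' w => LinearMap.map_add₂ (mulL M N) z z' w
    mul_assoc := mulL_assoc M N }

noncomputable instance : Algebra k (CrossedProduct M N) :=
  Algebra.ofModule (fun r z w => LinearMap.map_smul₂ (mulL M N) r z w)
    (fun r z w => map_smul (mulL M N z) r w)

/-- The underlying vector space of the crossed product is `A ⊗ K`. -/
noncomputable def ofTensor : A ⊗[k] K ≃ₗ[k] CrossedProduct M N :=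
  LinearEquiv.refl k (A ⊗[k] K)

/-- The multiplication of the crossed product:
`(a ⊗ x) (a' ⊗ x') = a (x₍₋₁₎.a') ⊗ x₍₀₎ x'`. -/
theorem ofTensor_mul_ofTensor (a a' : A) (x x' : K) :
    ofTensor M N (a ⊗ₜ x) * ofTensor M N (a' ⊗ₜ x') =
      ofTensor M N (TensorProduct.map (LinearMap.mulLeft k a ∘ₗ M.act.toLinearMap.flip a')
        (LinearMap.mulRight k x') (N.coact x)) := by
  change mulL M N (a ⊗ₜ x) (a' ⊗ₜ x') = TensorProduct.map _ _ _
  rw [mulL_apply, straighten_apply, ← LinearMap.comp_apply, ← TensorProduct.map_comp,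
    LinearMap.id_comp]

/-- The inclusion `a ↦ a ⊗ 1` of the module algebra into the crossed product. -/
noncomputable def inclA : A →ₐ[k] CrossedProduct M N :=
  AlgHom.ofLinearMap ((ofTensor M N).toLinearMap ∘ₗ (TensorProduct.mk k A K).flip 1) rfl
    (fun a a' => by
      change ((a * a') ⊗ₜ[k] (1 : K) : A ⊗[k] K) = mulL M N (a ⊗ₜ 1) (a' ⊗ₜ 1)
      rw [mulL_apply, map_one (straighten M N)]
      rfl)

/-- The inclusion `x ↦ 1 ⊗ x` of the comodule algebra into the crossed product. -/
noncomputable def inclK : K →ₐ[k] CrossedProduct M N :=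
  AlgHom.ofLinearMap ((ofTensor M N).toLinearMap ∘ₗ TensorProduct.mk k A K 1) rfl
    (fun x x' => by
      change ((1 : A) ⊗ₜ[k] (x * x') : A ⊗[k] K) = mulL M N (1 ⊗ₜ x) (1 ⊗ₜ x')
      rw [← straighten_one M N x, mulL_straighten, one_mulL, ← straighten_one M N x',
        ← straighten_one M N (x * x'), map_mul]
      rfl)

end CrossedProduct
end Crossed

section Homs
variable {k ι : Type*} [CommRing k] [DecidableEq ι] [Fintype ι] {A : ι → Type*}
  [∀ i, Ring (A i)] [∀ i, Bialgebra k (A i)]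

/-- The inclusion of a factor into a tensor product of bialgebras. -/
noncomputable def piSingle (i : ι) : A i →ₐc[k] ⨂[k] i, A i :=
  BialgHom.ofAlgHom (PiTensorProduct.singleAlgHom i)
    (AlgHom.ext fun a => piCounit_single i a) (AlgHom.ext fun a => (piComul_single i a).symm)

theorem piSingle_apply (i : ι) (a : A i) :
    piSingle (k := k) i a = PiTensorProduct.singleAlgHom i a := rfl

variable {B B₁ B₂ : Type*} [Ring B] [Bialgebra k B] [Ring B₁] [Bialgebra k B₁] [Ring B₂]
  [Bialgebra k B₂]

/-- The algebra morphism underlying `piLiftBialg`. -/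
noncomputable def piLiftBialgAux (f : ∀ i, A i →ₐc[k] B)
    (h : ∀ i j, i ≠ j → ∀ a b, Commute (f i a) (f j b)) : (⨂[k] i, A i) →ₐ[k] B :=
  piLift (fun i => (f i : A i →ₐ[k] B)) h

theorem piLiftBialgAux_single (f : ∀ i, A i →ₐc[k] B)
    (h : ∀ i j, i ≠ j → ∀ a b, Commute (f i a) (f j b)) (i : ι) (a : A i) :
    piLiftBialgAux f h (PiTensorProduct.singleAlgHom i a) = f i a :=
  piLift_single (fun i => (f i : A i →ₐ[k] B)) h i a

theorem piLiftBialgAux_comp_single (f : ∀ i, A i →ₐc[k] B)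
    (h : ∀ i j, i ≠ j → ∀ a b, Commute (f i a) (f j b)) (i : ι) :
    (piLiftBialgAux f h).comp (PiTensorProduct.singleAlgHom i) = (f i : A i →ₐ[k] B) :=
  AlgHom.ext fun a => piLiftBialgAux_single f h i a

/-- The bialgebra morphism out of a tensor product of bialgebras determined by pairwise commuting
bialgebra morphisms out of its factors. -/
noncomputable def piLiftBialg (f : ∀ i, A i →ₐc[k] B)
    (h : ∀ i j, i ≠ j → ∀ a b, Commute (f i a) (f j b)) : (⨂[k] i, A i) →ₐc[k] B :=
  BialgHom.ofAlgHom (piLiftBialgAux f h)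
    (PiTensorProduct.algHom_ext fun i => AlgHom.ext fun a => by
      change Coalgebra.counit (piLiftBialgAux f h
        (PiTensorProduct.singleAlgHom i a)) = piCounit (PiTensorProduct.singleAlgHom i a)
      rw [piLiftBialgAux_single, piCounit_single]
      exact CoalgHomClass.counit_comp_apply (f i) a)
    (PiTensorProduct.algHom_ext fun i => AlgHom.ext fun a => by
      change Algebra.TensorProduct.map (piLiftBialgAux f h) (piLiftBialgAux f h)
        (piComul (k := k) (A := A) (PiTensorProduct.singleAlgHom i a)) =
        Coalgebra.comul (piLiftBialgAux f h (PiTensorProduct.singleAlgHom i a))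
      rw [piLiftBialgAux_single, piComul_single, ← AlgHom.comp_apply,
        ← Algebra.TensorProduct.map_comp, piLiftBialgAux_comp_single]
      exact CoalgHomClass.map_comp_comul_apply (f i) a)

theorem piLiftBialg_single (f : ∀ i, A i →ₐc[k] B)
    (h : ∀ i j, i ≠ j → ∀ a b, Commute (f i a) (f j b)) (i : ι) (a : A i) :
    piLiftBialg f h (PiTensorProduct.singleAlgHom i a) = f i a :=
  piLift_single (fun i => (f i : A i →ₐ[k] B)) h i a

/-- The bialgebra morphism that is the counit. -/
noncomputable def trivialBialg : B₁ →ₐc[k] B :=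
  BialgHom.ofAlgHom ((Algebra.ofId k B).comp (Bialgebra.counitAlgHom k B₁))
    (AlgHom.ext fun a => by
      change Coalgebra.counit (algebraMap k B (Coalgebra.counit a)) = Coalgebra.counit (R := k) a
      rw [Algebra.algebraMap_eq_smul_one, map_smul, Bialgebra.counit_one, smul_eq_mul, mul_one])
    (AlgHom.ext fun a => by
      change Algebra.TensorProduct.map ((Algebra.ofId k B).comp (Bialgebra.counitAlgHom k B₁))
        ((Algebra.ofId k B).comp (Bialgebra.counitAlgHom k B₁)) (Coalgebra.comul a) =
        Coalgebra.comul (algebraMap k B (Coalgebra.counit a))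
      have h : ∀ t : B₁ ⊗[k] B₁, Algebra.TensorProduct.map
          ((Algebra.ofId k B).comp (Bialgebra.counitAlgHom k B₁))
          ((Algebra.ofId k B).comp (Bialgebra.counitAlgHom k B₁)) t =
          Algebra.TensorProduct.map (Algebra.ofId k B)
            ((Algebra.ofId k B).comp (Bialgebra.counitAlgHom k B₁))
            (Coalgebra.counit.rTensor _ t) := by
        intro t
        induction t with
        | zero => simp
        | add x y hx hy => simp only [map_add, hx, hy]
        | tmul x y => rfl
      rw [h, Coalgebra.rTensor_counit_comul, Algebra.algebraMap_eq_smul_one, map_smul,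
        Bialgebra.comul_one, Algebra.TensorProduct.map_tmul, map_one]
      change (1 : B) ⊗ₜ[k] (algebraMap k B (Coalgebra.counit (R := k) a)) = _
      rw [Algebra.algebraMap_eq_smul_one, TensorProduct.tmul_smul]
      rfl)

/-- The projection of a tensor product of bialgebras onto a factor, applying the counit to the
other factors. -/
noncomputable def piProj (i : ι) : (⨂[k] i, A i) →ₐc[k] A i :=
  piLiftBialg (Function.update (fun _ => trivialBialg) i (BialgHom.id k (A i)))
    (fun j l hjl a b => by
      by_cases hj : j = i
      · have hl : l ≠ i := fun h => hjl (hj.trans h.symm)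
        rw [Function.update_of_ne hl]
        exact Algebra.commute_algebraMap_right _ _
      · rw [Function.update_of_ne hj]
        exact Algebra.commute_algebraMap_left _ _)

theorem piProj_single_self (i : ι) (a : A i) :
    piProj i (PiTensorProduct.singleAlgHom (R := k) i a) = a := by
  refine (piLiftBialg_single _ _ i a).trans ?_
  rw [Function.update_self]
  rfl

theorem piProj_single_of_ne {i j : ι} (h : j ≠ i) (a : A j) :
    piProj i (PiTensorProduct.singleAlgHom (R := k) j a) = algebraMap k _ (Coalgebra.counit a) := by
  refine (piLiftBialg_single _ _ j a).trans ?_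
  rw [Function.update_of_ne h]
  rfl

/-- The bialgebra morphism out of a tensor product determined by two commuting ones. -/
noncomputable def liftBialg (f : B₁ →ₐc[k] B) (g : B₂ →ₐc[k] B)
    (h : ∀ a b, Commute (f a) (g b)) : B₁ ⊗[k] B₂ →ₐc[k] B :=
  BialgHom.ofAlgHom (Algebra.TensorProduct.lift (f : B₁ →ₐ[k] B) (g : B₂ →ₐ[k] B) h)
    (by
      refine Algebra.TensorProduct.ext' fun a b => ?_
      change Coalgebra.counit (f a * g b) = Coalgebra.counit (R := k) (a ⊗ₜ[k] b)
      rw [Bialgebra.counit_mul, CoalgHomClass.counit_comp_apply, CoalgHomClass.counit_comp_apply,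
        TensorProduct.counit_tmul, smul_eq_mul, mul_comm])
    (by
      refine Algebra.TensorProduct.ext' fun a b => ?_
      have key : ∀ (s : B₁ ⊗[k] B₁) (t : B₂ ⊗[k] B₂),
          TensorProduct.map (Algebra.TensorProduct.lift (f : B₁ →ₐ[k] B) (g : B₂ →ₐ[k] B) h).toLinearMap
            (Algebra.TensorProduct.lift (f : B₁ →ₐ[k] B) (g : B₂ →ₐ[k] B) h).toLinearMap
            (TensorProduct.AlgebraTensorModule.tensorTensorTensorComm k k k k B₁ B₁ B₂ B₂
              (s ⊗ₜ t)) =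
          TensorProduct.map (f : B₁ →ₗ[k] B) (f : B₁ →ₗ[k] B) s *
            TensorProduct.map (g : B₂ →ₗ[k] B) (g : B₂ →ₗ[k] B) t := by
        intro s t
        induction s with
        | zero => simp
        | add x y hx hy => simp only [map_add, TensorProduct.add_tmul, add_mul, hx, hy]
        | tmul x y =>
          induction t with
          | zero => simp
          | add x y hx hy => simp only [map_add, TensorProduct.tmul_add, mul_add, hx, hy]
          | tmul z w => simp; rfl
      change TensorProduct.map _ _ (Coalgebra.comul (a ⊗ₜ[k] b)) = Coalgebra.comul (f a * g b)
      rw [TensorProduct.comul_tmul]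
      refine (key _ _).trans ?_
      rw [Bialgebra.comul_mul, CoalgHomClass.map_comp_comul_apply,
        CoalgHomClass.map_comp_comul_apply])

theorem liftBialg_tmul (f : B₁ →ₐc[k] B) (g : B₂ →ₐc[k] B)
    (h : ∀ a b, Commute (f a) (g b)) (a : B₁) (b : B₂) :
    liftBialg f g h (a ⊗ₜ b) = f a * g b := rfl

/-- The inclusion of the first factor of a tensor product of bialgebras. -/
noncomputable def inclLeft : B₁ →ₐc[k] B₁ ⊗[k] B₂ :=
  BialgHom.ofAlgHom Algebra.TensorProduct.includeLeft
    (AlgHom.ext fun a => by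
      change Coalgebra.counit (R := k) (a ⊗ₜ[k] (1 : B₂)) = Coalgebra.counit a
      rw [TensorProduct.counit_tmul, Bialgebra.counit_one, one_smul])
    (AlgHom.ext fun a => by
      change TensorProduct.map _ _ (Coalgebra.comul a) = Coalgebra.comul (a ⊗ₜ[k] (1 : B₂))
      rw [TensorProduct.comul_tmul, Bialgebra.comul_one]
      generalize Coalgebra.comul (R := k) a = t
      induction t with
      | zero => simp
      | add x y hx hy => simp only [map_add, TensorProduct.add_tmul, hx, hy]
      | tmul z w => rfl)

/-- The inclusion of the second factor of a tensor product of bialgebras. -/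
noncomputable def inclRight : B₂ →ₐc[k] B₁ ⊗[k] B₂ :=
  BialgHom.ofAlgHom Algebra.TensorProduct.includeRight
    (AlgHom.ext fun a => by
      change Coalgebra.counit (R := k) ((1 : B₁) ⊗ₜ[k] a) = Coalgebra.counit a
      rw [TensorProduct.counit_tmul, Bialgebra.counit_one, smul_eq_mul, mul_one])
    (AlgHom.ext fun a => by
      change TensorProduct.map _ _ (Coalgebra.comul a) = Coalgebra.comul ((1 : B₁) ⊗ₜ[k] a)
      rw [TensorProduct.comul_tmul, Bialgebra.comul_one]
      generalize Coalgebra.comul (R := k) a = t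
      induction t with
      | zero => simp
      | add x y hx hy => simp only [map_add, TensorProduct.tmul_add, hx, hy]
      | tmul z w => rfl)

theorem commute_inclLeft_inclRight (a : B₁) (b : B₂) :
    Commute (inclLeft (k := k) (B₂ := B₂) a) (inclRight (k := k) (B₁ := B₁) b) := by
  change (a ⊗ₜ[k] (1 : B₂)) * ((1 : B₁) ⊗ₜ[k] b) = ((1 : B₁) ⊗ₜ[k] b) * (a ⊗ₜ[k] (1 : B₂))
  simp

end Homs

section
variable {k : Type*} [CommRing k] {B B' B₁ B₂ K : Type*} [Ring B] [Bialgebra k B] [Ring B']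
  [Bialgebra k B'] [Ring B₁] [Bialgebra k B₁] [Ring B₂] [Bialgebra k B₂] [Ring K] [Algebra k K]

namespace LeftComoduleAlgebra

/-- Extension of a coaction along a bialgebra morphism. -/
noncomputable def push (N : LeftComoduleAlgebra k B K) (f : B →ₐc[k] B') :
    LeftComoduleAlgebra k B' K where
  coact := (Algebra.TensorProduct.map (f : B →ₐ[k] B') (AlgHom.id k K)).comp N.coact
  coassoc x := by
    let F : B ⊗[k] K →ₗ[k] B' ⊗[k] K :=
      (Algebra.TensorProduct.map (f : B →ₐ[k] B') (AlgHom.id k K)).toLinearMap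
    let G : B ⊗[k] (B ⊗[k] K) →ₗ[k] B' ⊗[k] (B' ⊗[k] K) :=
      TensorProduct.map (f : B →ₗ[k] B') F
    have h1 : ∀ t : B ⊗[k] K, TensorProduct.assoc k B' B' K
        (TensorProduct.map Coalgebra.comul LinearMap.id (F t)) =
          G (TensorProduct.assoc k B B K (TensorProduct.map Coalgebra.comul LinearMap.id t)) := by
      intro t
      induction t with
      | zero => simp
      | add x y hx hy => simp only [map_add, hx, hy]
      | tmul b z =>
        change TensorProduct.assoc k B' B' K ((Coalgebra.comul (f b)) ⊗ₜ z) =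
          G (TensorProduct.assoc k B B K (Coalgebra.comul b ⊗ₜ z))
        rw [← CoalgHomClass.map_comp_comul_apply]
        generalize Coalgebra.comul (R := k) b = u
        induction u with
        | zero => simp
        | add x y hx hy => simp only [map_add, TensorProduct.add_tmul, hx, hy]
        | tmul b b' => rfl
    have h2 : ∀ t : B ⊗[k] K, TensorProduct.map LinearMap.id (F ∘ₗ N.coact.toLinearMap) (F t) =
          G (TensorProduct.map LinearMap.id N.coact.toLinearMap t) := by
      intro t
      induction t with
      | zero => simp
      | add x y hx hy => simp only [map_add, hx, hy]
      | tmul b z => rfl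
    exact (h1 _).trans ((congrArg G (N.coassoc x)).trans (h2 _).symm)
  counit x := by
    have h : ∀ t : B ⊗[k] K, TensorProduct.map Coalgebra.counit LinearMap.id
        (Algebra.TensorProduct.map (f : B →ₐ[k] B') (AlgHom.id k K) t) =
          TensorProduct.map (Coalgebra.counit (R := k)) LinearMap.id t := by
      intro t
      induction t with
      | zero => simp
      | add x y hx hy => simp only [map_add, hx, hy]
      | tmul b z =>
        change Coalgebra.counit (f b) ⊗ₜ z = Coalgebra.counit (R := k) b ⊗ₜ[k] z
        rw [CoalgHomClass.counit_comp_apply]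
    exact (congrArg _ (h _)).trans (N.counit x)

set_option maxHeartbeats 1000000 in
/-- The coaction of a tensor product of bialgebras given by two commuting coactions. -/
noncomputable def prod (N₁ : LeftComoduleAlgebra k B₁ K) (N₂ : LeftComoduleAlgebra k B₂ K)
    (h : ∀ x, TensorProduct.map LinearMap.id N₂.coact.toLinearMap (N₁.coact x) =
      TensorProduct.leftComm k B₂ B₁ K
        (TensorProduct.map LinearMap.id N₁.coact.toLinearMap (N₂.coact x))) :
    LeftComoduleAlgebra k (B₁ ⊗[k] B₂) K where
  coact := ((Algebra.TensorProduct.assoc k k k B₁ B₂ K).symm.toAlgHom.comp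
    (Algebra.TensorProduct.map (AlgHom.id k B₁) N₂.coact)).comp N₁.coact
  coassoc x := by
    let N₁' : K →ₗ[k] B₁ ⊗[k] K := N₁.coact.toLinearMap
    let N₂' : K →ₗ[k] B₂ ⊗[k] K := N₂.coact.toLinearMap
    let a : B₁ ⊗[k] (B₂ ⊗[k] K) →ₗ[k] (B₁ ⊗[k] B₂) ⊗[k] K :=
      (TensorProduct.assoc k B₁ B₂ K).symm.toLinearMap
    let aX : B₁ ⊗[k] (B₂ ⊗[k] ((B₁ ⊗[k] B₂) ⊗[k] K)) →ₗ[k]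
        (B₁ ⊗[k] B₂) ⊗[k] ((B₁ ⊗[k] B₂) ⊗[k] K) :=
      (TensorProduct.assoc k B₁ B₂ ((B₁ ⊗[k] B₂) ⊗[k] K)).symm.toLinearMap
    let C : K →ₗ[k] (B₁ ⊗[k] B₂) ⊗[k] K := a ∘ₗ TensorProduct.map .id N₂' ∘ₗ N₁'
    let P : B₁ ⊗[k] (B₁ ⊗[k] (B₂ ⊗[k] (B₂ ⊗[k] K))) →ₗ[k]
        (B₁ ⊗[k] B₂) ⊗[k] ((B₁ ⊗[k] B₂) ⊗[k] K) :=
      aX ∘ₗ TensorProduct.map .id (TensorProduct.map .id a ∘ₗ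
        (TensorProduct.leftComm k B₁ B₂ (B₂ ⊗[k] K)).toLinearMap)
    let Q : B₁ ⊗[k] (B₁ ⊗[k] (B₂ ⊗[k] K)) →ₗ[k] (B₁ ⊗[k] B₂) ⊗[k] ((B₁ ⊗[k] B₂) ⊗[k] K) :=
      aX ∘ₗ TensorProduct.map .id (TensorProduct.map .id (a ∘ₗ TensorProduct.map .id N₂') ∘ₗ
        (TensorProduct.leftComm k B₁ B₂ K).toLinearMap)
    let W : B₁ ⊗[k] (B₁ ⊗[k] K) →ₗ[k] (B₁ ⊗[k] B₂) ⊗[k] ((B₁ ⊗[k] B₂) ⊗[k] K) :=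
      P ∘ₗ TensorProduct.map .id (TensorProduct.map .id (TensorProduct.map .id N₂' ∘ₗ N₂'))
    have h1 : ∀ s : B₁ ⊗[k] K, TensorProduct.assoc k _ _ K
        (TensorProduct.map Coalgebra.comul .id (a (TensorProduct.map .id N₂' s))) =
          W (TensorProduct.assoc k _ _ K (TensorProduct.map Coalgebra.comul .id s)) := by
      intro s
      induction s with
      | zero => simp
      | add x y hx hy => simp only [map_add, hx, hy]
      | tmul b y =>
        have e1 : ∀ t : B₂ ⊗[k] K, TensorProduct.assoc k _ _ K
            (TensorProduct.map Coalgebra.comul .id (a (b ⊗ₜ t))) =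
              P (TensorProduct.assoc k _ _ _ (Coalgebra.comul b ⊗ₜ[k] TensorProduct.assoc k _ _ K
                (TensorProduct.map Coalgebra.comul .id t))) := by
          intro t
          induction t with
          | zero => simp
          | add x y hx hy => simp only [map_add, TensorProduct.tmul_add, hx, hy]
          | tmul b' z =>
            change TensorProduct.assoc k _ _ K (Coalgebra.comul (b ⊗ₜ[k] b') ⊗ₜ z) =
              P (TensorProduct.assoc k _ _ _ (Coalgebra.comul b ⊗ₜ[k] TensorProduct.assoc k _ _ K
                (Coalgebra.comul b' ⊗ₜ z)))
            rw [TensorProduct.comul_tmul]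
            generalize Coalgebra.comul (R := k) b = u
            generalize Coalgebra.comul (R := k) b' = v
            induction u with
            | zero => simp
            | add x y hx hy => simp only [map_add, TensorProduct.add_tmul, hx, hy]
            | tmul b b' =>
              induction v with
              | zero => simp
              | add x y hx hy =>
                simp only [map_add, TensorProduct.add_tmul, TensorProduct.tmul_add, hx, hy]
              | tmul b b' => rfl
        have e2 : ∀ u : B₁ ⊗[k] B₁, W (TensorProduct.assoc k _ _ K (u ⊗ₜ y)) =
            P (TensorProduct.assoc k _ _ _ (u ⊗ₜ[k] TensorProduct.map .id N₂' (N₂' y))) := by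
          intro u
          induction u with
          | zero => simp
          | add x y hx hy => simp only [map_add, TensorProduct.add_tmul, hx, hy]
          | tmul b b' => rfl
        exact (e1 _).trans ((congrArg (fun q => P (TensorProduct.assoc k _ _ _
          (Coalgebra.comul b ⊗ₜ[k] q))) (N₂.coassoc y)).trans (e2 _).symm)
    have h2 : ∀ s : B₁ ⊗[k] K, TensorProduct.map .id C (a (TensorProduct.map .id N₂' s)) =
        W (TensorProduct.map .id N₁' s) := by
      intro s
      induction s with
      | zero => simp
      | add x y hx hy => simp only [map_add, hx, hy]
      | tmul b y =>
        have e1 : ∀ t : B₂ ⊗[k] K, TensorProduct.map .id C (a (b ⊗ₜ t)) =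
            Q (b ⊗ₜ TensorProduct.leftComm k B₂ B₁ K (TensorProduct.map .id N₁' t)) := by
          intro t
          induction t with
          | zero => simp
          | add x y hx hy => simp only [map_add, TensorProduct.tmul_add, hx, hy]
          | tmul b' z =>
            change (b ⊗ₜ b') ⊗ₜ a (TensorProduct.map .id N₂' (N₁' z)) =
              Q (b ⊗ₜ TensorProduct.leftComm k B₂ B₁ K (b' ⊗ₜ N₁' z))
            generalize N₁' z = r
            induction r with
            | zero => simp
            | add x y hx hy => simp only [map_add, TensorProduct.tmul_add, hx, hy]
            | tmul c w => rfl
        have e2 : ∀ r : B₁ ⊗[k] K, Q (b ⊗ₜ TensorProduct.map .id N₂' r) = W (b ⊗ₜ r) := by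
          intro r
          induction r with
          | zero => simp
          | add x y hx hy => simp only [map_add, TensorProduct.tmul_add, hx, hy]
          | tmul c z =>
            change Q (b ⊗ₜ (c ⊗ₜ N₂' z)) = P (b ⊗ₜ (c ⊗ₜ TensorProduct.map .id N₂' (N₂' z)))
            generalize N₂' z = r
            induction r with
            | zero => simp
            | add x y hx hy => simp only [map_add, TensorProduct.tmul_add, hx, hy]
            | tmul d w => rfl
        exact (e1 _).trans ((congrArg (fun q => Q (b ⊗ₜ q)) (h y).symm).trans (e2 _))
    exact (h1 _).trans ((congrArg W (N₁.coassoc x)).trans (h2 _).symm)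
  counit x := by
    let a : B₁ ⊗[k] (B₂ ⊗[k] K) →ₗ[k] (B₁ ⊗[k] B₂) ⊗[k] K :=
      (TensorProduct.assoc k B₁ B₂ K).symm.toLinearMap
    have h1 : ∀ s : B₁ ⊗[k] K, TensorProduct.lid k K (TensorProduct.map Coalgebra.counit .id
        (a (TensorProduct.map .id N₂.coact.toLinearMap s))) =
          TensorProduct.lid k K (TensorProduct.map Coalgebra.counit .id s) := by
      intro s
      induction s with
      | zero => simp
      | add x y hx hy => simp only [map_add, hx, hy]
      | tmul b y =>
        have e1 : ∀ t : B₂ ⊗[k] K, TensorProduct.lid k K (TensorProduct.map Coalgebra.counit .id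
            (a (b ⊗ₜ t))) = Coalgebra.counit (R := k) b • TensorProduct.lid k K
              (TensorProduct.map Coalgebra.counit .id t) := by
          intro t
          induction t with
          | zero => simp
          | add x y hx hy => simp only [map_add, TensorProduct.tmul_add, smul_add, hx, hy]
          | tmul b' z =>
            change Coalgebra.counit (R := k) (b ⊗ₜ[k] b') • z =
              Coalgebra.counit (R := k) b • Coalgebra.counit (R := k) b' • z
            rw [TensorProduct.counit_tmul, smul_smul, smul_eq_mul, mul_comm]
        exact (e1 _).trans (congrArg _ (N₂.counit y))
    exact (h1 _).trans (N₁.counit x)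

section Pi
variable {ι : Type*} [DecidableEq ι] [Fintype ι] {D K : ι → Type*} [∀ i, Ring (D i)]
  [∀ i, Bialgebra k (D i)] [∀ i, Ring (K i)] [∀ i, Algebra k (K i)]
  (N : ∀ i, LeftComoduleAlgebra k (D i) (K i)) (g : ∀ i, D i →ₐc[k] B)

/-- The coaction of `pi`, on a factor. -/
noncomputable def piCoactAux (i : ι) : K i →ₐ[k] B ⊗[k] (⨂[k] i, K i) :=
  (Algebra.TensorProduct.map (g i : D i →ₐ[k] B) (PiTensorProduct.singleAlgHom i)).comp (N i).coact

theorem piCoactAux_commute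
    (h : ∀ i j, i ≠ j → ∀ a b, Commute (g i a) (g j b)) (i j : ι) (hij : i ≠ j) (x : K i) (y : K j) :
    Commute (piCoactAux N g i x) (piCoactAux N g j y) := by
  have key : ∀ (s : D i ⊗[k] K i) (t : D j ⊗[k] K j),
      Commute (Algebra.TensorProduct.map (g i : D i →ₐ[k] B)
          (PiTensorProduct.singleAlgHom (R := k) (A := K) i) s)
        (Algebra.TensorProduct.map (g j : D j →ₐ[k] B)
          (PiTensorProduct.singleAlgHom (R := k) (A := K) j) t) := by
    intro s t
    induction s with
    | zero => rw [map_zero]; exact Commute.zero_left _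
    | add x y hx hy => rw [map_add]; exact hx.add_left hy
    | tmul x y =>
      induction t with
      | zero => rw [map_zero]; exact Commute.zero_right _
      | add x y hx hy => rw [map_add]; exact hx.add_right hy
      | tmul z w =>
        rw [Algebra.TensorProduct.map_tmul, Algebra.TensorProduct.map_tmul]
        exact (h i j hij x z).tmul (commute_single hij y w)
  exact key _ _

variable (h : ∀ i j, i ≠ j → ∀ a b, Commute (g i a) (g j b))

/-- The coaction of `pi`. -/
noncomputable def piCoact : (⨂[k] i, K i) →ₐ[k] B ⊗[k] (⨂[k] i, K i) :=
  piLift (piCoactAux N g) (piCoactAux_commute N g h)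

theorem piCoact_single (i : ι) (x : K i) :
    piCoact N g h (PiTensorProduct.singleAlgHom i x) =
      TensorProduct.map (g i : D i →ₗ[k] B) (PiTensorProduct.singleAlgHom i).toLinearMap
        ((N i).coact x) :=
  piLift_single _ _ i x

/-- The coaction on a tensor product of comodule algebras over bialgebras whose images in a given
bialgebra commute with each other. -/
noncomputable def pi : LeftComoduleAlgebra k B (⨂[k] i, K i) where
  coact := piCoact N g h
  coassoc x := by
    have e : (Algebra.TensorProduct.assoc k k k B B (⨂[k] i, K i)).toAlgHom.comp
        ((Algebra.TensorProduct.map (Bialgebra.comulAlgHom k B) (AlgHom.id k _)).comp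
          (piCoact N g h)) =
        (Algebra.TensorProduct.map (AlgHom.id k B) (piCoact N g h)).comp (piCoact N g h) := by
      refine PiTensorProduct.algHom_ext fun i => AlgHom.ext fun x => ?_
      let s := (PiTensorProduct.singleAlgHom (R := k) (A := K) i).toLinearMap
      let G : D i ⊗[k] (D i ⊗[k] K i) →ₗ[k] B ⊗[k] (B ⊗[k] (⨂[k] i, K i)) :=
        TensorProduct.map (g i : D i →ₗ[k] B) (TensorProduct.map (g i : D i →ₗ[k] B) s)
      have h1 : ∀ t : D i ⊗[k] K i, TensorProduct.assoc k B B _ (TensorProduct.map Coalgebra.comul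
          LinearMap.id (TensorProduct.map (g i : D i →ₗ[k] B) s t)) =
            G (TensorProduct.assoc k _ _ _ (TensorProduct.map Coalgebra.comul LinearMap.id t)) := by
        intro t
        induction t with
        | zero => simp
        | add x y hx hy => simp only [map_add, hx, hy]
        | tmul b z =>
          change TensorProduct.assoc k B B _ ((Coalgebra.comul (g i b)) ⊗ₜ s z) =
            G (TensorProduct.assoc k _ _ _ (Coalgebra.comul b ⊗ₜ z))
          rw [← CoalgHomClass.map_comp_comul_apply]
          generalize Coalgebra.comul (R := k) b = u
          induction u with
          | zero => simp
          | add x y hx hy => simp only [map_add, TensorProduct.add_tmul, hx, hy]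
          | tmul b b' => rfl
      have h2 : ∀ t : D i ⊗[k] K i, TensorProduct.map LinearMap.id (piCoact N g h).toLinearMap
          (TensorProduct.map (g i : D i →ₗ[k] B) s t) =
            G (TensorProduct.map LinearMap.id (N i).coact.toLinearMap t) := by
        intro t
        induction t with
        | zero => simp
        | add x y hx hy => simp only [map_add, hx, hy]
        | tmul b z => exact congrArg (g i b ⊗ₜ[k] ·) (piCoact_single N g h i z)
      have h0 := piCoact_single N g h i x
      exact (congrArg (fun q => TensorProduct.assoc k B B _ (TensorProduct.map Coalgebra.comul
        LinearMap.id q)) h0).trans ((h1 _).trans ((congrArg G ((N i).coassoc x)).trans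
          ((h2 _).symm.trans (congrArg (TensorProduct.map LinearMap.id
            (piCoact N g h).toLinearMap) h0.symm))))
    exact DFunLike.congr_fun e x
  counit x := by
    have e : (Algebra.TensorProduct.lid k (⨂[k] i, K i)).toAlgHom.comp
        ((Algebra.TensorProduct.map (Bialgebra.counitAlgHom k B) (AlgHom.id k _)).comp
          (piCoact N g h)) = AlgHom.id k _ := by
      refine PiTensorProduct.algHom_ext fun i => AlgHom.ext fun x => ?_
      let s := (PiTensorProduct.singleAlgHom (R := k) (A := K) i).toLinearMap
      have h1 : ∀ t : D i ⊗[k] K i, TensorProduct.lid k _ (TensorProduct.map Coalgebra.counit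
          LinearMap.id (TensorProduct.map (g i : D i →ₗ[k] B) s t)) =
            s (TensorProduct.lid k _ (TensorProduct.map Coalgebra.counit LinearMap.id t)) := by
        intro t
        induction t with
        | zero => simp
        | add x y hx hy => simp only [map_add, hx, hy]
        | tmul b z =>
          change Coalgebra.counit (R := k) (g i b) • s z = s (Coalgebra.counit (R := k) b • z)
          rw [CoalgHomClass.counit_comp_apply, map_smul]
      have h0 := piCoact_single N g h i x
      exact (congrArg (fun q => TensorProduct.lid k _ (TensorProduct.map Coalgebra.counit
        LinearMap.id q)) h0).trans ((h1 _).trans (congrArg s ((N i).counit x)))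
    exact DFunLike.congr_fun e x

end Pi
end LeftComoduleAlgebra
end

section
variable {k : Type*} [CommRing k] {B B₁ B₂ K : Type*} [Ring B] [Bialgebra k B]
  [Ring B₁] [Bialgebra k B₁] [Ring B₂] [Bialgebra k B₂] [Ring K] [Algebra k K]

namespace Tw

/-- The identity map of `B ⊗ K`, as a linear equivalence. -/
noncomputable def twT (o c c' : Bool) {B K : Type*} [Ring B] [Algebra k B] [Ring K] [Algebra k K] :
    B ⊗[k] K ≃ₗ[k] Tw o c B ⊗[k] Tw o c' K :=
  TensorProduct.congr (tw k o c) (tw k o c')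

theorem twT_eq (o c c' : Bool) (t : B ⊗[k] K) : twT o c c' t = (t : B ⊗[k] K) := by
  induction t with
  | zero => exact map_zero _
  | add x y hx hy => rw [map_add]; exact congrArg₂ (· + ·) hx hy
  | tmul b z => rfl

theorem comul_tw (o c : Bool) (b : B) :
    Coalgebra.comul (tw k o c b) = twT o c c (twComul (k := k) c b) :=
  (twT_eq o c c _).symm

theorem twT_mul_false (c c' : Bool) (s t : B ⊗[k] K) :
    twT false c c' (s * t) = twT false c c' s * twT false c c' t := by
  rw [twT_eq, twT_eq, twT_eq]
  exact tmul_nop c c' s t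

theorem twT_mul_true (c c' : Bool) (s t : B ⊗[k] K) :
    twT true c c' (s * t) = twT true c c' t * twT true c c' s := by
  rw [twT_eq, twT_eq, twT_eq]
  exact tmul_op c c' s t

end Tw

/-- An algebra morphism `K → B ⊗ K` seen as a morphism between algebras with twisted
multiplication. -/
noncomputable def twAlgHom (o c : Bool) (f : K →ₐ[k] B ⊗[k] K) :
    Tw o false K →ₐ[k] Tw o c B ⊗[k] Tw o false K :=
  AlgHom.ofLinearMap
    ((Tw.twT o c false).toLinearMap ∘ₗ f.toLinearMap ∘ₗ (Tw.tw k o false).symm.toLinearMap)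
    (congrArg (Tw.twT o c false) (map_one f))
    (fun x y => by
      cases o
      · exact (congrArg (Tw.twT false c false) (map_mul f _ _)).trans (Tw.twT_mul_false _ _ _ _)
      · exact (congrArg (Tw.twT true c false) (map_mul f _ _)).trans (Tw.twT_mul_true _ _ _ _))

theorem twAlgHom_apply (o c : Bool) (f : K →ₐ[k] B ⊗[k] K) (x : K) :
    twAlgHom o c f (Tw.tw k o false x) = Tw.twT o c false (f x) := rfl

/-- If `K` is a left `B`-comodule algebra, then `K` with opposite multiplication is a left comodule
algebra over `B` with opposite multiplication. -/
noncomputable def LeftComoduleAlgebra.tw (o : Bool) (N : LeftComoduleAlgebra k B K) :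
    LeftComoduleAlgebra k (Tw o false B) (Tw o false K) where
  coact := twAlgHom o false N.coact
  coassoc x := by
    let F : B ⊗[k] K →ₗ[k] Tw o false B ⊗[k] Tw o false K := (Tw.twT o false false).toLinearMap
    let G : B ⊗[k] (B ⊗[k] K) →ₗ[k] Tw o false B ⊗[k] (Tw o false B ⊗[k] Tw o false K) :=
      TensorProduct.map (Tw.tw k o false).toLinearMap F
    have h1 : ∀ t : B ⊗[k] K, TensorProduct.assoc k _ _ _
        (TensorProduct.map Coalgebra.comul LinearMap.id (F t)) =
          G (TensorProduct.assoc k B B K (TensorProduct.map Coalgebra.comul LinearMap.id t)) := by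
      intro t
      induction t with
      | zero => simp
      | add x y hx hy => simp only [map_add, hx, hy]
      | tmul b z =>
        change TensorProduct.assoc k _ _ _ (Coalgebra.comul (Tw.tw k o false b) ⊗ₜ
          Tw.tw k o false z) = G (TensorProduct.assoc k B B K (Coalgebra.comul b ⊗ₜ z))
        rw [Tw.comul_tw]
        change TensorProduct.assoc k _ _ _ ((Tw.twT o false false (Coalgebra.comul b) :
            Tw o false B ⊗[k] Tw o false B) ⊗ₜ Tw.tw k o false z) = _
        generalize Coalgebra.comul (R := k) b = u
        induction u with
        | zero => simp
        | add x y hx hy => simp only [map_add, TensorProduct.add_tmul, hx, hy]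
        | tmul b b' => rfl
    have h2 : ∀ t : B ⊗[k] K,
        TensorProduct.map LinearMap.id (twAlgHom o false N.coact).toLinearMap (F t) =
          G (TensorProduct.map LinearMap.id N.coact.toLinearMap t) := by
      intro t
      induction t with
      | zero => simp
      | add x y hx hy => simp only [map_add, hx, hy]
      | tmul b z => rfl
    exact (h1 _).trans ((congrArg G (N.coassoc _)).trans (h2 _).symm)
  counit x := by
    have h : ∀ t : B ⊗[k] K, TensorProduct.lid k _ (TensorProduct.map Coalgebra.counit LinearMap.id
        (Tw.twT o false false t)) = Tw.tw k o false (TensorProduct.lid k _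
          (TensorProduct.map (Coalgebra.counit (R := k)) LinearMap.id t)) := by
      intro t
      induction t with
      | zero => simp
      | add x y hx hy => simp only [map_add, hx, hy]
      | tmul b z => rfl
    exact (h _).trans (N.counit x)

/-- If `K` is a right `B`-comodule algebra, then `K`, possibly with opposite multiplication, is a
left comodule algebra over `B` with opposite comultiplication, and possibly with opposite
multiplication. -/
noncomputable def RightComoduleAlgebra.toLeft (o : Bool) (N : RightComoduleAlgebra k B K) :
    LeftComoduleAlgebra k (Tw o true B) (Tw o false K) where
  coact := twAlgHom o true ((Algebra.TensorProduct.comm k K B).toAlgHom.comp N.coact)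
  coassoc x := by
    let F : K ⊗[k] B →ₗ[k] Tw o true B ⊗[k] Tw o false K :=
      (Tw.twT o true false).toLinearMap ∘ₗ (TensorProduct.comm k K B).toLinearMap
    let G : K ⊗[k] (B ⊗[k] B) →ₗ[k] Tw o true B ⊗[k] (Tw o true B ⊗[k] Tw o false K) :=
      TensorProduct.map (Tw.tw k o true).toLinearMap (Tw.twT o true false).toLinearMap ∘ₗ
        (TensorProduct.assoc k B B K).toLinearMap ∘ₗ (TensorProduct.comm k K (B ⊗[k] B)).toLinearMap
          ∘ₗ TensorProduct.map LinearMap.id (TensorProduct.comm k B B).toLinearMap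
    have h1 : ∀ t : K ⊗[k] B, TensorProduct.assoc k _ _ _
        (TensorProduct.map Coalgebra.comul LinearMap.id (F t)) =
          G (TensorProduct.map LinearMap.id Coalgebra.comul t) := by
      intro t
      induction t with
      | zero => simp
      | add x y hx hy => simp only [map_add, hx, hy]
      | tmul z b =>
        change TensorProduct.assoc k _ _ _ (Coalgebra.comul (Tw.tw k o true b) ⊗ₜ
          Tw.tw k o false z) = G (z ⊗ₜ Coalgebra.comul b)
        rw [Tw.comul_tw]
        change TensorProduct.assoc k _ _ _ ((Tw.twT o true true (TensorProduct.comm k B B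
          (Coalgebra.comul b)) : Tw o true B ⊗[k] Tw o true B) ⊗ₜ Tw.tw k o false z) = _
        generalize Coalgebra.comul (R := k) b = u
        induction u with
        | zero => simp
        | add x y hx hy =>
          simp only [map_add, TensorProduct.add_tmul, TensorProduct.tmul_add, hx, hy]
        | tmul b b' => rfl
    have h2 : ∀ t : K ⊗[k] B,
        TensorProduct.map LinearMap.id (twAlgHom o true
          ((Algebra.TensorProduct.comm k K B).toAlgHom.comp N.coact)).toLinearMap (F t) =
          G (TensorProduct.assoc k K B B (TensorProduct.map N.coact.toLinearMap .id t)) := by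
      intro t
      induction t with
      | zero => simp
      | add x y hx hy => simp only [map_add, hx, hy]
      | tmul z b =>
        change Tw.tw k o true b ⊗ₜ F (N.coact z) =
          G (TensorProduct.assoc k K B B (N.coact z ⊗ₜ b))
        generalize N.coact z = u
        induction u with
        | zero => simp
        | add x y hx hy =>
          simp only [map_add, TensorProduct.add_tmul, TensorProduct.tmul_add, hx, hy]
        | tmul b b' => rfl
    exact (h1 _).trans ((congrArg G (N.coassoc _).symm).trans (h2 _).symm)
  counit x := by
    have h : ∀ t : K ⊗[k] B, TensorProduct.lid k _ (TensorProduct.map Coalgebra.counit LinearMap.id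
        (Tw.twT o true false (TensorProduct.comm k K B t))) = Tw.tw k o false
          (TensorProduct.rid k _ (TensorProduct.map LinearMap.id (Coalgebra.counit (R := k)) t)) := by
      intro t
      induction t with
      | zero => simp
      | add x y hx hy => simp only [map_add, hx, hy]
      | tmul z b => rfl
    exact (h _).trans (N.counit x)

theorem leftComm_leftComm {L M N : Type*} [AddCommGroup L] [Module k L] [AddCommGroup M]
    [Module k M] [AddCommGroup N] [Module k N] (t : L ⊗[k] (M ⊗[k] N)) :
    TensorProduct.leftComm k M L N (TensorProduct.leftComm k L M N t) = t := by
  induction t with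
  | zero => simp
  | add x y hx hy => rw [map_add, map_add, hx, hy]
  | tmul b t =>
    induction t with
    | zero => simp
    | add x y hx hy => rw [TensorProduct.tmul_add, map_add, map_add, hx, hy]
    | tmul c z => rfl

namespace BicomoduleAlgebra

theorem legs_comm (X : BicomoduleAlgebra k B₁ B₂ K) (o : Bool) (x : Tw o false K) :
    TensorProduct.map LinearMap.id (X.left.tw o).coact.toLinearMap
        ((X.right.toLeft o).coact x) =
      TensorProduct.leftComm k _ _ _ (TensorProduct.map LinearMap.id
        (X.right.toLeft o).coact.toLinearMap ((X.left.tw o).coact x)) := by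
  let G : B₁ ⊗[k] (K ⊗[k] B₂) →ₗ[k] Tw o true B₂ ⊗[k] (Tw o false B₁ ⊗[k] Tw o false K) :=
    TensorProduct.map (Tw.tw k o true).toLinearMap (Tw.twT o false false).toLinearMap ∘ₗ
      (TensorProduct.leftComm k B₁ B₂ K).toLinearMap ∘ₗ
        TensorProduct.map LinearMap.id (TensorProduct.comm k K B₂).toLinearMap
  have h1 : ∀ t : K ⊗[k] B₂, TensorProduct.map LinearMap.id (X.left.tw o).coact.toLinearMap
      (Tw.twT o true false (TensorProduct.comm k K B₂ t)) = G (TensorProduct.assoc k B₁ K B₂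
        (TensorProduct.map X.left.coact.toLinearMap LinearMap.id t)) := by
    intro t
    induction t with
    | zero => simp
    | add x y hx hy => simp only [map_add, hx, hy]
    | tmul z b =>
      change Tw.tw k o true b ⊗ₜ Tw.twT o false false (X.left.coact z) =
        G (TensorProduct.assoc k B₁ K B₂ (X.left.coact z ⊗ₜ b))
      generalize X.left.coact z = u
      induction u with
      | zero => simp
      | add x y hx hy =>
        simp only [map_add, TensorProduct.add_tmul, TensorProduct.tmul_add, hx, hy]
      | tmul b b' => rfl
  have h2 : ∀ t : B₁ ⊗[k] K, TensorProduct.leftComm k _ _ _ (TensorProduct.map LinearMap.id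
        (X.right.toLeft o).coact.toLinearMap (Tw.twT o false false t)) =
      G (TensorProduct.map LinearMap.id X.right.coact.toLinearMap t) := by
    intro t
    induction t with
    | zero => simp
    | add x y hx hy => simp only [map_add, hx, hy]
    | tmul b z =>
      change TensorProduct.leftComm k _ _ _ (Tw.tw k o false b ⊗ₜ
        Tw.twT o true false (TensorProduct.comm k K B₂ (X.right.coact z))) =
          G (b ⊗ₜ X.right.coact z)
      generalize X.right.coact z = u
      induction u with
      | zero => simp
      | add x y hx hy =>
        simp only [map_add, TensorProduct.tmul_add, hx, hy]
      | tmul b b' => rfl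
  exact (h1 _).trans ((congrArg G (X.comm _)).trans (h2 _).symm)

/-- The coaction of the two sides of an edge on the algebra of its half-edge directed away from a
vertex: first the right side, then the left side, as seen from the vertex. -/
noncomputable def legsOut (X : BicomoduleAlgebra k B₁ B₂ K) :
    LeftComoduleAlgebra k (Tw false true B₂ ⊗[k] Tw false false B₁) (Tw false false K) :=
  (X.right.toLeft false).prod (X.left.tw false) (X.legs_comm false)

/-- The coaction of the two sides of an edge on the algebra of its half-edge directed towards a
vertex: first the right side, then the left side, as seen from the vertex. -/
noncomputable def legsIn (X : BicomoduleAlgebra k B₁ B₂ K) :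
    LeftComoduleAlgebra k (Tw true false B₁ ⊗[k] Tw true true B₂) (Tw true false K) :=
  (X.left.tw true).prod (X.right.toLeft true) (fun x => by
    rw [X.legs_comm true x, leftComm_leftComm])

end BicomoduleAlgebra

end

section Antipode
variable {k : Type*} [CommRing k] {H : Type*} [Ring H] [HopfAlgebra k H]

theorem comul_antipode (a : H) :
    Coalgebra.comul (R := k) (HopfAlgebra.antipode k a) =
      TensorProduct.map (HopfAlgebra.antipode k) (HopfAlgebra.antipode k)
        (TensorProduct.comm k H H (Coalgebra.comul a)) := by
  let S : H →ₗ[k] H := HopfAlgebra.antipode k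
  let δ : H →ₗ[k] H ⊗[k] H := Coalgebra.comul
  let G : H →ₗ[k] H ⊗[k] H :=
    TensorProduct.map S S ∘ₗ (TensorProduct.comm k H H).toLinearMap ∘ₗ δ
  let T : H ⊗[k] (H ⊗[k] (H ⊗[k] H)) →ₗ[k] H ⊗[k] H :=
    LinearMap.mul' k (H ⊗[k] H) ∘ₗ TensorProduct.map
        (TensorProduct.map S S ∘ₗ (TensorProduct.comm k H H).toLinearMap) LinearMap.id ∘ₗ
      (TensorProduct.assoc k H H (H ⊗[k] H)).symm.toLinearMap
  have h1 : ∀ t : H ⊗[k] H, LinearMap.mul' k (H ⊗[k] H) (TensorProduct.map G δ t) =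
      T (TensorProduct.map .id (TensorProduct.map .id δ) (TensorProduct.assoc k H H H
        (TensorProduct.map δ .id t))) := by
    intro t
    induction t with
    | zero => simp
    | add x y hx hy => simp only [map_add, hx, hy]
    | tmul x y =>
      change LinearMap.mul' k (H ⊗[k] H) ((TensorProduct.map S S (TensorProduct.comm k H H (δ x)))
        ⊗ₜ δ y) = T (TensorProduct.map .id (TensorProduct.map .id δ)
          (TensorProduct.assoc k H H H (δ x ⊗ₜ y)))
      generalize δ x = u
      induction u with
      | zero => simp
      | add x y hx hy => simp only [map_add, TensorProduct.add_tmul, hx, hy]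
      | tmul b b' => rfl
  have h2 : ∀ a x : H, T (a ⊗ₜ TensorProduct.map .id δ (δ x)) = (1 : H) ⊗ₜ (S a * x) := by
    intro a x
    have e : ∀ t : H ⊗[k] H, T (a ⊗ₜ TensorProduct.assoc k H H H (TensorProduct.map δ .id t)) =
        (1 : H) ⊗ₜ (S a * TensorProduct.lid k H (TensorProduct.map Coalgebra.counit .id t)) := by
      intro t
      induction t with
      | zero => simp
      | add x y hx hy => simp only [map_add, TensorProduct.tmul_add, mul_add, hx, hy]
      | tmul x y =>
        have e' : ∀ u : H ⊗[k] H, T (a ⊗ₜ TensorProduct.assoc k H H H (u ⊗ₜ y)) =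
            LinearMap.mul' k H (S.rTensor H u) ⊗ₜ (S a * y) := by
          intro u
          induction u with
          | zero => simp
          | add x y hx hy =>
            simp only [map_add, TensorProduct.add_tmul, TensorProduct.tmul_add, hx, hy]
          | tmul b b' => simp [T]
        refine (e' (δ x)).trans ?_
        rw [show LinearMap.mul' k H (S.rTensor H (δ x)) = algebraMap k H (Coalgebra.counit x) from
          HopfAlgebra.mul_antipode_rTensor_comul_apply x, Algebra.algebraMap_eq_smul_one,
          TensorProduct.smul_tmul]
        simp
    have c1 : TensorProduct.map .id δ (δ x) = TensorProduct.assoc k H H H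
      (TensorProduct.map δ .id (δ x)) := (Coalgebra.coassoc_apply x).symm
    have c2 : TensorProduct.map Coalgebra.counit .id (δ x) = (1 : k) ⊗ₜ x :=
      Coalgebra.rTensor_counit_comul x
    rw [c1, e, c2, TensorProduct.lid_tmul, one_smul]
  have h3 : WithConv.toConv G * WithConv.toConv δ = 1 := by
    refine WithConv.ext (LinearMap.ext fun x => ?_)
    have c1 : TensorProduct.assoc k H H H (TensorProduct.map δ .id (δ x)) =
      TensorProduct.map .id δ (δ x) := Coalgebra.coassoc_apply x
    have e : ∀ t : H ⊗[k] H, T (TensorProduct.map .id (TensorProduct.map .id δ)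
        (TensorProduct.map .id δ t)) = (1 : H) ⊗ₜ LinearMap.mul' k H (S.rTensor H t) := by
      intro t
      induction t with
      | zero => simp
      | add x y hx hy => simp only [map_add, TensorProduct.tmul_add, hx, hy]
      | tmul x y => exact h2 x y
    refine (h1 (δ x)).trans ?_
    rw [c1, e, show LinearMap.mul' k H (S.rTensor H (δ x)) = algebraMap k H (Coalgebra.counit x)
      from HopfAlgebra.mul_antipode_rTensor_comul_apply x]
    exact (Algebra.TensorProduct.algebraMap_apply' _).symm
  have h4 := left_inv_eq_right_inv h3 (LinearMap.comul_right_inv (R := k) (C := H))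
  exact (LinearMap.congr_fun (WithConv.toConv_injective h4) a).symm

/-- The antipode, as a bialgebra morphism to `H` with both operations reversed. -/
noncomputable def antipodeBialg (o c : Bool) : Tw o c H →ₐc[k] Tw (!o) (!c) H :=
  BialgHom.ofAlgHom
    (AlgHom.ofLinearMap ((Tw.tw k (!o) (!c)).toLinearMap ∘ₗ HopfAlgebra.antipode k ∘ₗ
        (Tw.tw k o c).symm.toLinearMap)
      (HopfAlgebra.antipode_one (R := k) (A := H))
      (fun x y => by
        cases o
        · exact HopfAlgebra.antipode_mul_antidistrib (R := k) (A := H) x y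
        · exact HopfAlgebra.antipode_mul_antidistrib (R := k) (A := H) y x))
    (AlgHom.ext fun x => HopfAlgebra.counit_antipode (R := k) (A := H) x)
    (AlgHom.ext fun x => by
      let S : H →ₗ[k] H := HopfAlgebra.antipode k
      let S' : Tw o c H →ₗ[k] Tw (!o) (!c) H := (Tw.tw k (!o) (!c)).toLinearMap ∘ₗ S ∘ₗ
        (Tw.tw k o c).symm.toLinearMap
      have h1 : ∀ t : H ⊗[k] H, TensorProduct.map S' S' (Tw.twT o c c t) =
          Tw.twT (!o) (!c) (!c) (TensorProduct.map S S t) := by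
        intro t
        induction t with
        | zero => simp
        | add x y hx hy => simp only [map_add, hx, hy]
        | tmul b b' => rfl
      have h2 : ∀ y : H, TensorProduct.map S S (Tw.twComul (k := k) c y) =
          Tw.twComul (!c) (S y) := by
        intro y
        cases c
        · change TensorProduct.map S S (Coalgebra.comul y) =
            TensorProduct.comm k H H (Coalgebra.comul (S y))
          rw [comul_antipode]
          generalize Coalgebra.comul (R := k) y = u
          induction u with
          | zero => simp
          | add x y hx hy => simp only [map_add, hx, hy]
          | tmul b b' => rfl
        · exact (comul_antipode y).symm
      change TensorProduct.map S' S' (Coalgebra.comul (Tw.tw k o c ((Tw.tw k o c).symm x))) =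
        Coalgebra.comul (Tw.tw k (!o) (!c) (S ((Tw.tw k o c).symm x)))
      rw [Tw.comul_tw, Tw.comul_tw, h1, h2])

theorem antipodeBialg_apply (o c : Bool) (a : H) :
    antipodeBialg (k := k) o c (Tw.tw k o c a) =
      Tw.tw k (!o) (!c) (HopfAlgebra.antipode k a) := rfl

/-- `a ↦ a` if `o = false`, and `a ↦ S a` if `o = true`. -/
noncomputable def signRight : ∀ o : Bool, Tw o o H →ₐc[k] Tw false false H
  | false => BialgHom.id k _
  | true => antipodeBialg true true

/-- `a ↦ S a` if `o = false`, and `a ↦ a` if `o = true`. -/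
noncomputable def signLeft : ∀ o : Bool, Tw o (!o) H →ₐc[k] Tw true false H
  | false => antipodeBialg false true
  | true => BialgHom.id k _

end Antipode

section ModuleAlgebras
variable {k : Type*} [CommRing k] {B B' B₁ B₂ A : Type*} [Ring B] [Bialgebra k B] [Ring B']
  [Bialgebra k B'] [Ring B₁] [Bialgebra k B₁] [Ring B₂] [Bialgebra k B₂] [Ring A] [Algebra k A]

namespace LeftModuleAlgebra

/-- Restriction of an action along a bialgebra morphism. -/
noncomputable def pull (M : LeftModuleAlgebra k B A) (f : B' →ₐc[k] B) :
    LeftModuleAlgebra k B' A where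
  act := M.act.comp (f : B' →ₐ[k] B)
  act_one b := (M.act_one (f b)).trans (congrArg _ (CoalgHomClass.counit_comp_apply f b))
  act_mul b x y := by
    have h : ∀ t : B' ⊗[k] B', TensorProduct.map (M.act.toLinearMap.flip x)
        (M.act.toLinearMap.flip y) (TensorProduct.map (f : B' →ₗ[k] B) (f : B' →ₗ[k] B) t) =
        TensorProduct.map ((M.act.comp (f : B' →ₐ[k] B)).toLinearMap.flip x)
          ((M.act.comp (f : B' →ₐ[k] B)).toLinearMap.flip y) t := by
      intro t
      induction t with
      | zero => simp
      | add x y hx hy => simp only [map_add, hx, hy]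
      | tmul b b' => rfl
    refine (M.act_mul (f b) x y).trans (congrArg _ ?_)
    rw [← h, ← CoalgHomClass.map_comp_comul_apply]

/-- The action of a tensor product of bialgebras given by two commuting actions. -/
noncomputable def prod (M₁ : LeftModuleAlgebra k B₁ A) (M₂ : LeftModuleAlgebra k B₂ A)
    (h : ∀ a b, Commute (M₁.act a) (M₂.act b)) : LeftModuleAlgebra k (B₁ ⊗[k] B₂) A where
  act := Algebra.TensorProduct.lift M₁.act M₂.act h
  act_one b := by
    induction b with
    | zero => simp
    | add x y hx hy => simp only [map_add, LinearMap.add_apply, hx, hy]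
    | tmul b c =>
      change M₁.act b (M₂.act c 1) = algebraMap k A (Coalgebra.counit (R := k) (b ⊗ₜ[k] c))
      rw [M₂.act_one, Algebra.algebraMap_eq_smul_one, map_smul, M₁.act_one,
        TensorProduct.counit_tmul, smul_eq_mul, map_mul, Algebra.smul_def]
  act_mul b x y := by
    induction b with
    | zero => simp
    | add x y hx hy => simp only [map_add, LinearMap.add_apply, hx, hy]
    | tmul b c =>
      change M₁.act b (M₂.act c (x * y)) = _
      rw [M₂.act_mul, TensorProduct.comul_tmul]
      generalize Coalgebra.comul (R := k) c = v
      induction v with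
      | zero => simp
      | add x y hx hy => simp only [map_add, TensorProduct.tmul_add, hx, hy]
      | tmul c d =>
        rw [TensorProduct.map_tmul, LinearMap.mul'_apply, M₁.act_mul]
        generalize Coalgebra.comul (R := k) b = u
        induction u with
        | zero => simp
        | add x y hx hy => simp only [map_add, TensorProduct.add_tmul, hx, hy]
        | tmul a b => rfl

section Pi
variable {ι : Type*} [DecidableEq ι] [Fintype ι] {D A : ι → Type*} [∀ i, Ring (D i)]
  [∀ i, Bialgebra k (D i)] [∀ i, Ring (A i)] [∀ i, Algebra k (A i)]
  (M : ∀ i, LeftModuleAlgebra k (D i) (A i))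

/-- The action of `pi`. -/
noncomputable def piAct : (⨂[k] i, D i) →ₐ[k] Module.End k (⨂[k] i, A i) :=
  piLift (fun i => (onFactor i).comp (M i).act)
    (fun _ _ hij _ _ => onFactor_commute hij _ _)

theorem piAct_single (i : ι) (b : D i) :
    piAct M (PiTensorProduct.singleAlgHom i b) = onFactor i ((M i).act b) :=
  piLift_single _ _ i b

/-- The factorwise action of a tensor product of bialgebras on a tensor product of algebras. -/
noncomputable def pi : LeftModuleAlgebra k (⨂[k] i, D i) (⨂[k] i, A i) where
  act := piAct M
  act_one b := by
    have e : ∀ b c : ⨂[k] i, D i, piAct M b 1 = algebraMap k _ (piCounit b) →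
        piAct M c 1 = algebraMap k _ (piCounit c) →
        piAct M (b * c) 1 = algebraMap k _ (piCounit (b * c)) := by
      intro b c hb hc
      rw [map_mul, map_mul, Module.End.mul_apply, hc, Algebra.algebraMap_eq_smul_one, map_smul,
        hb, map_mul, Algebra.smul_def]
      exact Algebra.commutes _ _
    let P : Subalgebra k (⨂[k] i, D i) :=
      { carrier := {b | piAct M b 1 = algebraMap k _ (piCounit b)}
        mul_mem' := fun {b c} => e b c
        add_mem' := fun {b c} hb hc => by
          change piAct M (b + c) 1 = algebraMap k _ (piCounit (b + c))
          rw [map_add, map_add, map_add, LinearMap.add_apply, hb, hc]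
        algebraMap_mem' := fun r => by
          change piAct M (algebraMap k _ r) 1 = algebraMap k _ (piCounit (algebraMap k _ r))
          rw [AlgHom.commutes, AlgHom.commutes, Module.algebraMap_end_apply,
            Algebra.algebraMap_eq_smul_one]
          rfl }
    refine pi_induction P (fun i b => ?_) b
    change piAct M _ 1 = algebraMap k _ (piCounit _)
    rw [piAct_single, piCounit_single]
    change onFactor i ((M i).act b) (PiTensorProduct.tprod k 1) = _
    rw [onFactor_tprod, Pi.one_apply, (M i).act_one, Algebra.algebraMap_eq_smul_one,
      MultilinearMap.map_update_smul, Algebra.algebraMap_eq_smul_one]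
    exact congrArg (fun q => Coalgebra.counit (R := k) b • PiTensorProduct.tprod k q)
      (Function.update_eq_self i (1 : ∀ i, A i))
  act_mul b x y := by
    let E := Module.endTensorEndAlgHom (R := k) (S := k) (A := k) (M := ⨂[k] i, A i)
      (N := ⨂[k] i, A i)
    let ρ : (⨂[k] i, D i) →ₐ[k] Module.End k ((⨂[k] i, A i) ⊗[k] (⨂[k] i, A i)) :=
      (E.comp (Algebra.TensorProduct.map (piAct M) (piAct M))).comp piComul
    have h0 : ∀ (t : (⨂[k] i, D i) ⊗[k] (⨂[k] i, D i)) (x y : ⨂[k] i, A i),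
        TensorProduct.map ((piAct M).toLinearMap.flip x) ((piAct M).toLinearMap.flip y) t =
          E (Algebra.TensorProduct.map (piAct M) (piAct M) t)
            (x ⊗ₜ y) := by
      intro t x y
      induction t with
      | zero => simp
      | add x y hx hy => simp only [map_add, LinearMap.add_apply, hx, hy]
      | tmul b b' => rfl
    let m := LinearMap.mul' k (⨂[k] i, A i)
    let P : Subalgebra k (⨂[k] i, D i) :=
      { carrier := {b | ∀ z, piAct M b (m z) = m (ρ b z)}
        mul_mem' := fun {b c} hb hc z => by
          rw [map_mul, map_mul, Module.End.mul_apply, Module.End.mul_apply, hc z, hb]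
        add_mem' := fun {b c} hb hc z => by
          rw [map_add, map_add, LinearMap.add_apply, LinearMap.add_apply, hb z, hc z, map_add]
        algebraMap_mem' := fun r z => by
          rw [AlgHom.commutes, AlgHom.commutes, Module.algebraMap_end_apply,
            Module.algebraMap_end_apply, map_smul] }
    have hP : ∀ i b, PiTensorProduct.singleAlgHom i b ∈ P := by
      intro i b
      have hs : ∀ x y : ⨂[k] i, A i, onFactor i ((M i).act b) (x * y) =
          m (ρ (PiTensorProduct.singleAlgHom i b) (x ⊗ₜ y)) := by
        intro x y
        have hρ : ρ (PiTensorProduct.singleAlgHom i b) (x ⊗ₜ y) = E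
            (Algebra.TensorProduct.map (piAct M) (piAct M)
              (piComul (k := k) (A := D) (PiTensorProduct.singleAlgHom i b))) (x ⊗ₜ y) := rfl
        rw [hρ, piComul_single]
        clear hρ
        have hu : ∀ (u : D i ⊗[k] D i) (f g : ∀ i, A i), m (E
            (Algebra.TensorProduct.map (piAct M) (piAct M) (Algebra.TensorProduct.map
              (PiTensorProduct.singleAlgHom i) (PiTensorProduct.singleAlgHom i) u))
              (PiTensorProduct.tprod k f ⊗ₜ PiTensorProduct.tprod k g)) =
            PiTensorProduct.tprod k (Function.update (f * g) i (LinearMap.mul' k (A i)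
              (TensorProduct.map ((M i).act.toLinearMap.flip (f i))
                ((M i).act.toLinearMap.flip (g i)) u))) := by
          intro u f g
          induction u with
          | zero => simp [MultilinearMap.map_update_zero]
          | add x y hx hy =>
            simp only [map_add, LinearMap.add_apply, MultilinearMap.map_update_add, hx, hy]
          | tmul c d =>
            change piAct M (PiTensorProduct.singleAlgHom i c) (PiTensorProduct.tprod k f) *
              piAct M (PiTensorProduct.singleAlgHom i d) (PiTensorProduct.tprod k g) =
                PiTensorProduct.tprod k (Function.update (f * g) i
                  ((M i).act c (f i) * (M i).act d (g i)))
            rw [piAct_single, piAct_single, onFactor_tprod, onFactor_tprod,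
              PiTensorProduct.tprod_mul_tprod]
            refine congrArg _ (funext fun j => ?_)
            by_cases hj : j = i
            · subst hj; simp
            · simp [Function.update_of_ne hj]
        induction x using PiTensorProduct.induction_on with
        | add x y hx hy => simp only [add_mul, TensorProduct.add_tmul, map_add, hx, hy]
        | smul_tprod r f =>
          induction y using PiTensorProduct.induction_on with
          | add x y hx hy => simp only [mul_add, TensorProduct.tmul_add, map_add, hx, hy]
          | smul_tprod q g =>
            rw [smul_mul_smul_comm, TensorProduct.smul_tmul_smul, map_smul, map_smul, map_smul, hu,
              PiTensorProduct.tprod_mul_tprod, onFactor_tprod, Pi.mul_apply, (M i).act_mul]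
      intro z
      rw [piAct_single]
      induction z with
      | zero => simp
      | add x y hx hy => simp only [map_add, hx, hy]
      | tmul x y => exact hs x y
    have := pi_induction P hP b (x ⊗ₜ y)
    refine this.trans (congrArg m (h0 _ x y).symm)

end Pi
end LeftModuleAlgebra
end ModuleAlgebras

section Balancing
variable {k : Type*} [CommRing k] {H : Type*} [Ring H] [HopfAlgebra k H]

/-- The dual algebra `H^*`, with the convolution product `(f f')(x) = f(x₍₁₎) f'(x₍₂₎)`. -/
def DualAlgebra (k H : Type*) [CommRing k] [Ring H] [HopfAlgebra k H] : Type _ :=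
  WithConv (H →ₗ[k] k)

noncomputable instance : Ring (DualAlgebra k H) :=
  inferInstanceAs (Ring (WithConv (H →ₗ[k] k)))

noncomputable instance : Algebra k (DualAlgebra k H) :=
  inferInstanceAs (Algebra k (WithConv (H →ₗ[k] k)))

/-- The linear form underlying an element of `H^*`, as a linear equivalence. -/
noncomputable def dualForm (k H : Type*) [CommRing k] [Ring H] [HopfAlgebra k H] :
    DualAlgebra k H ≃ₗ[k] (H →ₗ[k] k) :=
  { WithConv.linearEquiv k (H →ₗ[k] k) with }

theorem dualForm_mul (f g : DualAlgebra k H) (x : H) :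
    dualForm k H (f * g) x = LinearMap.mul' k k (TensorProduct.map (dualForm k H f)
      (dualForm k H g) (Coalgebra.comul x)) := rfl

theorem dualForm_one (x : H) : dualForm k H 1 x = Coalgebra.counit x := rfl

/-- The action `a.f = f(? a)` of `H` on `H^*`, as an algebra morphism. -/
noncomputable def rightTranslationAct : Tw false false H →ₐ[k] Module.End k (DualAlgebra k H) :=
  AlgHom.ofLinearMap
  { toFun := fun a =>
      { toFun := fun f => WithConv.toConv
          (f.ofConv ∘ₗ LinearMap.mulRight k ((Tw.tw k false false).symm a))
        map_add' := fun _ _ => rfl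
        map_smul' := fun _ _ => rfl }
    map_add' := fun _ _ => LinearMap.ext fun f => WithConv.ext <| LinearMap.ext fun x =>
      (congrArg f.ofConv (mul_add x _ _)).trans (map_add f.ofConv _ _)
    map_smul' := fun r _ => LinearMap.ext fun f => WithConv.ext <| LinearMap.ext fun x =>
      (congrArg f.ofConv (mul_smul_comm r x _)).trans (map_smul f.ofConv _ _) }
  (LinearMap.ext fun f => WithConv.ext <| LinearMap.ext fun x =>
    congrArg f.ofConv (mul_one x))
  (fun _ _ => LinearMap.ext fun f => WithConv.ext <| LinearMap.ext fun x =>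
    congrArg f.ofConv (mul_assoc x _ _).symm)

/-- The action `a.f = f(? a)` of `H` on `H^*`. -/
noncomputable def rightTranslation :
    LeftModuleAlgebra k (Tw false false H) (DualAlgebra k H) where
  act := rightTranslationAct
  act_one a := WithConv.ext <| LinearMap.ext fun x => by
    change Coalgebra.counit (R := k) (x * (Tw.tw k false false).symm a) =
      Coalgebra.counit (R := k) ((Tw.tw k false false).symm a) * Coalgebra.counit (R := k) x
    rw [Bialgebra.counit_mul, mul_comm]
  act_mul a f g := WithConv.ext <| LinearMap.ext fun x => by
    let L : Tw false false H →ₗ[k] Module.End k (DualAlgebra k H) := rightTranslationAct.toLinearMap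
    have key : ∀ u : H ⊗[k] H, LinearMap.mul' k k (TensorProduct.map f.ofConv g.ofConv
        (Coalgebra.comul x * u)) = (LinearMap.mul' k (DualAlgebra k H) (TensorProduct.map
          (L.flip f) (L.flip g) (Tw.twT false false false u))).ofConv x := by
      intro u
      induction u with
      | zero => simp; rfl
      | add y z hy hz =>
        rw [mul_add, map_add, map_add, hy, hz, map_add, map_add, map_add]
        rfl
      | tmul c d =>
        change _ = LinearMap.mul' k k (TensorProduct.map (f.ofConv ∘ₗ LinearMap.mulRight k c)
          (g.ofConv ∘ₗ LinearMap.mulRight k d) (Coalgebra.comul x))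
        generalize Coalgebra.comul (R := k) x = t
        induction t with
        | zero => simp
        | add y z hy hz => simp only [map_add, add_mul, hy, hz]
        | tmul y z => rw [Algebra.TensorProduct.tmul_mul_tmul]; rfl
    have h := key (Coalgebra.comul ((Tw.tw k false false).symm a))
    rw [← Bialgebra.comul_mul] at h
    refine h.trans ?_
    have h2 := Tw.comul_tw (k := k) false false ((Tw.tw k false false).symm a)
    exact congrArg (fun q => (LinearMap.mul' k (DualAlgebra k H) (TensorProduct.map
      (L.flip f) (L.flip g) q)).ofConv x) h2.symm

/-- The action `a.f = f(a ?)` of `H`, with opposite multiplication, on `H^*`, as an algebra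
morphism. -/
noncomputable def leftTranslationAct : Tw true false H →ₐ[k] Module.End k (DualAlgebra k H) :=
  AlgHom.ofLinearMap
  { toFun := fun a =>
      { toFun := fun f => WithConv.toConv
          (f.ofConv ∘ₗ LinearMap.mulLeft k ((Tw.tw k true false).symm a))
        map_add' := fun _ _ => rfl
        map_smul' := fun _ _ => rfl }
    map_add' := fun _ _ => LinearMap.ext fun f => WithConv.ext <| LinearMap.ext fun x =>
      (congrArg f.ofConv (add_mul (R := H) _ _ x)).trans (map_add f.ofConv _ _)
    map_smul' := fun r _ => LinearMap.ext fun f => WithConv.ext <| LinearMap.ext fun x =>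
      (congrArg f.ofConv (smul_mul_assoc (β := H) r _ x)).trans (map_smul f.ofConv _ _) }
  (LinearMap.ext fun f => WithConv.ext <| LinearMap.ext fun x =>
    congrArg f.ofConv (one_mul x))
  (fun _ _ => LinearMap.ext fun f => WithConv.ext <| LinearMap.ext fun x =>
    congrArg f.ofConv (mul_assoc (G := H) _ _ x))

/-- The action `a.f = f(a ?)` of `H`, with opposite multiplication, on `H^*`. -/
noncomputable def leftTranslation :
    LeftModuleAlgebra k (Tw true false H) (DualAlgebra k H) where
  act := leftTranslationAct
  act_one a := WithConv.ext <| LinearMap.ext fun x => by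
    change Coalgebra.counit (R := k) ((Tw.tw k true false).symm a * x) =
      Coalgebra.counit (R := k) ((Tw.tw k true false).symm a) * Coalgebra.counit (R := k) x
    rw [Bialgebra.counit_mul]
  act_mul a f g := WithConv.ext <| LinearMap.ext fun x => by
    let L : Tw true false H →ₗ[k] Module.End k (DualAlgebra k H) := leftTranslationAct.toLinearMap
    have key : ∀ u : H ⊗[k] H, LinearMap.mul' k k (TensorProduct.map f.ofConv g.ofConv
        (u * Coalgebra.comul x)) = (LinearMap.mul' k (DualAlgebra k H) (TensorProduct.map
          (L.flip f) (L.flip g) (Tw.twT true false false u))).ofConv x := by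
      intro u
      induction u with
      | zero => simp; rfl
      | add y z hy hz =>
        rw [add_mul, map_add, map_add, hy, hz, map_add, map_add, map_add]
        rfl
      | tmul c d =>
        change _ = LinearMap.mul' k k (TensorProduct.map (f.ofConv ∘ₗ LinearMap.mulLeft k c)
          (g.ofConv ∘ₗ LinearMap.mulLeft k d) (Coalgebra.comul x))
        generalize Coalgebra.comul (R := k) x = t
        induction t with
        | zero => simp
        | add y z hy hz => simp only [map_add, mul_add, hy, hz]
        | tmul y z => rw [Algebra.TensorProduct.tmul_mul_tmul]; rfl
    have h := key (Coalgebra.comul ((Tw.tw k true false).symm a))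
    rw [← Bialgebra.comul_mul] at h
    refine h.trans ?_
    have h2 := Tw.comul_tw (k := k) true false ((Tw.tw k true false).symm a)
    exact congrArg (fun q => (LinearMap.mul' k (DualAlgebra k H) (TensorProduct.map
      (L.flip f) (L.flip g) q)).ofConv x) h2.symm

/-- The balancing algebra: `H^*` with the action `(a' ⊗ a).f = f(a'^⟨-ε'⟩ ? a^⟨ε⟩)`, where the sign
`ε` is negative if `o = true`, the sign `ε'` is negative if `o' = true`, and where `a^⟨1⟩ = a` and
`a^⟨-1⟩ = S a`. -/
noncomputable def balancing (o' o : Bool) :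
    LeftModuleAlgebra k (Tw o' (!o') H ⊗[k] Tw o o H) (DualAlgebra k H) :=
  (leftTranslation.pull (signLeft o')).prod (rightTranslation.pull (signRight o))
    (fun _ _ => LinearMap.ext fun f => WithConv.ext <| LinearMap.ext fun _ =>
      congrArg f.ofConv (mul_assoc (G := H) _ _ _))

theorem balancing_act (o' o : Bool) (a' : Tw o' (!o') H) (a : Tw o o H) (f : DualAlgebra k H)
    (x : H) : ((balancing (k := k) o' o).act (a' ⊗ₜ a) f).ofConv x =
      f.ofConv ((Tw.tw k true false).symm (signLeft (k := k) o' a') * x *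
        (Tw.tw k false false).symm (signRight (k := k) o a)) := rfl

end Balancing

/-- A cell decomposition of a compact oriented surface, possibly with boundary, with sets `V` of
vertices, `E` of edges and `F` of faces. Each boundary circle of the surface is filled by a disk,
whose interior is recorded as a face in `bdry`; the remaining faces are the plaquettes.

The half-edge `(e, true)` is the half-edge of `e` at its source, directed away from its vertex, and
`(e, false)` is the half-edge of `e` at its target, directed towards its vertex. The permutation
`rot` maps a half-edge to the next one at the same vertex in counterclockwise order, so that the
vertices are its cycles.

The corner between the half-edges `d` and `rot d` at their vertex is also denoted by `d`. As seen
from the vertex it is bounded by `d` on the right and by `rot d` on the left. Walking along the edge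
of `rot d` to its other end, with the face of the corner on the right-hand side, one arrives at the
next corner of this face in clockwise order, so that the faces are the cycles of `next`. In
particular, `face (e, true)` and `face (e, false)` are the faces on the left and on the right of the
edge `e`. -/
structure CellDecomposition (V E F : Type*) where
  rot : Equiv.Perm (E × Bool)
  vert : E × Bool → V
  vert_surjective : Function.Surjective vert
  vert_eq_iff : ∀ d d', vert d = vert d' ↔ rot.SameCycle d d'
  face : E × Bool → F
  face_surjective : Function.Surjective face
  face_eq_iff : ∀ d d', face d = face d' ↔
    Equiv.Perm.SameCycle (rot.trans (Equiv.prodCongr (Equiv.refl E) Equiv.boolNot)) d d'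
  bdry : Set F
  /-- A boundary circle passes at most once through a vertex. -/
  bdry_vert : ∀ d d', face d ∈ bdry → face d' ∈ bdry → vert d = vert d' → d = d'
  /-- An edge has a plaquette on at least one of its sides. -/
  bdry_edge : ∀ e, face (e, true) ∉ bdry ∨ face (e, false) ∉ bdry

namespace CellDecomposition
variable {V E F : Type*} (Γ : CellDecomposition V E F)

/-- The next corner of the same face, in clockwise order. -/
def next : Equiv.Perm (E × Bool) :=
  Γ.rot.trans (Equiv.prodCongr (Equiv.refl E) Equiv.boolNot)

theorem vert_rot (d : E × Bool) : Γ.vert (Γ.rot d) = Γ.vert d :=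
  (Γ.vert_eq_iff _ _).2 (Equiv.Perm.sameCycle_apply_left.2 (Equiv.Perm.SameCycle.refl _ _))

theorem face_next (d : E × Bool) : Γ.face (Γ.next d) = Γ.face d :=
  (Γ.face_eq_iff _ _).2 (Equiv.Perm.sameCycle_apply_left.2 (Equiv.Perm.SameCycle.refl _ _))

theorem face_next_pow (d : E × Bool) (n : ℕ) : Γ.face ((Γ.next ^ n) d) = Γ.face d :=
  (Γ.face_eq_iff _ _).2 (Equiv.Perm.sameCycle_pow_left.2 (Equiv.Perm.SameCycle.refl _ _))

/-- The half-edges at a vertex, and also the corners at a vertex. -/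
abbrev At (v : V) : Type _ := {d : E × Bool // Γ.vert d = v}

/-- The counterclockwise rotation at a vertex. -/
def rotAt (v : V) : Equiv.Perm (Γ.At v) :=
  Γ.rot.subtypePerm fun d => by rw [Γ.vert_rot d]

/-- Neither the cell decomposition nor its dual has loops. -/
def Regular : Prop :=
  ∀ e, Γ.vert (e, true) ≠ Γ.vert (e, false) ∧ Γ.face (e, true) ≠ Γ.face (e, false)

end CellDecomposition

/-- Labels for the faces and edges of a cell decomposition: finite-dimensional semisimple Hopf
algebras for the plaquettes and the ground field for the filled boundary circles, and for each edge
a finite-dimensional semisimple bicomodule algebra over the labels of the faces on its left and on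
its right. -/
structure Labelling (k : Type*) [Field k] {V E F : Type*} (Γ : CellDecomposition V E F) where
  H : F → Type*
  [ring : ∀ f, Ring (H f)]
  [hopf : ∀ f, HopfAlgebra k (H f)]
  [finite : ∀ f, Module.Finite k (H f)]
  [semisimple : ∀ f, IsSemisimpleRing (H f)]
  bdry : ∀ f, f ∈ Γ.bdry → Function.Bijective (algebraMap k (H f))
  K : E → Type*
  [edgeRing : ∀ e, Ring (K e)]
  [edgeAlgebra : ∀ e, Algebra k (K e)]
  [edgeFinite : ∀ e, Module.Finite k (K e)]
  [edgeSemisimple : ∀ e, IsSemisimpleRing (K e)]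
  coact : ∀ e, BicomoduleAlgebra k (H (Γ.face (e, true))) (H (Γ.face (e, false))) (K e)

namespace Labelling
attribute [instance] ring hopf finite semisimple edgeRing edgeAlgebra edgeFinite edgeSemisimple

variable {k : Type*} [Field k] {V E F : Type*} {Γ : CellDecomposition V E F}
  (L : Labelling k Γ)

/-- The algebra `K_e^ε` of a half-edge: `K_e` or its opposite algebra, according to whether the
half-edge is directed away from or towards its vertex. -/
def HalfEdgeAlgebra (d : E × Bool) : Type _ := Tw (!d.2) false (L.K d.1)

noncomputable instance (d : E × Bool) : Ring (L.HalfEdgeAlgebra d) :=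
  inferInstanceAs (Ring (Tw (!d.2) false (L.K d.1)))

noncomputable instance (d : E × Bool) : Algebra k (L.HalfEdgeAlgebra d) :=
  inferInstanceAs (Algebra k (Tw (!d.2) false (L.K d.1)))

/-- `(H^ε)^cop`, for the face `f` and the sign `ε` which is positive if `b = true`. -/
abbrev CopFace (b : Bool) (f : F) : Type _ := Tw (!b) (!!b) (L.H f)

/-- `H^ε`, for the face `f` and the sign `ε` which is positive if `b = true`. -/
abbrev SignedFace (b : Bool) (f : F) : Type _ := Tw (!b) (!b) (L.H f)

/-- The bialgebra acting on the balancing algebra of a corner, `(H^ε')^cop ⊗ H^ε`, where `ε` and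
`ε'` are the signs of the half-edges on the right and on the left. -/
def CornerBialgebra (s : E × Bool) : Type _ :=
  L.CopFace (Γ.rot s).2 (Γ.face s) ⊗[k] L.SignedFace s.2 (Γ.face s)

noncomputable instance (s : E × Bool) : Ring (L.CornerBialgebra s) :=
  inferInstanceAs (Ring (L.CopFace (Γ.rot s).2 (Γ.face s) ⊗[k] L.SignedFace s.2 (Γ.face s)))

noncomputable instance (s : E × Bool) : Bialgebra k (L.CornerBialgebra s) :=
  inferInstanceAs (Bialgebra k (L.CopFace (Γ.rot s).2 (Γ.face s) ⊗[k]
    L.SignedFace s.2 (Γ.face s)))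

/-- The inclusion of the first factor. -/
noncomputable def cornerLeft (s : E × Bool) :
    L.CopFace (Γ.rot s).2 (Γ.face s) →ₐc[k] L.CornerBialgebra s :=
  inclLeft (k := k) (B₁ := L.CopFace (Γ.rot s).2 (Γ.face s)) (B₂ := L.SignedFace s.2 (Γ.face s))

/-- The inclusion of the second factor. -/
noncomputable def cornerRight (s : E × Bool) :
    L.SignedFace s.2 (Γ.face s) →ₐc[k] L.CornerBialgebra s :=
  inclRight (k := k) (B₁ := L.CopFace (Γ.rot s).2 (Γ.face s)) (B₂ := L.SignedFace s.2 (Γ.face s))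

theorem commute_corner (s : E × Bool) (a b) : Commute (L.cornerLeft s a) (L.cornerRight s b) :=
  commute_inclLeft_inclRight (k := k) (B₁ := L.CopFace (Γ.rot s).2 (Γ.face s))
    (B₂ := L.SignedFace s.2 (Γ.face s)) a b

/-- The bialgebra coacting on the algebra of a half-edge, `(H'^ε)^cop ⊗ H^ε`, where `H'` and `H` are
the labels of the faces on its right and on its left. -/
abbrev HalfEdgeBialgebra (d : E × Bool) : Type _ :=
  L.CopFace d.2 (Γ.face (d.1, !d.2)) ⊗[k] L.SignedFace d.2 (Γ.face d)

/-- The coaction of the faces on both sides of a half-edge. -/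
noncomputable def halfEdgeCoaction :
    ∀ d : E × Bool, LeftComoduleAlgebra k (L.HalfEdgeBialgebra d) (L.HalfEdgeAlgebra d)
  | (e, true) => (L.coact e).legsOut
  | (e, false) => (L.coact e).legsIn

/-- Equal faces have equal labels. -/
noncomputable def castBialg (o c : Bool) {f₁ f₂ : F} (h : f₁ = f₂) :
    Tw o c (L.H f₁) →ₐc[k] Tw o c (L.H f₂) :=
  match f₂, h with
  | _, rfl => BialgHom.id k _

section Vertex
variable [Fintype E] [DecidableEq E] [DecidableEq V]

/-- The tensor product of the bialgebras of the corners at a vertex. -/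
def VertexBialgebra (v : V) : Type _ := ⨂[k] s : Γ.At v, L.CornerBialgebra s.1

noncomputable instance (v : V) : Ring (L.VertexBialgebra v) :=
  inferInstanceAs (Ring (⨂[k] s : Γ.At v, L.CornerBialgebra s.1))

noncomputable instance (v : V) : Bialgebra k (L.VertexBialgebra v) :=
  inferInstanceAs (Bialgebra k (⨂[k] s : Γ.At v, L.CornerBialgebra s.1))

/-- The inclusion of the bialgebra of a corner. -/
noncomputable def cornerIncl (v : V) (s : Γ.At v) :
    L.CornerBialgebra s.1 →ₐc[k] L.VertexBialgebra v :=
  piSingle (k := k) (A := fun s : Γ.At v => L.CornerBialgebra s.1) s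

/-- The projection to the bialgebra of a corner, applying the counit to the other factors. -/
noncomputable def cornerProj (v : V) (s : Γ.At v) :
    L.VertexBialgebra v →ₐc[k] L.CornerBialgebra s.1 :=
  piProj (k := k) (A := fun s : Γ.At v => L.CornerBialgebra s.1) s

theorem commute_cornerIncl (v : V) (s t : Γ.At v) (h : s ≠ t) (a b) :
    Commute (L.cornerIncl v s a) (L.cornerIncl v t b) :=
  commute_single (k := k) (A := fun s : Γ.At v => L.CornerBialgebra s.1) h a b

/-- The algebra `K_v`, the tensor product of the algebras of the half-edges at `v`. -/
def KAt (v : V) : Type _ := ⨂[k] d : Γ.At v, L.HalfEdgeAlgebra d.1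

noncomputable instance (v : V) : Ring (L.KAt v) :=
  inferInstanceAs (Ring (⨂[k] d : Γ.At v, L.HalfEdgeAlgebra d.1))

noncomputable instance (v : V) : Algebra k (L.KAt v) :=
  inferInstanceAs (Algebra k (⨂[k] d : Γ.At v, L.HalfEdgeAlgebra d.1))

/-- The tensor product of the dual algebras of the labels of the corners at `v`. -/
def HAt (v : V) : Type _ := ⨂[k] s : Γ.At v, DualAlgebra k (L.H (Γ.face s.1))

noncomputable instance (v : V) : Ring (L.HAt v) :=
  inferInstanceAs (Ring (⨂[k] s : Γ.At v, DualAlgebra k (L.H (Γ.face s.1))))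

noncomputable instance (v : V) : Algebra k (L.HAt v) :=
  inferInstanceAs (Algebra k (⨂[k] s : Γ.At v, DualAlgebra k (L.H (Γ.face s.1))))

/-- The identity map, as an algebra morphism to `HAt`. -/
noncomputable def toHAt (v : V) :
    (⨂[k] s : Γ.At v, DualAlgebra k (L.H (Γ.face s.1))) →ₐ[k] L.HAt v :=
  AlgHom.id k (⨂[k] s : Γ.At v, DualAlgebra k (L.H (Γ.face s.1)))

/-- The inclusion of the dual of the label of a corner. -/
noncomputable def hAtSingle (v : V) (s : Γ.At v) :
    DualAlgebra k (L.H (Γ.face s.1)) →ₐ[k] L.HAt v :=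
  (L.toHAt v).comp (PiTensorProduct.singleAlgHom
    (A := fun s : Γ.At v => DualAlgebra k (L.H (Γ.face s.1))) s)

theorem hAtSingle_commute (v : V) (s t : Γ.At v) (h : s ≠ t) (f g) :
    Commute (L.hAtSingle v s f) (L.hAtSingle v t g) :=
  (commute_single (k := k) (A := fun s : Γ.At v => DualAlgebra k (L.H (Γ.face s.1)))
    h f g).map (L.toHAt v)

/-- The inclusion of the bialgebra of the right-hand side of the half-edge `d`, which is the
half-edge on the left of the corner `s`. -/
noncomputable def rightIncl (v : V) (s d : Γ.At v) (h : Γ.rotAt v s = d) :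
    L.CopFace d.1.2 (Γ.face (d.1.1, !d.1.2)) →ₐc[k] L.VertexBialgebra v :=
  match d, h with
  | _, rfl => (L.cornerIncl v s).comp
      ((L.cornerLeft s.1).comp (L.castBialg _ _ (Γ.face_next s.1)))

/-- The inclusion of the bialgebra of the left-hand side of the half-edge `d`, which is the
half-edge on the right of the corner `d`. -/
noncomputable def leftIncl (v : V) (d : Γ.At v) :
    L.SignedFace d.1.2 (Γ.face d.1) →ₐc[k] L.VertexBialgebra v :=
  (L.cornerIncl v d).comp (L.cornerRight d.1)

theorem rightIncl_apply (v : V) (s d : Γ.At v) (h : Γ.rotAt v s = d) (a) :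
    ∃ b, L.rightIncl v s d h a = L.cornerIncl v s (L.cornerLeft s.1 b) := by
  subst h
  exact ⟨_, rfl⟩

theorem commute_rightIncl_leftIncl (v : V) (s d d' : Γ.At v) (h : Γ.rotAt v s = d) (a b) :
    Commute (L.rightIncl v s d h a) (L.leftIncl v d' b) := by
  obtain ⟨c, hc⟩ := L.rightIncl_apply v s d h a
  rw [hc]
  by_cases hs : s = d'
  · subst hs
    exact (L.commute_corner s.1 c b).map (L.cornerIncl v s)
  · exact L.commute_cornerIncl v _ _ hs _ _

theorem commute_rightIncl_rightIncl (v : V) (s s' d d' : Γ.At v) (h : Γ.rotAt v s = d)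
    (h' : Γ.rotAt v s' = d') (hd : d ≠ d') (a b) :
    Commute (L.rightIncl v s d h a) (L.rightIncl v s' d' h' b) := by
  obtain ⟨c, hc⟩ := L.rightIncl_apply v s d h a
  obtain ⟨c', hc'⟩ := L.rightIncl_apply v s' d' h' b
  rw [hc, hc']
  exact L.commute_cornerIncl v _ _ (fun e => hd (by rw [← h, ← h', e])) _ _

/-- The inclusion of the bialgebra coacting on a half-edge at `v`: its right-hand side is on the
left of the corner before it, and its left-hand side is on the right of the corner after it. -/
noncomputable def halfEdgeIncl (v : V) (d : Γ.At v) :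
    L.HalfEdgeBialgebra d.1 →ₐc[k] L.VertexBialgebra v :=
  liftBialg (L.rightIncl v ((Γ.rotAt v).symm d) d (Equiv.apply_symm_apply _ _)) (L.leftIncl v d)
    (L.commute_rightIncl_leftIncl v _ _ _ _)

theorem halfEdgeIncl_commute (v : V) (d d' : Γ.At v) (hd : d ≠ d') (a b) :
    Commute (L.halfEdgeIncl v d a) (L.halfEdgeIncl v d' b) := by
  induction a using TensorProduct.induction_on with
  | zero => rw [map_zero]; exact Commute.zero_left _
  | add x y hx hy => rw [map_add]; exact hx.add_left hy
  | tmul x y =>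
    induction b using TensorProduct.induction_on with
    | zero => rw [map_zero]; exact Commute.zero_right _
    | add x y hx hy => rw [map_add]; exact hx.add_right hy
    | tmul z w =>
      refine Commute.mul_left (Commute.mul_right ?_ ?_) (Commute.mul_right ?_ ?_)
      · exact L.commute_rightIncl_rightIncl v _ _ _ _ _ _ hd _ _
      · exact L.commute_rightIncl_leftIncl v _ _ _ _ _ _
      · exact (L.commute_rightIncl_leftIncl v _ _ _ _ _ _).symm
      · exact L.commute_cornerIncl v _ _ hd _ _

/-- The comodule algebra `K_v`. -/
noncomputable def coactAt (v : V) : LeftComoduleAlgebra k (L.VertexBialgebra v) (L.KAt v) :=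
  LeftComoduleAlgebra.pi (fun d : Γ.At v => L.halfEdgeCoaction d.1) (L.halfEdgeIncl v)
    (L.halfEdgeIncl_commute v)

/-- The balancing algebra of a corner. -/
noncomputable def balancingAt (s : E × Bool) :
    LeftModuleAlgebra k (L.CornerBialgebra s) (DualAlgebra k (L.H (Γ.face s))) :=
  balancing (!(Γ.rot s).2) (!s.2)

/-- The module algebra `⨂ H_p^*` of the corners at `v`. -/
noncomputable def actAt (v : V) : LeftModuleAlgebra k (L.VertexBialgebra v) (L.HAt v) :=
  LeftModuleAlgebra.pi fun s : Γ.At v => L.balancingAt s.1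

/-- The vertex algebra `C_v`. -/
abbrev VertexAlgebra (v : V) : Type _ := CrossedProduct (L.actAt v) (L.coactAt v)

/-- The crossed product `H_p^* ⋉ K_v` of the balancing algebra of one corner with `K_v`, for the
coaction on `K_v` of the bialgebra of this corner. -/
abbrev SiteAlgebra (s : E × Bool) : Type _ :=
  CrossedProduct (L.balancingAt s)
    ((L.coactAt (Γ.vert s)).push (L.cornerProj (Γ.vert s) ⟨s, rfl⟩))

end Vertex
end Labelling

section Dual
variable {k : Type*} [CommRing k] {H : Type*} [Ring H] [HopfAlgebra k H]

theorem dualForm_ext {f g : DualAlgebra k H} (h : ∀ x, dualForm k H f x = dualForm k H g x) :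
    f = g :=
  (dualForm k H).injective (LinearMap.ext h)

/-- Evaluation at `1`, the counit of `H^*`. -/
noncomputable def dualCounit (k H : Type*) [CommRing k] [Ring H] [HopfAlgebra k H] :
    DualAlgebra k H →ₐ[k] k :=
  AlgHom.ofLinearMap (LinearMap.applyₗ (1 : H) ∘ₗ (dualForm k H).toLinearMap)
    ((dualForm_one (k := k) (1 : H)).trans Bialgebra.counit_one)
    (fun f g => by
      change dualForm k H (f * g) 1 = dualForm k H f 1 * dualForm k H g 1
      rw [dualForm_mul, Bialgebra.comul_one]
      rfl)

/-- The antipode of `H^*`, given by `f ↦ f ∘ S`. -/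
noncomputable def dualAntipode (k H : Type*) [CommRing k] [Ring H] [HopfAlgebra k H] :
    DualAlgebra k H →ₐ[k] (DualAlgebra k H)ᵐᵒᵖ :=
  AlgHom.ofLinearMap
    ((MulOpposite.opLinearEquiv k).toLinearMap ∘ₗ (dualForm k H).symm.toLinearMap ∘ₗ
      LinearMap.lcomp k k (HopfAlgebra.antipode k) ∘ₗ (dualForm k H).toLinearMap)
    (MulOpposite.unop_injective <| dualForm_ext fun x => HopfAlgebra.counit_antipode x)
    (fun f g => MulOpposite.unop_injective <| dualForm_ext fun x => by
      change LinearMap.mul' k k (TensorProduct.map (dualForm k H f) (dualForm k H g)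
        (Coalgebra.comul (HopfAlgebra.antipode k x))) = LinearMap.mul' k k (TensorProduct.map
          (dualForm k H g ∘ₗ HopfAlgebra.antipode k) (dualForm k H f ∘ₗ HopfAlgebra.antipode k)
            (Coalgebra.comul x))
      rw [comul_antipode]
      generalize Coalgebra.comul (R := k) x = u
      induction u with
      | zero => simp
      | add p q hp hq => simp only [map_add, hp, hq]
      | tmul p q => exact mul_comm _ _)

variable [Module.Finite k H] [Module.Free k H]

/-- The identification of `H^* ⊗ H^*` with the dual of `H ⊗ H`. -/
noncomputable def dualPair (k H : Type*) [CommRing k] [Ring H] [HopfAlgebra k H]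
    [Module.Finite k H] [Module.Free k H] :
    DualAlgebra k H ⊗[k] DualAlgebra k H ≃ₗ[k] Module.Dual k (H ⊗[k] H) :=
  (TensorProduct.congr (dualForm k H) (dualForm k H)).trans (TensorProduct.dualDistribEquiv k H H)

theorem dualPair_tmul (f g : DualAlgebra k H) (x y : H) :
    dualPair k H (f ⊗ₜ g) (x ⊗ₜ y) = dualForm k H f x * dualForm k H g y := rfl

theorem dualPair_mul (s t : DualAlgebra k H ⊗[k] DualAlgebra k H) (x y : H) :
    dualPair k H (s * t) (x ⊗ₜ y) = LinearMap.mul' k k (TensorProduct.map (dualPair k H s)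
      (dualPair k H t) (TensorProduct.tensorTensorTensorComm k H H H H
        (Coalgebra.comul x ⊗ₜ Coalgebra.comul y))) := by
  induction s with
  | zero => simp
  | add a b ha hb =>
    rw [add_mul, map_add, map_add, LinearMap.add_apply, ha, hb, TensorProduct.map_add_left,
      LinearMap.add_apply, map_add]
  | tmul a b =>
    induction t with
    | zero => simp
    | add a b ha hb =>
      rw [mul_add, map_add, map_add, LinearMap.add_apply, ha, hb,
        TensorProduct.map_add_right, LinearMap.add_apply, map_add]
    | tmul c d =>
      rw [Algebra.TensorProduct.tmul_mul_tmul]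
      change LinearMap.mul' k k (TensorProduct.map (dualForm k H a) (dualForm k H c)
        (Coalgebra.comul x)) * LinearMap.mul' k k (TensorProduct.map (dualForm k H b)
          (dualForm k H d) (Coalgebra.comul y)) = _
      generalize Coalgebra.comul (R := k) x = u
      generalize Coalgebra.comul (R := k) y = v
      induction u with
      | zero => simp
      | add p q hp hq => simp only [map_add, TensorProduct.add_tmul, add_mul, hp, hq]
      | tmul p q =>
        induction v with
        | zero => simp
        | add p q hp hq => simp only [map_add, TensorProduct.tmul_add, mul_add, hp, hq]
        | tmul r s => exact mul_mul_mul_comm _ _ _ _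

/-- The comultiplication of `H^*`, given by `f(x y) = f₍₁₎(x) f₍₂₎(y)`. -/
noncomputable def dualComul (k H : Type*) [CommRing k] [Ring H] [HopfAlgebra k H]
    [Module.Finite k H] [Module.Free k H] :
    DualAlgebra k H →ₐ[k] DualAlgebra k H ⊗[k] DualAlgebra k H :=
  AlgHom.ofLinearMap
    ((dualPair k H).symm.toLinearMap ∘ₗ (LinearMap.lcomp k k (LinearMap.mul' k H)) ∘ₗ
      (dualForm k H).toLinearMap)
    (by
      refine (dualPair k H).symm_apply_eq.2 (TensorProduct.ext' fun x y => ?_)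
      exact Bialgebra.counit_mul x y)
    (fun f g => by
      refine (dualPair k H).symm_apply_eq.2 (TensorProduct.ext' fun x y => ?_)
      rw [dualPair_mul]
      change dualForm k H (f * g) (x * y) = LinearMap.mul' k k (TensorProduct.map
        (dualPair k H ((dualPair k H).symm (dualForm k H f ∘ₗ LinearMap.mul' k H)))
        (dualPair k H ((dualPair k H).symm (dualForm k H g ∘ₗ LinearMap.mul' k H))) _)
      rw [LinearEquiv.apply_symm_apply, LinearEquiv.apply_symm_apply, dualForm_mul,
        Bialgebra.comul_mul]
      generalize Coalgebra.comul (R := k) x = u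
      generalize Coalgebra.comul (R := k) y = v
      induction u with
      | zero => simp
      | add p q hp hq => simp only [map_add, TensorProduct.add_tmul, add_mul, hp, hq]
      | tmul p q =>
        induction v with
        | zero => simp
        | add p q hp hq => simp only [map_add, TensorProduct.tmul_add, mul_add, hp, hq]
        | tmul r s =>
          rw [Algebra.TensorProduct.tmul_mul_tmul]
          rfl)

theorem dualPair_dualComul (f : DualAlgebra k H) (x y : H) :
    dualPair k H (dualComul k H f) (x ⊗ₜ y) = dualForm k H f (x * y) := by
  change dualPair k H ((dualPair k H).symm (dualForm k H f ∘ₗ LinearMap.mul' k H)) _ = _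
  rw [LinearEquiv.apply_symm_apply]
  rfl

variable {S : Type*} [Ring S] [Algebra k S]

/-- The convolution product of a list of maps defined on `H^*`: if these are right actions of `H^*`
on a vector space, then `f` acts by letting `f₍₁₎`, `f₍₂₎`, … act one after the other. -/
noncomputable def convProd : List (DualAlgebra k H →ₐ[k] S) → DualAlgebra k H →ₗ[k] S
  | [] => Algebra.linearMap k S ∘ₗ (dualCounit k H).toLinearMap
  | r :: l => LinearMap.mul' k S ∘ₗ TensorProduct.map r.toLinearMap (convProd l) ∘ₗ
      (dualComul k H).toLinearMap

theorem commute_convProd (b : S) : ∀ l : List (DualAlgebra k H →ₐ[k] S),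
    (∀ r ∈ l, ∀ f, Commute (r f) b) → ∀ f, Commute (convProd l f) b
  | [], _, f => Algebra.commutes _ b
  | r :: l, h, f => by
    change Commute (LinearMap.mul' k S (TensorProduct.map r.toLinearMap (convProd l)
      (dualComul k H f))) b
    generalize dualComul k H f = t
    induction t with
    | zero => rw [map_zero, map_zero]; exact Commute.zero_left _
    | add x y hx hy => rw [map_add, map_add]; exact hx.add_left hy
    | tmul x y =>
      exact (h r (by simp) x).mul_left
        (commute_convProd b l (fun r hr => h r (List.mem_cons_of_mem _ hr)) y)

theorem convProd_one : ∀ l : List (DualAlgebra k H →ₐ[k] S), convProd l 1 = 1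
  | [] => by
    change algebraMap k S (dualCounit k H 1) = 1
    rw [map_one, map_one]
  | r :: l => by
    change LinearMap.mul' k S (TensorProduct.map r.toLinearMap (convProd l)
      (dualComul k H 1)) = 1
    rw [map_one]
    change r 1 * convProd l 1 = 1
    rw [map_one, convProd_one, one_mul]

theorem convProd_mul : ∀ l : List (DualAlgebra k H →ₐ[k] S),
    l.Pairwise (fun r r' => ∀ f f', Commute (r f) (r' f')) → ∀ f g,
      convProd l (f * g) = convProd l f * convProd l g
  | [], _, f, g => by
    change algebraMap k S (dualCounit k H (f * g)) = _
    rw [map_mul, map_mul]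
    rfl
  | r :: l, h, f, g => by
    rw [List.pairwise_cons] at h
    change LinearMap.mul' k S (TensorProduct.map r.toLinearMap (convProd l)
      (dualComul k H (f * g))) = LinearMap.mul' k S (TensorProduct.map r.toLinearMap (convProd l)
      (dualComul k H f)) * LinearMap.mul' k S (TensorProduct.map r.toLinearMap (convProd l)
      (dualComul k H g))
    rw [map_mul]
    generalize dualComul k H f = s
    generalize dualComul k H g = t
    induction s with
    | zero => simp
    | add x y hx hy => simp only [map_add, add_mul, hx, hy]
    | tmul x y =>
      induction t with
      | zero => simp
      | add x y hx hy => simp only [map_add, mul_add, hx, hy]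
      | tmul z w =>
        rw [Algebra.TensorProduct.tmul_mul_tmul]
        change r (x * z) * convProd l (y * w) = r x * convProd l y * (r z * convProd l w)
        rw [map_mul, convProd_mul l h.2]
        have hc : Commute (convProd l y) (r z) :=
          commute_convProd _ _ (fun r' hr' f => (h.1 r' hr' z f).symm) _
        exact (hc.symm.mul_mul_mul_comm _ _)

/-- The convolution product of a list of pairwise commuting actions. -/
noncomputable def convProdHom (l : List (DualAlgebra k H →ₐ[k] S))
    (h : l.Pairwise (fun r r' => ∀ f f', Commute (r f) (r' f'))) : DualAlgebra k H →ₐ[k] S :=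
  AlgHom.ofLinearMap (convProd l) (convProd_one l) (convProd_mul l h)

end Dual

section Operators
variable {k : Type*} [CommRing k]

/-- Post-composition of linear maps `M → N` with an endomorphism of `N`. -/
noncomputable def postcomp (k M N : Type*) [CommRing k] [AddCommGroup M] [Module k M]
    [AddCommGroup N] [Module k N] : Module.End k N →ₐ[k] Module.End k (M →ₗ[k] N) :=
  AlgHom.ofLinearMap (LinearMap.llcomp k M N N) rfl (fun _ _ => rfl)

/-- Pre-composition of linear maps `M → N` with an endomorphism of `M`. -/
noncomputable def precomp (k M N : Type*) [CommRing k] [AddCommGroup M] [Module k M]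
    [AddCommGroup N] [Module k N] : Module.End k M →ₐ[k] (Module.End k (M →ₗ[k] N))ᵐᵒᵖ :=
  AlgHom.ofLinearMap
    ((MulOpposite.opLinearEquiv k).toLinearMap ∘ₗ (LinearMap.llcomp k M M N).flip)
    rfl (fun _ _ => rfl)

theorem postcomp_precomp_commute {M N : Type*} [AddCommGroup M] [Module k M]
    [AddCommGroup N] [Module k N] (a : Module.End k N) (b : Module.End k M) :
    Commute (postcomp k M N a) (precomp k M N b).unop := rfl

/-- An `A`-bimodule structure on a vector space. -/
structure BimoduleStructure (k A M : Type*) [CommRing k] [Ring A] [Algebra k A] [AddCommGroup M]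
    [Module k M] where
  left : A →ₐ[k] Module.End k M
  right : A →ₐ[k] (Module.End k M)ᵐᵒᵖ
  comm : ∀ a b, Commute (left a) (right b).unop

/-- The operator `x ↦ a.x.b`. -/
noncomputable def BimoduleStructure.act {A M : Type*} [Ring A] [Algebra k A] [AddCommGroup M]
    [Module k M] (β : BimoduleStructure k A M) (a b : A) : Module.End k M :=
  β.left a * (β.right b).unop

end Operators

section EdgeAction
variable {k : Type*} [CommRing k] {H K : Type*} [Ring H] [HopfAlgebra k H] [Ring K] [Algebra k K]

/-- The action `f.x = x₍₀₎ f(x₍₁₎)` of `H^*` on a right `H`-comodule algebra. -/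
noncomputable def rightDualAct (N : RightComoduleAlgebra k H K) :
    DualAlgebra k H →ₐ[k] Module.End k K :=
  AlgHom.ofLinearMap
    { toFun := fun f => (TensorProduct.rid k K).toLinearMap ∘ₗ
        TensorProduct.map LinearMap.id (dualForm k H f) ∘ₗ N.coact.toLinearMap
      map_add' := fun f g => by
        rw [map_add, TensorProduct.map_add_right, LinearMap.add_comp, LinearMap.comp_add]
      map_smul' := fun r f => by
        rw [map_smul, TensorProduct.map_smul_right, LinearMap.smul_comp, LinearMap.comp_smul]
        rfl }
    (LinearMap.ext fun x => N.counit x)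
    (fun f g => LinearMap.ext fun x => by
      let G : K ⊗[k] (H ⊗[k] H) →ₗ[k] K := (TensorProduct.rid k K).toLinearMap ∘ₗ
        TensorProduct.map LinearMap.id (LinearMap.mul' k k ∘ₗ
          TensorProduct.map (dualForm k H f) (dualForm k H g))
      have h1 : ∀ t : K ⊗[k] H, TensorProduct.rid k K (TensorProduct.map LinearMap.id
          (dualForm k H (f * g)) t) = G (TensorProduct.map LinearMap.id Coalgebra.comul t) := by
        intro t
        induction t with
        | zero => simp
        | add x y hx hy => simp only [map_add, hx, hy]
        | tmul x y => rfl
      have h2 : ∀ t : K ⊗[k] H, TensorProduct.rid k K (TensorProduct.map LinearMap.id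
          (dualForm k H f) (N.coact (TensorProduct.rid k K (TensorProduct.map LinearMap.id
            (dualForm k H g) t)))) = G (TensorProduct.assoc k K H H
              (TensorProduct.map N.coact.toLinearMap LinearMap.id t)) := by
        intro t
        induction t with
        | zero => simp
        | add x y hx hy => simp only [map_add, hx, hy]
        | tmul x y =>
          rw [TensorProduct.map_tmul, TensorProduct.map_tmul, TensorProduct.rid_tmul, map_smul,
            map_smul, map_smul, AlgHom.toLinearMap_apply]
          generalize N.coact x = u
          induction u with
          | zero => simp
          | add x y hx hy => simp only [map_add, TensorProduct.add_tmul, smul_add, hx, hy]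
          | tmul x z =>
            change dualForm k H g y • dualForm k H f z • x =
              (dualForm k H f z * dualForm k H g y) • x
            rw [smul_smul, mul_comm]
      exact (h1 _).trans ((congrArg G (N.coassoc x).symm).trans (h2 _).symm))

/-- The action `f.x = f(S x₍₋₁₎) x₍₀₎` of `H^*` on a left `H`-comodule algebra. -/
noncomputable def leftDualAct (N : LeftComoduleAlgebra k H K) :
    DualAlgebra k H →ₐ[k] Module.End k K :=
  AlgHom.ofLinearMap
    { toFun := fun f => (TensorProduct.lid k K).toLinearMap ∘ₗ
        TensorProduct.map (dualForm k H f ∘ₗ HopfAlgebra.antipode k) LinearMap.id ∘ₗ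
          N.coact.toLinearMap
      map_add' := fun f g => by
        rw [map_add, LinearMap.add_comp, TensorProduct.map_add_left, LinearMap.add_comp,
          LinearMap.comp_add]
      map_smul' := fun r f => by
        rw [map_smul, LinearMap.smul_comp, TensorProduct.map_smul_left, LinearMap.smul_comp,
          LinearMap.comp_smul]
        rfl }
    (LinearMap.ext fun x => by
      refine Eq.trans ?_ (N.counit x)
      have h : dualForm k H 1 ∘ₗ HopfAlgebra.antipode k = Coalgebra.counit (R := k) :=
        LinearMap.ext fun x => HopfAlgebra.counit_antipode x
      change TensorProduct.lid k K (TensorProduct.map (dualForm k H 1 ∘ₗ HopfAlgebra.antipode k)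
        LinearMap.id (N.coact x)) = _
      rw [h])
    (fun f g => LinearMap.ext fun x => by
      let F : H →ₗ[k] k := dualForm k H f ∘ₗ HopfAlgebra.antipode k
      let F' : H →ₗ[k] k := dualForm k H g ∘ₗ HopfAlgebra.antipode k
      let G : H ⊗[k] (H ⊗[k] K) →ₗ[k] K := (TensorProduct.lid k K).toLinearMap ∘ₗ
        TensorProduct.map (LinearMap.mul' k k ∘ₗ TensorProduct.map F' F) LinearMap.id ∘ₗ
          (TensorProduct.assoc k H H K).symm.toLinearMap
      have h0 : ∀ y : H, dualForm k H (f * g) (HopfAlgebra.antipode k y) =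
          LinearMap.mul' k k (TensorProduct.map F' F (Coalgebra.comul y)) := by
        intro y
        rw [dualForm_mul, comul_antipode]
        generalize Coalgebra.comul (R := k) y = u
        induction u with
        | zero => simp
        | add x y hx hy => simp only [map_add, hx, hy]
        | tmul x y => exact mul_comm _ _
      have h1 : ∀ t : H ⊗[k] K, TensorProduct.lid k K (TensorProduct.map
          (dualForm k H (f * g) ∘ₗ HopfAlgebra.antipode k) LinearMap.id t) =
            G (TensorProduct.assoc k H H K
              (TensorProduct.map Coalgebra.comul LinearMap.id t)) := by
        intro t
        induction t with
        | zero => simp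
        | add x y hx hy => simp only [map_add, hx, hy]
        | tmul y x =>
          change dualForm k H (f * g) (HopfAlgebra.antipode k y) • x = TensorProduct.lid k K
            (TensorProduct.map (LinearMap.mul' k k ∘ₗ TensorProduct.map F' F) LinearMap.id
              ((TensorProduct.assoc k H H K).symm (TensorProduct.assoc k H H K
                (Coalgebra.comul y ⊗ₜ x))))
          rw [LinearEquiv.symm_apply_apply, h0]
          rfl
      have h2 : ∀ t : H ⊗[k] K, TensorProduct.lid k K (TensorProduct.map F LinearMap.id
          (N.coact (TensorProduct.lid k K (TensorProduct.map F' LinearMap.id t)))) =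
            G (TensorProduct.map LinearMap.id N.coact.toLinearMap t) := by
        intro t
        induction t with
        | zero => simp
        | add x y hx hy => simp only [map_add, hx, hy]
        | tmul y x =>
          rw [TensorProduct.map_tmul, TensorProduct.map_tmul, TensorProduct.lid_tmul, map_smul,
            map_smul, map_smul, AlgHom.toLinearMap_apply]
          generalize N.coact x = u
          induction u with
          | zero => simp
          | add x y hx hy => simp only [map_add, TensorProduct.tmul_add, smul_add, hx, hy]
          | tmul z x =>
            change F' y • F z • x = (F' y * F z) • x
            rw [smul_smul]
      exact (h1 _).trans ((congrArg G (N.coassoc x)).trans (h2 _).symm))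

theorem dualAct_commute {H' : Type*} [Ring H'] [HopfAlgebra k H'] (X : BicomoduleAlgebra k H H' K)
    (f : DualAlgebra k H) (g : DualAlgebra k H') :
    Commute (leftDualAct X.left f) (rightDualAct X.right g) := by
  refine LinearMap.ext fun x => ?_
  let F : H →ₗ[k] k := dualForm k H f ∘ₗ HopfAlgebra.antipode k
  let F' : H' →ₗ[k] k := dualForm k H' g
  let G : H ⊗[k] (K ⊗[k] H') →ₗ[k] K := (TensorProduct.lid k K).toLinearMap ∘ₗ
    TensorProduct.map F ((TensorProduct.rid k K).toLinearMap ∘ₗ TensorProduct.map LinearMap.id F')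
  have h1 : ∀ t : K ⊗[k] H', TensorProduct.lid k K (TensorProduct.map F LinearMap.id
      (X.left.coact (TensorProduct.rid k K (TensorProduct.map LinearMap.id F' t)))) =
        G (TensorProduct.assoc k H K H'
          (TensorProduct.map X.left.coact.toLinearMap LinearMap.id t)) := by
    intro t
    induction t with
    | zero => simp
    | add x y hx hy => simp only [map_add, hx, hy]
    | tmul x y =>
      rw [TensorProduct.map_tmul, TensorProduct.map_tmul, TensorProduct.rid_tmul, map_smul,
        map_smul, map_smul, AlgHom.toLinearMap_apply]
      generalize X.left.coact x = u
      induction u with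
      | zero => simp
      | add x y hx hy => simp only [map_add, TensorProduct.add_tmul, smul_add, hx, hy]
      | tmul z x =>
        change F' y • F z • x = F z • F' y • x
        exact smul_comm _ _ _
  have h2 : ∀ t : H ⊗[k] K, TensorProduct.rid k K (TensorProduct.map LinearMap.id F'
      (X.right.coact (TensorProduct.lid k K (TensorProduct.map F LinearMap.id t)))) =
        G (TensorProduct.map LinearMap.id X.right.coact.toLinearMap t) := by
    intro t
    induction t with
    | zero => simp
    | add x y hx hy => simp only [map_add, hx, hy]
    | tmul y x =>
      rw [TensorProduct.map_tmul, TensorProduct.map_tmul, TensorProduct.lid_tmul, map_smul,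
        map_smul, map_smul, AlgHom.toLinearMap_apply]
      rfl
  exact (h1 _).trans ((congrArg G (X.comm x)).trans (h2 _).symm)

end EdgeAction

/-- Labels for the vertices: modules over the vertex algebras. -/
structure VertexLabelling {k : Type*} [Field k] {V E F : Type*} {Γ : CellDecomposition V E F}
    [Fintype E] [DecidableEq E] [DecidableEq V] (L : Labelling k Γ) where
  Z : V → Type*
  [addCommGroup : ∀ v, AddCommGroup (Z v)]
  [module : ∀ v, Module k (Z v)]
  act : ∀ v, L.VertexAlgebra v →ₐ[k] Module.End k (Z v)

namespace VertexLabelling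
attribute [instance] addCommGroup module

variable {k : Type*} [Field k] {V E F : Type*} {Γ : CellDecomposition V E F}
  [Fintype E] [DecidableEq E] [DecidableEq V] {L : Labelling k Γ} (Z : VertexLabelling L)

/-- The state space `Hom(⨂ K_e, ⨂ Z_v)`. -/
abbrev StateSpace : Type _ := (⨂[k] e, L.K e) →ₗ[k] (⨂[k] v, Z.Z v)

/-- The action of `K_v ⊆ C_v` on `Z_v`. -/
noncomputable def vertexKAct (v : V) : L.KAt v →ₐ[k] Module.End k (Z.Z v) :=
  (Z.act v).comp (CrossedProduct.inclK (L.actAt v) (L.coactAt v))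

/-- The action of `H_p^* ⊆ C_v` on `Z_v`, for a corner of the plaquette `p` at `v`. -/
noncomputable def cornerAct (v : V) (s : Γ.At v) :
    DualAlgebra k (L.H (Γ.face s.1)) →ₐ[k] Module.End k (Z.Z v) :=
  (Z.act v).comp ((CrossedProduct.inclA (L.actAt v) (L.coactAt v)).comp (L.hAtSingle v s))

theorem cornerAct_commute (v : V) (s t : Γ.At v) (h : s ≠ t) (f g) :
    Commute (Z.cornerAct v s f) (Z.cornerAct v t g) := by
  have h1 := L.hAtSingle_commute v s t h f g
  have h2 := h1.map (CrossedProduct.inclA (L.actAt v) (L.coactAt v))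
  exact h2.map (Z.act v)

/-- The extension to the state space of the action of `H_p^* ⊆ C_v` on `Z_v`, for a corner of the
plaquette `p` at `v`. -/
noncomputable def cornerLeft (v : V) (s : Γ.At v) :
    DualAlgebra k (L.H (Γ.face s.1)) →ₐ[k] Module.End k Z.StateSpace :=
  (postcomp k (⨂[k] e, L.K e) (⨂[k] v, Z.Z v)).comp
    ((onFactor (M := Z.Z) v).comp (Z.cornerAct v s))

theorem cornerLeft_commute_of_ne (v : V) (s t : Γ.At v) (h : s ≠ t) (f g) :
    Commute (Z.cornerLeft v s f) (Z.cornerLeft v t g) := by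
  have h1 := Z.cornerAct_commute v s t h f g
  have h2 := h1.map (onFactor (M := Z.Z) v)
  exact h2.map (postcomp k (⨂[k] e, L.K e) (⨂[k] v, Z.Z v))

theorem cornerLeft_commute_of_vert_ne (v w : V) (h : v ≠ w) (s : Γ.At v) (t : Γ.At w) (f g) :
    Commute (Z.cornerLeft v s f) (Z.cornerLeft w t g) := by
  have h2 := onFactor_commute (M := Z.Z) h (Z.cornerAct v s f) (Z.cornerAct w t g)
  exact h2.map (postcomp k (⨂[k] e, L.K e) (⨂[k] v, Z.Z v))

/-- The left action of `H_p^*` on the state space, for a corner of the plaquette `p`. -/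
noncomputable def siteLeft (c : E × Bool) :
    DualAlgebra k (L.H (Γ.face c)) →ₐ[k] Module.End k Z.StateSpace :=
  Z.cornerLeft (Γ.vert c) ⟨c, rfl⟩

theorem cornerLeft_eq (v : V) (c : E × Bool) (h : Γ.vert c = v) :
    Z.cornerLeft v ⟨c, h⟩ = Z.siteLeft c := by
  subst h
  rfl

theorem siteLeft_commute (c c' : E × Bool) (h : c ≠ c') (f g) :
    Commute (Z.siteLeft c f) (Z.siteLeft c' g) := by
  by_cases hv : Γ.vert c = Γ.vert c'
  · have h1 := Z.cornerLeft_commute_of_ne (Γ.vert c) ⟨c, rfl⟩ ⟨c', hv.symm⟩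
      (fun e => h (congrArg Subtype.val e)) f g
    rw [Z.cornerLeft_eq, Z.cornerLeft_eq] at h1
    exact h1
  · have h1 := Z.cornerLeft_commute_of_vert_ne (Γ.vert c) (Γ.vert c') hv ⟨c, rfl⟩ ⟨c', rfl⟩ f g
    rw [Z.cornerLeft_eq, Z.cornerLeft_eq] at h1
    exact h1

/-- The right action of `H_p^*` on the state space through the antipode, for a corner of the
plaquette `p`. -/
noncomputable def siteRight (c : E × Bool) :
    DualAlgebra k (L.H (Γ.face c)) →ₐ[k] (Module.End k Z.StateSpace)ᵐᵒᵖ :=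
  (AlgHom.op (Z.siteLeft c)).comp (dualAntipode k (L.H (Γ.face c)))

end VertexLabelling

namespace Labelling
variable {k : Type*} [Field k] {V E F : Type*} {Γ : CellDecomposition V E F} (L : Labelling k Γ)

/-- The action of the algebra of a half-edge on the algebra of its edge: by left multiplication if
it is directed away from its vertex, by right multiplication otherwise. -/
noncomputable def halfEdgeMul : ∀ d : E × Bool, L.HalfEdgeAlgebra d →ₐ[k] Module.End k (L.K d.1)
  | (e, true) => AlgHom.ofLinearMap
      (LinearMap.mul k (L.K e) ∘ₗ (Tw.tw k false false).symm.toLinearMap)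
      (LinearMap.ext fun x => one_mul x) (fun _ _ => LinearMap.ext fun _ => mul_assoc _ _ _)
  | (e, false) => AlgHom.ofLinearMap
      ((LinearMap.mul k (L.K e)).flip ∘ₗ (Tw.tw k true false).symm.toLinearMap)
      (LinearMap.ext fun x => mul_one x)
      (fun _ _ => LinearMap.ext fun x => (mul_assoc (G := L.K e) x _ _).symm)

/-- The left action `f.x = x₍₀₎ f(x₍₁₎)` of the dual of the label on the right of an edge, and the
left action `f.x = f(S x₍₋₁₎) x₍₀₎` of the dual of the label on the left of an edge. -/
noncomputable def edgeDualAct :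
    ∀ d : E × Bool, DualAlgebra k (L.H (Γ.face d)) →ₐ[k] Module.End k (L.K d.1)
  | (e, true) => leftDualAct (L.coact e).left
  | (e, false) => rightDualAct (L.coact e).right

variable [DecidableEq E]

theorem halfEdgeMul_commute (d d' : E × Bool) (h : d ≠ d') (x y) :
    Commute (onFactor (M := L.K) d.1 (L.halfEdgeMul d x))
      (onFactor (M := L.K) d'.1 (L.halfEdgeMul d' y)) := by
  obtain ⟨e, b⟩ := d
  obtain ⟨e', b'⟩ := d'
  by_cases he : e = e'
  · subst he
    refine Commute.map ?_ (onFactor (M := L.K) e)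
    cases b <;> cases b'
    · exact absurd rfl h
    · exact LinearMap.ext fun z => (mul_assoc (G := L.K e) _ _ _).symm.symm
    · exact LinearMap.ext fun z => (mul_assoc (G := L.K e) _ _ _).symm
    · exact absurd rfl h
  · exact onFactor_commute he _ _

theorem edgeDualAct_commute (d d' : E × Bool) (h : d ≠ d') (f g) :
    Commute (onFactor (M := L.K) d.1 (L.edgeDualAct d f))
      (onFactor (M := L.K) d'.1 (L.edgeDualAct d' g)) := by
  obtain ⟨e, b⟩ := d
  obtain ⟨e', b'⟩ := d'
  by_cases he : e = e'
  · subst he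
    refine Commute.map ?_ (onFactor (M := L.K) e)
    cases b <;> cases b'
    · exact absurd rfl h
    · exact (dualAct_commute (L.coact e) _ _).symm
    · exact dualAct_commute (L.coact e) _ _
    · exact absurd rfl h
  · exact onFactor_commute he _ _

/-- The left action of `K_v` on `⨂ K_e`, a restriction of the regular bimodule structure. -/
noncomputable def regularAct [Fintype E] [DecidableEq V] (v : V) :
    L.KAt v →ₐ[k] Module.End k (⨂[k] e, L.K e) :=
  piLift (fun d : Γ.At v => (onFactor (M := L.K) d.1.1).comp (L.halfEdgeMul d.1))
    (fun _ _ h _ _ => L.halfEdgeMul_commute _ _ (fun e => h (Subtype.ext e)) _ _)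

/-- Equal faces have equal labels. -/
noncomputable def castDual {f₁ f₂ : F} (h : f₁ = f₂) :
    DualAlgebra k (L.H f₁) →ₐ[k] DualAlgebra k (L.H f₂) :=
  match f₂, h with
  | _, rfl => AlgHom.id k _

end Labelling

namespace VertexLabelling

variable {k : Type*} [Field k] {V E F : Type*} {Γ : CellDecomposition V E F}
  [Fintype E] [DecidableEq E] [DecidableEq V] {L : Labelling k Γ} (Z : VertexLabelling L)

/-- The `K_v`-bimodule structure on the state space: the right action is given by pre-composition
with the action on `⨂ K_e`, the left action by post-composition with the action on `Z_v`. -/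
noncomputable def vertexBimodule (v : V) : BimoduleStructure k (L.KAt v) Z.StateSpace where
  left := (postcomp k (⨂[k] e, L.K e) (⨂[k] v, Z.Z v)).comp
    ((onFactor (M := Z.Z) v).comp (Z.vertexKAct v))
  right := (precomp k (⨂[k] e, L.K e) (⨂[k] v, Z.Z v)).comp (L.regularAct v)
  comm _ _ := postcomp_precomp_commute _ _

/-- The right action of `H_p^*` on the state space, given by pre-composition with the left action
on `K_e`, for the edge `e` of `d` and the plaquette `p` at this side of `e`. -/
noncomputable def edgeRight (d : E × Bool) :
    DualAlgebra k (L.H (Γ.face d)) →ₐ[k] (Module.End k Z.StateSpace)ᵐᵒᵖ :=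
  (precomp k (⨂[k] e, L.K e) (⨂[k] v, Z.Z v)).comp
    ((onFactor (M := L.K) d.1).comp (L.edgeDualAct d))

theorem edgeRight_commute (d d' : E × Bool) (h : d ≠ d') (f g) :
    Commute (Z.edgeRight d f) (Z.edgeRight d' g) :=
  (L.edgeDualAct_commute d d' h f g).map (precomp k (⨂[k] e, L.K e) (⨂[k] v, Z.Z v))

theorem siteRight_commute (c c' : E × Bool) (h : c ≠ c') (f g) :
    Commute (Z.siteRight c f) (Z.siteRight c' g) :=
  (Z.siteLeft_commute c c' h _ _).op

theorem edgeRight_siteRight_commute (d c : E × Bool) (f g) :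
    Commute (Z.edgeRight d f) (Z.siteRight c g) :=
  (postcomp_precomp_commute _ _).symm.op

/-- The right `H_p^*`-actions at the edges and the sites of a plaquette in clockwise order, starting
right after the site `c`: the edge between the first two sites, the site after `c`, the next edge,
and so on. -/
noncomputable def plaquetteItem (c : E × Bool) (j : ℕ) :
    DualAlgebra k (L.H (Γ.face c)) →ₐ[k] (Module.End k Z.StateSpace)ᵐᵒᵖ :=
  (if j % 2 = 0 then Z.edgeRight ((Γ.next ^ (j / 2 + 1)) c)
    else Z.siteRight ((Γ.next ^ (j / 2 + 1)) c)).comp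
      (L.castDual (Γ.face_next_pow c (j / 2 + 1)).symm)

/-- The number of sites of the plaquette of a site. -/
noncomputable def size (_Z : VertexLabelling L) (c : E × Bool) : ℕ :=
  Function.minimalPeriod Γ.next c

theorem next_pow_ne (c : E × Bool) (i : ℕ) (h : i + 1 < Z.size c) : (Γ.next ^ (i + 1)) c ≠ c := by
  intro e
  rw [← Equiv.Perm.iterate_eq_pow] at e
  exact Function.not_isPeriodicPt_of_pos_of_lt_minimalPeriod (Nat.succ_ne_zero i) h e

theorem next_pow_ne_next_pow (c : E × Bool) (i j : ℕ) (h : i ≠ j) (hi : i < Z.size c)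
    (hj : j < Z.size c) : (Γ.next ^ (i + 1)) c ≠ (Γ.next ^ (j + 1)) c := by
  intro e
  rw [pow_succ', pow_succ', Equiv.Perm.mul_apply, Equiv.Perm.mul_apply] at e
  have e := Γ.next.injective e
  rw [← Equiv.Perm.iterate_eq_pow, ← Equiv.Perm.iterate_eq_pow] at e
  exact h ((Function.iterate_eq_iterate_iff_of_lt_minimalPeriod hi hj).1 e)

theorem plaquetteItem_commute (c : E × Bool) (i j : ℕ) (h : i ≠ j) (hi : i < 2 * Z.size c - 1)
    (hj : j < 2 * Z.size c - 1) (f g) :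
    Commute (Z.plaquetteItem c i f) (Z.plaquetteItem c j g) := by
  rw [plaquetteItem, plaquetteItem, AlgHom.comp_apply, AlgHom.comp_apply]
  by_cases h1 : i % 2 = 0 <;> by_cases h2 : j % 2 = 0
  · rw [if_pos h1, if_pos h2]
    exact Z.edgeRight_commute _ _ (Z.next_pow_ne_next_pow c _ _ (by omega) (by omega) (by omega)) _ _
  · rw [if_pos h1, if_neg h2]
    exact Z.edgeRight_siteRight_commute _ _ _ _
  · rw [if_neg h1, if_pos h2]
    exact (Z.edgeRight_siteRight_commute _ _ _ _).symm
  · rw [if_neg h1, if_neg h2]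
    exact Z.siteRight_commute _ _ (Z.next_pow_ne_next_pow c _ _ (by omega) (by omega) (by omega)) _ _

theorem siteLeft_plaquetteItem_commute (c : E × Bool) (j : ℕ) (hj : j < 2 * Z.size c - 1) (f g) :
    Commute (Z.plaquetteItem c j f) (MulOpposite.op (Z.siteLeft c g)) := by
  rw [plaquetteItem, AlgHom.comp_apply]
  by_cases h : j % 2 = 0
  · rw [if_pos h]
    exact (postcomp_precomp_commute _ _).symm.op
  · rw [if_neg h]
    exact (Z.siteLeft_commute _ _ (Z.next_pow_ne c _ (by omega)) _ _).op

/-- The list of these actions, ending with the edge before the site `c`. -/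
noncomputable def plaquetteItems (c : E × Bool) :
    List (DualAlgebra k (L.H (Γ.face c)) →ₐ[k] (Module.End k Z.StateSpace)ᵐᵒᵖ) :=
  (List.range (2 * Z.size c - 1)).map (Z.plaquetteItem c)

theorem plaquetteItems_pairwise (c : E × Bool) :
    (Z.plaquetteItems c).Pairwise (fun r r' => ∀ f f', Commute (r f) (r' f')) := by
  refine List.pairwise_map.2 ?_
  refine List.Pairwise.imp_of_mem ?_ List.pairwise_lt_range
  intro i j hi hj hij f g
  exact Z.plaquetteItem_commute c i j (Nat.ne_of_lt hij) (List.mem_range.1 hi)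
    (List.mem_range.1 hj) f g

theorem siteLeft_convProd_commute (c : E × Bool) (f g) :
    Commute (convProd (Z.plaquetteItems c) f) (MulOpposite.op (Z.siteLeft c g)) := by
  refine commute_convProd _ _ (fun r hr f' => ?_) f
  obtain ⟨j, hj, e⟩ := List.mem_map.1 hr
  rw [← e]
  exact Z.siteLeft_plaquetteItem_commute c j (List.mem_range.1 hj) f' g

/-- The right action of `H_p^*` at the edges of `p` and at the sites of `p` other than `c`, one
after the other in clockwise order. -/
noncomputable def plaquetteRight (c : E × Bool) :
    DualAlgebra k (L.H (Γ.face c)) →ₐ[k] (Module.End k Z.StateSpace)ᵐᵒᵖ :=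
  convProdHom (S := (Module.End k Z.StateSpace)ᵐᵒᵖ) (Z.plaquetteItems c) (Z.plaquetteItems_pairwise c)

theorem siteLeft_plaquetteRight_commute (c : E × Bool) (f g) :
    Commute (Z.siteLeft c f) (Z.plaquetteRight c g).unop := by
  have h : MulOpposite.op (Z.siteLeft c f) * Z.plaquetteRight c g =
    Z.plaquetteRight c g * MulOpposite.op (Z.siteLeft c f) :=
    (Z.siteLeft_convProd_commute c g f).symm
  exact (congrArg MulOpposite.unop h).symm

/-- The `H_p^*`-bimodule structure on the state space, for a site `c` of the plaquette `p`: the left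
action is the one on `Z_v`, for the vertex `v` of `c`, and the right action is given by the actions
at the edges of `p` and at the sites of `p` other than `c`, in clockwise order. -/
noncomputable def plaquetteBimodule (c : E × Bool) :
    BimoduleStructure k (DualAlgebra k (L.H (Γ.face c))) Z.StateSpace where
  left := Z.siteLeft c
  right := Z.plaquetteRight c
  comm f g := Z.siteLeft_plaquetteRight_commute c f g

end VertexLabelling

end Kitaev

/-!
The operators of the bimodule structures act by pre- and post-composition with operators on single
tensor factors of `⨂ K_e` and `⨂ Z_v`. Pre- and post-compositions commute, and so do operators on
different factors. This settles the operators at two different vertices and, since the two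
coactions on `K_e` commute and different sites at a vertex have different factors in `C_v`, the
operators of two different plaquettes; see `VertexLabelling.vertexBimodule_act_commute` and
`VertexLabelling.plaquetteBimodule_act_commute`.

For a site `(p, v)`, a bimodule structure over the crossed product `H_p^* ⋉ K_v` consists of a left
and a right action that commute, and these, by the universal property `CrossedProduct.lift`, are
pairs of actions of `H_p^*` and `K_v` that satisfy the straightening relation
`x a = (x₍₋₁₎.a) x₍₀₎`. The left action comes from the vertex algebra `C_v`, of which the two
algebras are subalgebras with this relation. For the right action
(`VertexLabelling.mem_straightening_right`), it is enough to consider elements of a single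
half-edge. As `p` has no other site at `v`, a half-edge at `v` lies on an edge of `p` only if it
bounds the site; the other half-edges commute with `H_p^*`, and the site coacts trivially on them.
The half-edges that bound the site belong to the first and the last edge in the clockwise order
around `p`, on which the first and the last leg of the coproduct of `f` act. Translating `f` to
`f(a ? b)` translates exactly these two legs, on the left by `a` and on the right by `b`. So
everything is reduced to four identities about one edge: left or right multiplication on `K_e`
against the action of `H_p^*` through the left or the right coaction. Two of them follow from
`a₍₁₎ S(a₍₂₎) = ε(a)`, the other two, `mulLeft_mul_leftDualAct` and `mulLeft_mul_rightDualAct`,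
from `S(a₍₂₎) a₍₁₎ = ε(a)`, which requires `S² = 1`.

That `S² = 1` is the theorem of Larson and Radford, `antipode_antipode`. The form
`λ(x) = Tr(y ↦ x S²(y))` is a left integral of `H^*`, and it is nonzero since `λ(Λ) = 1` for the
normalized integral `Λ` of the semisimple algebra `H`. Left integrals are unique up to scalars,
which yields a group-like element `a` with `λ(x₍₁₎) x₍₂₎ = λ(x) a` and Radford's formula: `S⁴` is
the conjugation by `a`. Hence `S²` has finite order. On the matrix blocks of `H` it is the
conjugation by matrices `uᵢ` of finite order up to scalars, so that `Tr S² = ∑ Tr(uᵢ) Tr(uᵢ⁻¹)` is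
a sum of squares of absolute values of complex numbers. It vanishes only if all `Tr(uᵢ⁻¹)` do,
which would make `λ` zero. So `λ(1) = Tr S² ≠ 0`; this forces `a = 1` and `S⁴ = 1`. Finally,
convolution by the regular character `χ` is `dim H` times a projection that commutes with `S²`, and
its product with `S²` has trace `Tr S²`. Thus the difference of the dimensions of the two
eigenspaces of `S²` is a nonzero multiple of their sum `dim H`, so that one of them is zero, and it
is not the one that contains `1`.
-/

namespace Kitaev

/-! ### Left integrals of the dual algebra -/

section Integrals

variable {k H : Type*} [Field k] [Ring H] [HopfAlgebra k H]

/-- The square of the antipode, as an algebra morphism. -/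
noncomputable def antipodeSq (k H : Type*) [Field k] [Ring H] [HopfAlgebra k H] : H →ₐ[k] H :=
  AlgHom.ofLinearMap (HopfAlgebra.antipode k ∘ₗ HopfAlgebra.antipode k)
    (by rw [LinearMap.comp_apply, HopfAlgebra.antipode_one, HopfAlgebra.antipode_one])
    (fun x y => by
      simp only [LinearMap.comp_apply, HopfAlgebra.antipode_mul_antidistrib])

theorem antipodeSq_apply (x : H) :
    antipodeSq k H x = HopfAlgebra.antipode k (HopfAlgebra.antipode k x) := rfl

theorem comul_antipodeSq (x : H) : Coalgebra.comul (R := k) (antipodeSq k H x) =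
    Algebra.TensorProduct.map (antipodeSq k H) (antipodeSq k H) (Coalgebra.comul x) := by
  rw [antipodeSq_apply, comul_antipode, comul_antipode]
  generalize Coalgebra.comul (R := k) x = t
  induction t with
  | zero => simp
  | add x y hx hy => simp only [map_add, hx, hy]
  | tmul x y => rfl

theorem counit_antipodeSq (x : H) :
    Coalgebra.counit (R := k) (antipodeSq k H x) = Coalgebra.counit x := by
  rw [antipodeSq_apply, HopfAlgebra.counit_antipode, HopfAlgebra.counit_antipode]

/-- The operator `x ↦ p(x₍₁₎) x₍₂₎`. -/
noncomputable def hit : (H →ₗ[k] k) →ₗ[k] Module.End k H where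
  toFun p := (TensorProduct.lid k H).toLinearMap ∘ₗ TensorProduct.map p LinearMap.id ∘ₗ
    Coalgebra.comul
  map_add' p q := by
    rw [TensorProduct.map_add_left, LinearMap.add_comp, LinearMap.comp_add]
  map_smul' r p := by
    rw [TensorProduct.map_smul_left, LinearMap.smul_comp, LinearMap.comp_smul]
    rfl

theorem hit_apply (p : H →ₗ[k] k) (x : H) : hit p x =
    TensorProduct.lid k H (TensorProduct.map p LinearMap.id (Coalgebra.comul x)) := rfl

theorem hit_counit (x : H) : hit (Coalgebra.counit (R := k)) x = x := by
  rw [hit_apply]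
  exact (congrArg (TensorProduct.lid k H) (Coalgebra.rTensor_counit_comul x)).trans (one_smul k x)

theorem counit_hit (p : H →ₗ[k] k) (x : H) : Coalgebra.counit (R := k) (hit p x) = p x := by
  have h : ∀ t : H ⊗[k] H, Coalgebra.counit (R := k) (TensorProduct.lid k H
      (TensorProduct.map p LinearMap.id t)) =
        p (TensorProduct.rid k H (Coalgebra.counit.lTensor H t)) := by
    intro t
    induction t with
    | zero => simp
    | add x y hx hy => simp only [map_add, hx, hy]
    | tmul x y => simp [mul_comm]
  rw [hit_apply, h, Coalgebra.lTensor_counit_comul, TensorProduct.rid_tmul, one_smul]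

theorem comul_hit (p : H →ₗ[k] k) (x : H) : Coalgebra.comul (R := k) (hit p x) =
    TensorProduct.map (hit p) LinearMap.id (Coalgebra.comul x) := by
  let G : H ⊗[k] (H ⊗[k] H) →ₗ[k] H ⊗[k] H :=
    (TensorProduct.lid k _).toLinearMap ∘ₗ TensorProduct.map p LinearMap.id
  have h1 : ∀ t : H ⊗[k] H, Coalgebra.comul (R := k) (TensorProduct.lid k H
      (TensorProduct.map p LinearMap.id t)) = G (Coalgebra.comul.lTensor H t) := by
    intro t
    induction t with
    | zero => simp
    | add x y hx hy => simp only [map_add, hx, hy]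
    | tmul x y => simp [G]
  have h2 : ∀ t : H ⊗[k] H, TensorProduct.map (hit p) LinearMap.id t =
      G (TensorProduct.assoc k H H H (Coalgebra.comul.rTensor H t)) := by
    intro t
    induction t with
    | zero => simp
    | add x y hx hy => simp only [map_add, hx, hy]
    | tmul x y =>
      rw [TensorProduct.map_tmul, LinearMap.rTensor_tmul, hit_apply]
      generalize Coalgebra.comul (R := k) x = u
      induction u with
      | zero => simp
      | add x y hx hy => simp only [map_add, TensorProduct.add_tmul, hx, hy]
      | tmul x z => simp [G, TensorProduct.smul_tmul']
  rw [hit_apply, h1, h2, Coalgebra.coassoc_apply]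

theorem hit_hit (p q : H →ₗ[k] k) (x : H) : hit p (hit q x) = hit (p ∘ₗ hit q) x := by
  rw [hit_apply, comul_hit, hit_apply, ← LinearMap.comp_apply, ← TensorProduct.map_comp]
  rfl

/-- The linear form `x ↦ Tr(y ↦ x S²(y))`. -/
noncomputable def traceForm (k H : Type*) [Field k] [Ring H] [HopfAlgebra k H] : H →ₗ[k] k :=
  LinearMap.trace k H ∘ₗ (LinearMap.mulRight k (antipodeSq k H).toLinearMap :
    Module.End k H →ₗ[k] Module.End k H) ∘ₗ LinearMap.mul k H

theorem traceForm_apply (x : H) : traceForm k H x =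
    LinearMap.trace k H (LinearMap.mulLeft k x * (antipodeSq k H).toLinearMap) := rfl

theorem traceForm_mul (x y : H) :
    traceForm k H (x * y) = traceForm k H (y * antipodeSq k H x) := by
  have h : (antipodeSq k H).toLinearMap * LinearMap.mulLeft k x =
      LinearMap.mulLeft k (antipodeSq k H x) * (antipodeSq k H).toLinearMap :=
    LinearMap.ext fun z => map_mul (antipodeSq k H) x z
  rw [traceForm_apply, traceForm_apply, LinearMap.mulLeft_mul, LinearMap.mulLeft_mul]
  change LinearMap.trace k H (LinearMap.mulLeft k x * LinearMap.mulLeft k y * _) =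
    LinearMap.trace k H (LinearMap.mulLeft k y * LinearMap.mulLeft k _ * _)
  rw [mul_assoc, LinearMap.trace_mul_comm, mul_assoc, mul_assoc, h]

/-- The antipode axiom in the form `S²(x₍₂₎) S(x₍₁₎) = ε(x)`. -/
theorem antipodeSq_mul_antipode (x : H) :
    LinearMap.mul' k H (TensorProduct.comm k H H (TensorProduct.map (HopfAlgebra.antipode k)
      (antipodeSq k H).toLinearMap (Coalgebra.comul x))) =
        algebraMap k H (Coalgebra.counit x) := by
  have h : ∀ t : H ⊗[k] H, LinearMap.mul' k H (TensorProduct.comm k H H (TensorProduct.map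
      (HopfAlgebra.antipode k) (antipodeSq k H).toLinearMap t)) =
        HopfAlgebra.antipode k (LinearMap.mul' k H ((HopfAlgebra.antipode k).lTensor H t)) := by
    intro t
    induction t with
    | zero => simp
    | add x y hx hy => simp only [map_add, hx, hy]
    | tmul x y => simp [antipodeSq_apply, HopfAlgebra.antipode_mul_antidistrib]
  rw [h, HopfAlgebra.mul_antipode_lTensor_comul_apply, Algebra.algebraMap_eq_smul_one, map_smul,
    HopfAlgebra.antipode_one]

theorem sum_coord_smul_hit {ι : Type*} [Fintype ι] (b : Module.Basis ι k H) (q : H →ₗ[k] k)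
    (z : H) : ∑ i, q (b i) • hit (b.coord i) z = hit q z := by
  have h := congrArg (fun p => hit p z) (b.sum_dual_apply_smul_coord q)
  simpa only [map_sum, map_smul, LinearMap.sum_apply, LinearMap.smul_apply] using h

/-- Multiplying `L_x S²` from both sides by the operators attached to the coordinate forms of a
basis and to the basis elements, and summing up, gives `L_(hit p x) S²`. The elements `b i` and
their coordinates recombine by `∑ q(b i) (b i)^* = q`, after which `S²(y₍₂₎) S(y₍₁₎) = ε(y)`
removes the factors that depend on `y`. -/
theorem sum_hit_mul_hit {ι : Type*} [Fintype ι] (b : Module.Basis ι k H) (p : H →ₗ[k] k) (x : H) :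
    ∑ i, hit (b.coord i) * (LinearMap.mulLeft k x * (antipodeSq k H).toLinearMap) *
      hit (p ∘ₗ LinearMap.mulLeft k (b i) ∘ₗ HopfAlgebra.antipode k) =
        LinearMap.mulLeft k (hit p x) * (antipodeSq k H).toLinearMap := by
  let σ := (antipodeSq k H).toLinearMap
  let m : H ⊗[k] H →ₗ[k] H := LinearMap.mul' k H ∘ₗ (TensorProduct.comm k H H).toLinearMap ∘ₗ
    TensorProduct.map (HopfAlgebra.antipode k) σ
  let K : H ⊗[k] (H ⊗[k] H) →ₗ[k] H ⊗[k] H :=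
    TensorProduct.map m σ ∘ₗ (TensorProduct.assoc k H H H).symm.toLinearMap
  let P : H ⊗[k] H →ₗ[k] H := (TensorProduct.lid k H).toLinearMap ∘ₗ
    TensorProduct.map p LinearMap.id
  refine LinearMap.ext fun y => ?_
  have h1 : ∀ t : H ⊗[k] H, ∑ i, hit (b.coord i) (x * σ (TensorProduct.lid k H (TensorProduct.map
      (p ∘ₗ LinearMap.mulLeft k (b i) ∘ₗ HopfAlgebra.antipode k) LinearMap.id t))) =
        P (Coalgebra.comul x * K (Coalgebra.comul.lTensor H t)) := by
    intro t
    induction t with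
    | zero => simp
    | add x y hx hy => simp only [map_add, mul_add, Finset.sum_add_distrib, hx, hy]
    | tmul s c =>
      have e := sum_coord_smul_hit b (p ∘ₗ LinearMap.mulRight k (HopfAlgebra.antipode k s))
        (x * σ c)
      refine Eq.trans ?_ (e.trans ?_)
      · simp
      · rw [hit_apply, Bialgebra.comul_mul, LinearMap.lTensor_tmul]
        change TensorProduct.lid k H (TensorProduct.map _ _ (_ *
          Coalgebra.comul (R := k) (antipodeSq k H c))) = _
        rw [comul_antipodeSq]
        generalize Coalgebra.comul (R := k) x = u
        generalize Coalgebra.comul (R := k) c = v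
        induction v with
        | zero => simp
        | add x y hx hy => simp only [map_add, mul_add, TensorProduct.tmul_add, hx, hy]
        | tmul c d =>
          induction u with
          | zero => simp
          | add x y hx hy => simp only [map_add, add_mul, hx, hy]
          | tmul y z => simp [P, K, m, σ, mul_assoc]
  have h2 : K (Coalgebra.comul.lTensor H (Coalgebra.comul y)) = 1 ⊗ₜ σ y := by
    rw [← Coalgebra.coassoc_apply]
    have h : ∀ t : H ⊗[k] H, K (TensorProduct.assoc k H H H (Coalgebra.comul.rTensor H t)) =
        1 ⊗ₜ σ (TensorProduct.lid k H (Coalgebra.counit.rTensor H t)) := by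
      intro t
      induction t with
      | zero => simp
      | add x y hx hy => simp only [map_add, TensorProduct.tmul_add, hx, hy]
      | tmul x y =>
        have e : m (Coalgebra.comul x) = algebraMap k H (Coalgebra.counit x) :=
          antipodeSq_mul_antipode x
        simp only [K, LinearMap.comp_apply, LinearMap.rTensor_tmul, LinearEquiv.coe_coe,
          LinearEquiv.symm_apply_apply, TensorProduct.map_tmul, e, TensorProduct.lid_tmul,
          map_smul, TensorProduct.tmul_smul, TensorProduct.smul_tmul',
          Algebra.algebraMap_eq_smul_one]
    rw [h, Coalgebra.rTensor_counit_comul, TensorProduct.lid_tmul, one_smul]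
  rw [LinearMap.sum_apply]
  refine (h1 _).trans ?_
  rw [h2, Module.End.mul_apply, LinearMap.mulLeft_apply, hit_apply]
  generalize Coalgebra.comul (R := k) x = u
  induction u with
  | zero => simp
  | add x y hx hy => simp only [map_add, add_mul, hx, hy]
  | tmul y z => simp [P, σ]

/-- The two families of `sum_hit_mul_hit`, multiplied in the opposite order, sum up to the scalar
`p(1)`. With the cyclicity of the trace, the two identities show that `traceForm` is a left
integral. -/
theorem sum_hit_mul_hit_one {ι : Type*} [Fintype ι] (b : Module.Basis ι k H) (p : H →ₗ[k] k) :
    ∑ i, hit (p ∘ₗ LinearMap.mulLeft k (b i) ∘ₗ HopfAlgebra.antipode k) * hit (b.coord i) =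
        p 1 • (1 : Module.End k H) := by
  let m : H ⊗[k] H →ₗ[k] H := LinearMap.mul' k H ∘ₗ (HopfAlgebra.antipode k).lTensor H
  let K : H ⊗[k] (H ⊗[k] H) →ₗ[k] H := (TensorProduct.lid k H).toLinearMap ∘ₗ
    TensorProduct.map (p ∘ₗ m) LinearMap.id ∘ₗ (TensorProduct.assoc k H H H).symm.toLinearMap
  refine LinearMap.ext fun y => ?_
  have h1 : ∀ t : H ⊗[k] H, ∑ i, hit (p ∘ₗ LinearMap.mulLeft k (b i) ∘ₗ HopfAlgebra.antipode k)
      (TensorProduct.lid k H (TensorProduct.map (b.coord i) LinearMap.id t)) =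
        K (Coalgebra.comul.lTensor H t) := by
    intro t
    induction t with
    | zero => simp
    | add x y hx hy => simp only [map_add, Finset.sum_add_distrib, hx, hy]
    | tmul s c =>
      have e : ∀ v : H ⊗[k] H, ∑ i, b.coord i s • TensorProduct.lid k H (TensorProduct.map
          (p ∘ₗ LinearMap.mulLeft k (b i) ∘ₗ HopfAlgebra.antipode k) LinearMap.id v) =
            K (s ⊗ₜ v) := by
        intro v
        induction v with
        | zero => simp
        | add x y hx hy =>
          simp only [map_add, smul_add, Finset.sum_add_distrib, TensorProduct.tmul_add, hx, hy]
        | tmul c d =>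
          have e' := congrArg (fun z => p (z * HopfAlgebra.antipode k c) • d) (b.sum_repr s)
          simp only [Finset.sum_mul, map_sum, Finset.sum_smul, smul_mul_assoc, map_smul] at e'
          simpa [K, m, mul_smul] using e'
      rw [LinearMap.lTensor_tmul, ← e]
      simp [hit_apply]
  have h : ∀ t : H ⊗[k] H, K (TensorProduct.assoc k H H H (Coalgebra.comul.rTensor H t)) =
      p 1 • (TensorProduct.lid k H (Coalgebra.counit.rTensor H t)) := by
    intro t
    induction t with
    | zero => simp
    | add x y hx hy => simp only [map_add, smul_add, hx, hy]
    | tmul x y =>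
      have e : m (Coalgebra.comul x) = algebraMap k H (Coalgebra.counit x) :=
        HopfAlgebra.mul_antipode_lTensor_comul_apply x
      simp [K, e, Algebra.algebraMap_eq_smul_one, smul_smul, mul_comm]
  rw [LinearMap.sum_apply]
  refine (h1 _).trans ?_
  rw [← Coalgebra.coassoc_apply, h, Coalgebra.rTensor_counit_comul, TensorProduct.lid_tmul,
    one_smul]
  rfl

/-- The linear form `traceForm` is a left integral of `H^*`. -/
theorem traceForm_hit [FiniteDimensional k H] (p : H →ₗ[k] k) (x : H) :
    traceForm k H (hit p x) = p 1 * traceForm k H x := by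
  let b := Module.finBasis k H
  have h1 := congrArg (LinearMap.trace k H) (sum_hit_mul_hit b p x)
  rw [map_sum] at h1
  rw [traceForm_apply, ← h1]
  have h2 : ∀ i, LinearMap.trace k H (hit (b.coord i) *
      (LinearMap.mulLeft k x * (antipodeSq k H).toLinearMap) *
        hit (p ∘ₗ LinearMap.mulLeft k (b i) ∘ₗ HopfAlgebra.antipode k)) =
      LinearMap.trace k H ((hit (p ∘ₗ LinearMap.mulLeft k (b i) ∘ₗ HopfAlgebra.antipode k) *
        hit (b.coord i)) * (LinearMap.mulLeft k x * (antipodeSq k H).toLinearMap)) := fun i => by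
    rw [LinearMap.trace_mul_comm, mul_assoc]
  rw [Finset.sum_congr rfl fun i _ => h2 i, ← map_sum, ← Finset.sum_mul, sum_hit_mul_hit_one,
    smul_mul_assoc, one_mul, map_smul, smul_eq_mul, traceForm_apply]

end Integrals

/-! ### Integrals and the distinguished group-like element -/

section Integrals
variable {k H : Type*} [Field k] [Ring H] [HopfAlgebra k H]

/-- A two-sided integral of a Hopf algebra, normalized by `ε(Λ) = 1`. -/
structure IsNormalizedIntegral (k : Type*) {H : Type*} [Field k] [Ring H] [HopfAlgebra k H]
    (Λ : H) : Prop where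
  mul_left : ∀ x, x * Λ = Coalgebra.counit (R := k) x • Λ
  mul_right : ∀ x, Λ * x = Coalgebra.counit (R := k) x • Λ
  counit_eq_one : Coalgebra.counit (R := k) Λ = 1

/-- The kernel of a character of a semisimple algebra is generated by an idempotent `e`, and
`1 - e` spans a complementary left ideal, on which the algebra acts by the character. -/
theorem exists_left_integral {k A : Type*} [Field k] [Ring A] [Algebra k A] [IsSemisimpleRing A]
    (f : A →ₐ[k] k) : ∃ Λ : A, (∀ x, x * Λ = f x • Λ) ∧ f Λ = 1 := by
  obtain ⟨e, he, h⟩ := IsSemisimpleRing.ideal_eq_span_idempotent (RingHom.ker f)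
  have hfe : f e = 0 := by
    have : e ∈ RingHom.ker f := h ▸ Ideal.mem_span_singleton_self e
    exact this
  refine ⟨1 - e, fun x => ?_, by rw [map_sub, map_one, hfe, sub_zero]⟩
  have hx : x - algebraMap k A (f x) ∈ RingHom.ker f := by
    rw [RingHom.mem_ker, map_sub, AlgHom.commutes]
    exact sub_self _
  rw [h, Ideal.mem_span_singleton'] at hx
  obtain ⟨y, hy⟩ := hx
  have h0 : (x - algebraMap k A (f x)) * (1 - e) = 0 := by
    rw [← hy, mul_assoc, mul_sub, mul_one, he.eq, sub_self, mul_zero]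
  rw [sub_mul, sub_eq_zero] at h0
  rw [h0, Algebra.smul_def]

/-- The left and right ideals complementary to the kernel of the counit provide a left and a right
integral. Normalized by `ε = 1`, both of them equal the product of the two, and so they coincide. -/
theorem exists_normalizedIntegral [IsSemisimpleRing H] : ∃ Λ : H, IsNormalizedIntegral k Λ := by
  obtain ⟨Λ, h1, h2⟩ := exists_left_integral (Bialgebra.counitAlgHom k H)
  obtain ⟨M, h3, h4⟩ := exists_left_integral (A := Hᵐᵒᵖ)
    ((Bialgebra.counitAlgHom k H).fromOpposite fun _ _ => Commute.all _ _)
  have h5 : ∀ x, M.unop * x = Coalgebra.counit (R := k) x • M.unop := fun x =>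
    congrArg MulOpposite.unop (h3 (MulOpposite.op x))
  have h6 : Coalgebra.counit (R := k) M.unop = 1 := h4
  have h7 : ∀ x, x * Λ = Coalgebra.counit (R := k) x • Λ := h1
  have h8 : Coalgebra.counit (R := k) Λ = 1 := h2
  have h : M.unop = Λ := by
    have := h7 M.unop
    rw [h5, h8, h6, one_smul, one_smul] at this
    exact this
  exact ⟨Λ, h7, h ▸ h5, h8⟩

namespace IsNormalizedIntegral
variable {Λ : H} (hΛ : IsNormalizedIntegral k Λ)
include hΛ

/-- The antipode is an antimorphism that preserves the counit, and hence fixes the unique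
normalized integral. -/
theorem antipode_eq (hS : Function.Surjective (HopfAlgebra.antipode k (A := H))) :
    HopfAlgebra.antipode k Λ = Λ := by
  obtain ⟨M, hM⟩ := hS Λ
  have h1 := hΛ.mul_left (HopfAlgebra.antipode k Λ)
  have h2 := congrArg (HopfAlgebra.antipode k) (hΛ.mul_left M)
  rw [HopfAlgebra.antipode_mul_antidistrib, hM, h1, map_smul, HopfAlgebra.counit_antipode,
    hΛ.counit_eq_one, one_smul, ← HopfAlgebra.counit_antipode (R := k) M, hM, hΛ.counit_eq_one,
    one_smul] at h2
  exact h2.symm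

theorem traceForm_eq_one [FiniteDimensional k H] : traceForm k H Λ = 1 := by
  have h : LinearMap.mulLeft k Λ * (antipodeSq k H).toLinearMap =
      (Coalgebra.counit (R := k) (A := H)).smulRight Λ := LinearMap.ext fun x => by
    change Λ * antipodeSq k H x = Coalgebra.counit (R := k) x • Λ
    rw [hΛ.mul_right, counit_antipodeSq]
  rw [traceForm_apply, h, LinearMap.trace_smulRight, hΛ.counit_eq_one]

/-- The identity `S(Λ₍₁₎) ⊗ Λ₍₂₎ x = x S(Λ₍₁₎) ⊗ Λ₍₂₎`. -/
theorem casimir (x : H) :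
    (HopfAlgebra.antipode k).rTensor H (Coalgebra.comul Λ) * ((1 : H) ⊗ₜ[k] x) =
      (x ⊗ₜ 1) * (HopfAlgebra.antipode k).rTensor H (Coalgebra.comul Λ) := by
  let T := (HopfAlgebra.antipode k).rTensor H (Coalgebra.comul Λ)
  let K : H ⊗[k] (H ⊗[k] H) →ₗ[k] H ⊗[k] H := TensorProduct.lift
    ((LinearMap.mul k (H ⊗[k] H)).compl₁₂ ((TensorProduct.mk k H H).flip 1)
      ((HopfAlgebra.antipode k).rTensor H ∘ₗ LinearMap.mulLeft k (Coalgebra.comul Λ)))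
  have hK : ∀ a b c, K (a ⊗ₜ (b ⊗ₜ c)) =
      ((a * HopfAlgebra.antipode k b) ⊗ₜ 1) * T * (1 ⊗ₜ c) := by
    intro a b c
    change (a ⊗ₜ[k] (1 : H)) * (HopfAlgebra.antipode k).rTensor H (Coalgebra.comul Λ * (b ⊗ₜ c)) = _
    simp only [T]
    generalize Coalgebra.comul (R := k) Λ = t
    induction t with
    | zero => simp
    | add x y hx hy => simp only [map_add, mul_add, add_mul, hx, hy]
    | tmul x y => simp [HopfAlgebra.antipode_mul_antidistrib, mul_assoc]
  have h1 : ∀ t : H ⊗[k] H, K (Coalgebra.comul.lTensor H t) =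
      (TensorProduct.rid k H (Coalgebra.counit.lTensor H t) ⊗ₜ 1) * T := by
    intro t
    induction t with
    | zero => simp
    | add x y hx hy => simp only [map_add, TensorProduct.add_tmul, add_mul, hx, hy]
    | tmul a z =>
      change (a ⊗ₜ[k] (1 : H)) *
        (HopfAlgebra.antipode k).rTensor H (Coalgebra.comul Λ * Coalgebra.comul z) = _
      rw [← Bialgebra.comul_mul, hΛ.mul_right, map_smul, map_smul]
      simp [T, ← TensorProduct.smul_tmul']
  have h2 : ∀ t : H ⊗[k] H, K (TensorProduct.assoc k H H H (Coalgebra.comul.rTensor H t)) =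
      T * (1 ⊗ₜ TensorProduct.lid k H (Coalgebra.counit.rTensor H t)) := by
    intro t
    induction t with
    | zero => simp
    | add x y hx hy => simp only [map_add, TensorProduct.tmul_add, mul_add, hx, hy]
    | tmul a z =>
      have e : ∀ u : H ⊗[k] H, K (TensorProduct.assoc k H H H (u ⊗ₜ z)) =
          (LinearMap.mul' k H ((HopfAlgebra.antipode k).lTensor H u) ⊗ₜ 1) * T * (1 ⊗ₜ z) := by
        intro u
        induction u with
        | zero => simp
        | add x y hx hy => simp only [map_add, TensorProduct.add_tmul, add_mul, hx, hy]
        | tmul x y => simp [hK]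
      rw [LinearMap.rTensor_tmul, e, HopfAlgebra.mul_antipode_lTensor_comul_apply]
      simp [Algebra.algebraMap_eq_smul_one, ← TensorProduct.smul_tmul',
        ← Algebra.TensorProduct.one_def]
  have h3 := h2 (Coalgebra.comul x)
  rw [Coalgebra.coassoc_apply, h1, Coalgebra.rTensor_counit_comul, Coalgebra.lTensor_counit_comul,
    TensorProduct.rid_tmul, TensorProduct.lid_tmul, one_smul] at h3
  exact h3.symm

theorem sum_antipode_mul (μ : H →ₗ[k] k) (x : H) :
    TensorProduct.rid k H (TensorProduct.map LinearMap.id μ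
      ((HopfAlgebra.antipode k).rTensor H (Coalgebra.comul Λ) * ((1 : H) ⊗ₜ[k] x))) =
    x * HopfAlgebra.antipode k (TensorProduct.rid k H (TensorProduct.map LinearMap.id μ
      (Coalgebra.comul Λ))) := by
  rw [hΛ.casimir]
  generalize Coalgebra.comul (R := k) Λ = t
  induction t with
  | zero => simp
  | add x y hx hy => simp only [map_add, mul_add, hx, hy]
  | tmul y z => simp

end IsNormalizedIntegral

/-- A linear form `μ` on `H` with `x₍₁₎ μ(x₍₂₎) = μ(x) 1`. -/
def IsLeftCointegral (μ : H →ₗ[k] k) : Prop := ∀ p x, μ (hit p x) = p 1 * μ x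

theorem IsLeftCointegral.rid_map {μ : H →ₗ[k] k} (h : IsLeftCointegral μ) (x : H) :
    TensorProduct.rid k H (TensorProduct.map LinearMap.id μ (Coalgebra.comul x)) = μ x • 1 := by
  refine sub_eq_zero.1 ((Module.forall_dual_apply_eq_zero_iff k _).1 fun p => ?_)
  have h1 : ∀ t : H ⊗[k] H, p (TensorProduct.rid k H (TensorProduct.map LinearMap.id μ t)) =
      μ (TensorProduct.lid k H (TensorProduct.map p LinearMap.id t)) := by
    intro t
    induction t with
    | zero => simp
    | add x y hx hy => simp only [map_add, hx, hy]
    | tmul y z => simp [mul_comm]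
  rw [map_sub, h1, ← hit_apply, h p x, map_smul, smul_eq_mul, mul_comm, sub_self]

namespace IsNormalizedIntegral
variable {Λ : H} (hΛ : IsNormalizedIntegral k Λ)
include hΛ

/-- `S(Λ₍₁₎) μ(Λ₍₂₎ x) = μ(Λ) x` for each left integral `μ` of `H^*`. -/
theorem sum_antipode_mul_eq {μ : H →ₗ[k] k} (h : IsLeftCointegral μ) (x : H) :
    TensorProduct.rid k H (TensorProduct.map LinearMap.id μ
      ((HopfAlgebra.antipode k).rTensor H (Coalgebra.comul Λ) * ((1 : H) ⊗ₜ[k] x))) = μ Λ • x := by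
  rw [hΛ.sum_antipode_mul, h.rid_map, map_smul, HopfAlgebra.antipode_one, mul_smul_comm, mul_one]

variable [FiniteDimensional k H]

theorem sum_antipode_mul_traceForm (x : H) :
    TensorProduct.rid k H (TensorProduct.map LinearMap.id (traceForm k H)
      ((HopfAlgebra.antipode k).rTensor H (Coalgebra.comul Λ) * ((1 : H) ⊗ₜ[k] x))) = x := by
  rw [hΛ.sum_antipode_mul_eq traceForm_hit, hΛ.traceForm_eq_one, one_smul]

/-- The bilinear form `λ(y x)` of the integral `λ = traceForm` is nondegenerate, as `x` is
recovered from the numbers `λ(Λ₍₂₎ x)`. In particular every linear form is of the form `λ(? c)`. -/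
theorem eq_zero_of_traceForm (x : H) (h : ∀ y, traceForm k H (y * x) = 0) : x = 0 := by
  have h1 := hΛ.sum_antipode_mul_traceForm x
  rw [← h1]
  generalize (HopfAlgebra.antipode k).rTensor H (Coalgebra.comul (R := k) Λ) = t
  induction t with
  | zero => simp
  | add x y hx hy => simp only [map_add, add_mul, hx, hy, add_zero]
  | tmul y z => simp [h]

theorem antipode_surjective : Function.Surjective (HopfAlgebra.antipode k (A := H)) := by
  intro x
  refine ⟨TensorProduct.rid k H (TensorProduct.map LinearMap.id (traceForm k H)
    (Coalgebra.comul Λ * ((1 : H) ⊗ₜ[k] x))), ?_⟩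
  conv_rhs => rw [← hΛ.sum_antipode_mul_traceForm x]
  generalize Coalgebra.comul (R := k) Λ = t
  induction t with
  | zero => simp
  | add x y hx hy => simp only [map_add, add_mul, hx, hy]
  | tmul y z => simp

theorem antipode_injective : Function.Injective (HopfAlgebra.antipode k (A := H)) :=
  LinearMap.injective_iff_surjective.2 hΛ.antipode_surjective

theorem exists_eq_traceForm_mul (ν : H →ₗ[k] k) : ∃ c, ∀ x, ν x = traceForm k H (x * c) := by
  let T : H →ₗ[k] Module.Dual k H := (LinearMap.mul k H).flip.compr₂ (traceForm k H)
  have hT : Function.Injective T := (injective_iff_map_eq_zero T).2 fun c hc =>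
    hΛ.eq_zero_of_traceForm c fun y => LinearMap.congr_fun hc y
  obtain ⟨c, hc⟩ := (LinearMap.injective_iff_surjective_of_finrank_eq_finrank
    (Subspace.dual_finrank_eq (K := k) (V := H)).symm).1 hT ν
  exact ⟨c, fun x => (LinearMap.congr_fun hc x).symm⟩

/-- Uniqueness of left integrals of `H^*`. -/
theorem eq_smul_traceForm {μ : H →ₗ[k] k} (h : IsLeftCointegral μ) (x : H) :
    μ x = μ Λ * traceForm k H x := by
  obtain ⟨c, hc⟩ := hΛ.exists_eq_traceForm_mul μ
  have h1 := hΛ.sum_antipode_mul_eq h 1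
  have h2 := hΛ.sum_antipode_mul_traceForm c
  have e : c = μ Λ • 1 := by
    rw [← h1]
    conv_lhs => rw [← h2]
    generalize (HopfAlgebra.antipode k).rTensor H (Coalgebra.comul (R := k) Λ) = t
    induction t with
    | zero => simp
    | add x y hx hy => simp only [map_add, add_mul, hx, hy]
    | tmul y z => simp [hc]
  rw [hc x, e, mul_smul_comm, mul_one, map_smul, smul_eq_mul]

end IsNormalizedIntegral

section
variable [FiniteDimensional k H]

/-- The distinguished group-like element `a` of `H`, with `λ(x₍₁₎) x₍₂₎ = λ(x) a` for the left
integral `λ` of `H^*`. -/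
noncomputable def modularElt (k : Type*) {H : Type*} [Field k] [Ring H] [HopfAlgebra k H]
    (Λ : H) : H := hit (traceForm k H) Λ

variable {Λ : H} (hΛ : IsNormalizedIntegral k Λ)
include hΛ

/-- For each linear form `p`, the form `x ↦ p(λ(x₍₁₎) x₍₂₎)` is again a left integral of `H^*`,
hence a multiple of `λ`. -/
theorem hit_traceForm (x : H) :
    hit (traceForm k H) x = traceForm k H x • modularElt k Λ := by
  refine sub_eq_zero.1 ((Module.forall_dual_apply_eq_zero_iff k _).1 fun p => ?_)
  have h : IsLeftCointegral (p ∘ₗ hit (traceForm k H)) := fun q x => by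
    have e : traceForm k H ∘ₗ hit q = q 1 • traceForm k H :=
      LinearMap.ext fun y => traceForm_hit q y
    rw [LinearMap.comp_apply, hit_hit, e, map_smul, LinearMap.smul_apply, map_smul, smul_eq_mul]
    rfl
  have h1 := hΛ.eq_smul_traceForm h x
  rw [LinearMap.comp_apply, LinearMap.comp_apply] at h1
  rw [map_sub, map_smul, h1, smul_eq_mul, mul_comm, modularElt, sub_self]

theorem isGroupLikeElem_modularElt : IsGroupLikeElem k (modularElt k Λ) where
  counit_eq_one := by rw [modularElt, counit_hit, hΛ.traceForm_eq_one]
  comul_eq_tmul_self := by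
    have h : ∀ t : H ⊗[k] H, TensorProduct.map (hit (traceForm k H)) LinearMap.id t =
        modularElt k Λ ⊗ₜ TensorProduct.lid k H
          (TensorProduct.map (traceForm k H) LinearMap.id t) := by
      intro t
      induction t with
      | zero => simp
      | add x y hx hy => simp only [map_add, TensorProduct.tmul_add, hx, hy]
      | tmul y z => simp [hit_traceForm hΛ, TensorProduct.smul_tmul]
    conv_lhs => rw [modularElt]
    rw [comul_hit, h, ← hit_apply]
    rfl

/-- The form `λ ∘ S` satisfies the equation of a left integral of `H^*` up to the inverse `S(a)` of
the distinguished group-like element: `x₍₁₎ λ(S(x₍₂₎)) = λ(S(x)) S(a)`. -/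
theorem traceForm_antipode_hit (q : H →ₗ[k] k) (x : H) :
    traceForm k H (HopfAlgebra.antipode k (hit q x)) =
      q (HopfAlgebra.antipode k (modularElt k Λ)) * traceForm k H (HopfAlgebra.antipode k x) := by
  have ha := isGroupLikeElem_modularElt hΛ
  let T := TensorProduct.rid k H (TensorProduct.map LinearMap.id
    (traceForm k H ∘ₗ HopfAlgebra.antipode k) (Coalgebra.comul x))
  have h1 : HopfAlgebra.antipode k T = hit (traceForm k H) (HopfAlgebra.antipode k x) := by
    rw [hit_apply, comul_antipode]
    simp only [T]
    generalize Coalgebra.comul (R := k) x = t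
    induction t with
    | zero => simp
    | add x y hx hy => simp only [map_add, hx, hy]
    | tmul y z => simp
  have h2 : T = traceForm k H (HopfAlgebra.antipode k x) •
      HopfAlgebra.antipode k (modularElt k Λ) := by
    apply hΛ.antipode_injective
    rw [h1, hit_traceForm hΛ, map_smul, ha.antipode_antipode]
  have h3 : q T = traceForm k H (HopfAlgebra.antipode k (hit q x)) := by
    rw [hit_apply]
    simp only [T]
    generalize Coalgebra.comul (R := k) x = t
    induction t with
    | zero => simp
    | add x y hx hy => simp only [map_add, hx, hy]
    | tmul y z => simp [mul_comm]
  rw [← h3, h2, map_smul, smul_eq_mul, mul_comm]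

/-- Translating `λ ∘ S` by the inverse of the distinguished group-like element `a` turns it into a
left integral again. By uniqueness this is `λ`, whence `λ(S(x)) = λ(a x)`. -/
theorem traceForm_antipode (x : H) :
    traceForm k H (HopfAlgebra.antipode k x) = traceForm k H (modularElt k Λ * x) := by
  have ha := isGroupLikeElem_modularElt hΛ
  set a := modularElt k Λ
  let b := HopfAlgebra.antipode k a
  let μ : H →ₗ[k] k := traceForm k H ∘ₗ HopfAlgebra.antipode k ∘ₗ LinearMap.mulLeft k b
  have hab : a * b = 1 := ha.mul_antipode_cancel
  have hba : b * a = 1 := ha.antipode_mul_cancel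
  have h : IsLeftCointegral μ := fun q y => by
    have e : b * hit q y = hit (q ∘ₗ LinearMap.mulLeft k a) (b * y) := by
      rw [hit_apply, hit_apply, Bialgebra.comul_mul, (ha.antipode).comul_eq_tmul_self]
      generalize Coalgebra.comul (R := k) y = t
      induction t with
      | zero => simp
      | add x y hx hy => simp only [map_add, mul_add, hx, hy]
      | tmul y z =>
        rw [Algebra.TensorProduct.tmul_mul_tmul]
        change b * (q y • z) = q (a * (b * y)) • (b * z)
        rw [← mul_assoc, hab, one_mul, mul_smul_comm]
    change traceForm k H (HopfAlgebra.antipode k (b * hit q y)) = _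
    rw [e, traceForm_antipode_hit hΛ]
    change q (a * b) * _ = _
    rw [hab]
    rfl
  have h1 : μ Λ = 1 := by
    change traceForm k H (HopfAlgebra.antipode k (b * Λ)) = 1
    rw [hΛ.mul_left, ha.antipode.counit_eq_one, one_smul, hΛ.antipode_eq hΛ.antipode_surjective,
      hΛ.traceForm_eq_one]
  have h2 := hΛ.eq_smul_traceForm h (a * x)
  rw [h1, one_mul] at h2
  rw [← h2]
  change _ = traceForm k H (HopfAlgebra.antipode k (b * (a * x)))
  rw [← mul_assoc, hba, one_mul]

/-- Radford's formula for the fourth power of the antipode, in the presence of a two-sided integral,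
which makes the distinguished group-like element of `H^*` trivial. Both sides arise from `λ(S(x y))`
by the formula `λ(S(x)) = λ(a x)` and the twisted trace property `λ(x y) = λ(y S²(x))`, applied to
`x y` and to `S(y) S(x)`. -/
theorem modularElt_mul_antipodeSq (y : H) :
    modularElt k Λ * antipodeSq k H (antipodeSq k H y) = y * modularElt k Λ := by
  have ha := isGroupLikeElem_modularElt hΛ
  set a := modularElt k Λ with ha'
  have hSa : antipodeSq k H a = a := ha.antipode_antipode
  refine sub_eq_zero.1 (hΛ.eq_zero_of_traceForm _ fun x => ?_)
  have h1 : traceForm k H (HopfAlgebra.antipode k (x * y)) = traceForm k H (x * (y * a)) := by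
    rw [traceForm_antipode hΛ, ← ha', traceForm_mul, hSa, mul_assoc]
  have h2 : traceForm k H (HopfAlgebra.antipode k (x * y)) =
      traceForm k H (x * (a * antipodeSq k H (antipodeSq k H y))) := by
    have e : antipodeSq k H (HopfAlgebra.antipode k y) =
      HopfAlgebra.antipode k (antipodeSq k H y) := rfl
    rw [HopfAlgebra.antipode_mul_antidistrib, traceForm_mul, e,
      ← HopfAlgebra.antipode_mul_antidistrib, traceForm_antipode hΛ, ← ha', ← mul_assoc,
      traceForm_mul, map_mul (antipodeSq k H), hSa]
  rw [mul_sub, map_sub, ← h1, ← h2, sub_self]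

end
end Integrals

/-! ### Traces of matrices of finite order -/

section Traces
variable {k : Type*} [Field k]

/-- The trace of `X ↦ W X V` on a product of matrix algebras. -/
theorem trace_mulLeft_mulRight_pi_matrix {ι : Type*} [Fintype ι] (d : ι → ℕ)
    (W V : ∀ i, Matrix (Fin (d i)) (Fin (d i)) k) :
    LinearMap.trace k _ (LinearMap.mulLeft k W * LinearMap.mulRight k V) =
      ∑ i, (W i).trace * (V i).trace := by
  classical
  let b := Pi.basis fun i => Matrix.stdBasis k (Fin (d i)) (Fin (d i))
  have h : ∀ j, b.repr ((LinearMap.mulLeft k W * LinearMap.mulRight k V) (b j)) j =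
      W j.1 j.2.1 j.2.1 * V j.1 j.2.2 j.2.2 := by
    rintro ⟨i, p, q⟩
    have e : (Matrix.stdBasis k (Fin (d i)) (Fin (d i))).repr
        (W i * (Matrix.stdBasis k (Fin (d i)) (Fin (d i)) (p, q) * V i)) (p, q) =
          (W i * (Matrix.single p q 1 * V i) : Matrix _ _ k) p q := by
      rw [Matrix.stdBasis_eq_single]
      rfl
    simp only [b, Pi.basis_repr, Pi.basis_apply, Module.End.mul_apply, LinearMap.mulLeft_apply,
      LinearMap.mulRight_apply, Pi.mul_apply, Pi.single_eq_same]
    rw [e, ← mul_assoc, Matrix.mul_apply, Finset.sum_eq_single q]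
    · simp
    · intro r _ hr
      rw [Matrix.mul_single_apply_of_ne (hbj := hr), zero_mul]
    · simp
  rw [LinearMap.trace_eq_matrix_trace k b, Matrix.trace]
  simp only [Matrix.diag_apply, LinearMap.toMatrix_apply, h]
  rw [Fintype.sum_sigma]
  refine Finset.sum_congr rfl fun i _ => ?_
  rw [Fintype.sum_prod_type, Matrix.trace, Matrix.trace, Finset.sum_mul_sum]
  rfl

open Polynomial in
/-- The eigenvalues of an inverse matrix are the inverses of the eigenvalues, with
multiplicities. -/
theorem roots_charpoly_inv [IsAlgClosed k] {n : ℕ} (A : Matrix (Fin n) (Fin n) k) (hA : IsUnit A) :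
    A⁻¹.charpoly.roots = A.charpoly.roots.map (·⁻¹) := by
  have hdet : A.det ≠ 0 := (((Matrix.isUnit_iff_isUnit_det A).1 hA)).ne_zero
  have h0 : (0 : k) ∉ A.charpoly.roots := by
    intro h
    rw [Matrix.det_eq_prod_roots_charpoly] at hdet
    exact hdet (Multiset.prod_eq_zero h)
  have hs : A.charpoly = (A.charpoly.roots.map fun a => X - C a).prod :=
    ((IsAlgClosed.splits A.charpoly).eq_prod_roots_of_monic A.charpoly_monic)
  -- The reverse of `X - a` is a multiple of `X - a⁻¹`.
  have hrev : ∀ s : Multiset k, (0 : k) ∉ s → ∃ c : k, c ≠ 0 ∧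
      ((s.map fun a => X - C a).prod).reverse =
        C c * ((s.map (·⁻¹)).map fun a => X - C a).prod := by
    intro s
    induction s using Multiset.induction with
    | empty => exact fun _ => ⟨1, one_ne_zero, by simp [reverse, reflect_one]⟩
    | cons a s ih =>
      intro h
      rw [Multiset.mem_cons, not_or] at h
      obtain ⟨c, hc, e⟩ := ih h.2
      have ha : a ≠ 0 := fun h' => h.1 h'.symm
      have e1 : (X - C a).reverse = C (-a) * (X - C a⁻¹) := by
        have : (X - C a : k[X]) = C (-a) + X := by simp; ring
        rw [this, mul_sub, ← C_mul, neg_mul, mul_inv_cancel₀ ha]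
        ext n
        have hd : (C (-a) + X : k[X]).natDegree = 1 := by
          rw [add_comm]; exact natDegree_X_add_C _
        rw [coeff_reverse, hd]
        rcases n with _ | _ | n
        · simp [revAt_le]
        · simp [revAt_le, coeff_X, coeff_one]
        · rw [revAt_eq_self_of_lt (by omega)]
          simp [coeff_X, coeff_one]
      refine ⟨-a * c, mul_ne_zero (neg_ne_zero.2 ha) hc, ?_⟩
      rw [Multiset.map_cons, Multiset.prod_cons, reverse_mul_of_domain, e, e1]
      simp only [Multiset.map_cons, Multiset.prod_cons, C_mul]
      ring
  obtain ⟨c, hc, e⟩ := hrev _ h0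
  rw [Matrix.charpoly_inv A hA, ← Matrix.reverse_charpoly]
  conv_lhs => rw [hs, e]
  have e2 : (-1 : k[X]) ^ Fintype.card (Fin n) * C (Ring.inverse A.det) *
      (C c * ((A.charpoly.roots.map (·⁻¹)).map fun a => X - C a).prod) =
        C ((-1) ^ Fintype.card (Fin n) * Ring.inverse A.det * c) *
          ((A.charpoly.roots.map (·⁻¹)).map fun a => X - C a).prod := by
    simp only [C_mul, C_pow, C_neg, C_1]
    ring
  rw [e2, roots_C_mul, roots_multiset_prod_X_sub_C]
  refine mul_ne_zero (mul_ne_zero (pow_ne_zero _ (neg_ne_zero.2 one_ne_zero)) ?_) hc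
  rw [Ring.inverse_eq_inv']
  exact inv_ne_zero hdet

theorem pow_eq_one_of_mem_roots_charpoly {n : ℕ} (A : Matrix (Fin n) (Fin n) k) (M : ℕ)
    (hA : A ^ M = 1) (r : k) (hr : r ∈ A.charpoly.roots) : r ^ M = 1 := by
  have h1 := Matrix.mem_spectrum_of_isRoot_charpoly (Polynomial.isRoot_of_mem_roots hr)
  have h2 := spectrum.pow_mem_pow A M h1
  rw [hA] at h2
  by_contra h
  refine h2 ?_
  change IsUnit (algebraMap k _ (r ^ M) - 1)
  rw [← map_one (algebraMap k _), ← map_sub]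
  exact (isUnit_iff_ne_zero.2 (sub_ne_zero.2 h)).map _

variable [CharZero k] [IsAlgClosed k]

/-- An embedding of the field of algebraic numbers in `k` into the complex numbers. -/
noncomputable def algebraicEmbedding (k : Type*) [Field k] [CharZero k] :
    algebraicClosure ℚ k →+* ℂ :=
  haveI : Algebra.IsAlgebraic ℚ (algebraicClosure ℚ k) := by
    convert algebraicClosure.isAlgebraic ℚ k
    · rfl
    · exact Subsingleton.elim _ _
  (IsAlgClosed.lift : algebraicClosure ℚ k →ₐ[ℚ] ℂ).toRingHom

/-- The product of the traces of a matrix of finite order and of its inverse is an algebraic number,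
and is the square of an absolute value. -/
theorem exists_trace_mul_trace_of_pow_eq_one {n : ℕ} (g h : Matrix (Fin n) (Fin n) k)
    (hgh : g * h = 1) {M : ℕ} (hM : M ≠ 0) (hg : g ^ M = 1) :
    ∃ (z : algebraicClosure ℚ k) (s : ℂ), (z : k) = g.trace * h.trace ∧
      algebraicEmbedding k z = (Complex.normSq s : ℂ) ∧ (s = 0 → g.trace = 0) := by
  have hu : IsUnit g := IsUnit.of_mul_eq_one _ hgh
  have hh : h = g⁻¹ := (Matrix.inv_eq_right_inv hgh).symm
  have hR : ∀ r ∈ g.charpoly.roots, r ∈ algebraicClosure ℚ k := by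
    intro r hr
    have h1 := pow_eq_one_of_mem_roots_charpoly g M hg r hr
    rw [mem_algebraicClosure_iff]
    refine (IsIntegral.of_pow (Nat.pos_of_ne_zero hM) ?_).isAlgebraic
    rw [h1]
    exact isIntegral_one
  obtain ⟨R, hRR⟩ : ∃ R : Multiset (algebraicClosure ℚ k),
      R.map (algebraMap (algebraicClosure ℚ k) k) = g.charpoly.roots :=
    ⟨g.charpoly.roots.pmap Subtype.mk hR, by
      rw [Multiset.map_pmap]
      exact (Multiset.pmap_eq_map _ _ _ _).trans (Multiset.map_id _)⟩
  have hR1 : ∀ r ∈ R, r ^ M = 1 := by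
    intro r hr
    have h1 := pow_eq_one_of_mem_roots_charpoly g M hg (algebraMap _ k r)
      (hRR ▸ Multiset.mem_map_of_mem _ hr)
    rw [← map_pow] at h1
    exact (algebraMap (algebraicClosure ℚ k) k).injective (h1.trans (map_one _).symm)
  have ht : g.trace = algebraMap (algebraicClosure ℚ k) k R.sum := by
    rw [Matrix.trace_eq_sum_roots_charpoly, ← hRR, map_multiset_sum]
  have ht' : h.trace = algebraMap (algebraicClosure ℚ k) k (R.map (·⁻¹)).sum := by
    rw [Matrix.trace_eq_sum_roots_charpoly, hh, roots_charpoly_inv g hu, ← hRR, map_multiset_sum,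
      Multiset.map_map, Multiset.map_map]
    refine congrArg Multiset.sum (Multiset.map_congr rfl fun r _ => ?_)
    simp
  -- The eigenvalues are roots of unity, which have absolute value `1` in `ℂ`.
  have hc : algebraicEmbedding k (R.map (·⁻¹)).sum =
      (starRingEnd ℂ) (algebraicEmbedding k R.sum) := by
    rw [map_multiset_sum, map_multiset_sum, map_multiset_sum, Multiset.map_map, Multiset.map_map]
    refine congrArg Multiset.sum (Multiset.map_congr rfl fun r hr => ?_)
    have h1 : ‖algebraicEmbedding k r‖ = 1 := by
      refine Complex.norm_eq_one_of_pow_eq_one (n := M) ?_ hM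
      rw [← map_pow, hR1 r hr, map_one]
    rw [Function.comp_apply, Function.comp_apply, map_inv₀, Complex.inv_eq_conj h1]
  refine ⟨R.sum * (R.map (·⁻¹)).sum, algebraicEmbedding k R.sum, ?_, ?_, fun h0 => ?_⟩
  · rw [ht, ht', ← map_mul]
    rfl
  · rw [map_mul, hc, Complex.mul_conj]
  · rw [ht, (map_eq_zero_iff _ (algebraicEmbedding k).injective).1 h0, map_zero]

/-- The product of the traces of `g` and of its inverse does not change when `g` is rescaled. So it
is enough that `g` has finite order up to scalars. -/
theorem exists_trace_mul_trace {n : ℕ} (g h : Matrix (Fin n) (Fin n) k)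
    (hgh : g * h = 1) {M : ℕ} (hM : M ≠ 0) (c : k) (hg : g ^ M = c • 1) :
    ∃ (z : algebraicClosure ℚ k) (s : ℂ), (z : k) = g.trace * h.trace ∧
      algebraicEmbedding k z = (Complex.normSq s : ℂ) ∧ (s = 0 → g.trace = 0) := by
  by_cases hc : c = 0
  · have h0 : g ^ M = 0 := by rw [hg, hc, zero_smul]
    have hu : IsUnit g := IsUnit.of_mul_eq_one _ hgh
    have h1 : g = 0 := by
      have h2 := hu.pow M
      rw [h0, isUnit_zero_iff] at h2
      rw [← mul_one g, ← h2, mul_zero]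
    exact ⟨0, 0, by simp [h1], by simp, fun _ => by simp [h1]⟩
  · obtain ⟨s, hs⟩ := IsAlgClosed.exists_pow_nat_eq c (Nat.pos_of_ne_zero hM)
    have hs0 : s ≠ 0 := by
      rintro rfl
      exact hc (by rw [← hs, zero_pow hM])
    obtain ⟨z, w, h1, h2, h3⟩ := exists_trace_mul_trace_of_pow_eq_one (s⁻¹ • g) (s • h)
      (by rw [smul_mul_smul_comm, hgh, inv_mul_cancel₀ hs0, one_smul]) hM
      (by rw [smul_pow, hg, smul_smul, ← hs, inv_pow, inv_mul_cancel₀ (pow_ne_zero _ hs0),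
        one_smul])
    refine ⟨z, w, ?_, h2, fun h0 => ?_⟩
    · rw [h1, Matrix.trace_smul, Matrix.trace_smul, smul_mul_smul_comm, inv_mul_cancel₀ hs0,
        one_smul]
    · have h4 := h3 h0
      rw [Matrix.trace_smul, smul_eq_zero] at h4
      exact h4.resolve_left (inv_ne_zero hs0)

/-- If `g i` has finite order up to scalars, then `∑ i, Tr(g i) Tr((g i)⁻¹)` is a sum of squares of
absolute values, so that it vanishes only if all summands vanish. -/
theorem trace_eq_zero_of_sum_eq_zero {ι : Type*} [Fintype ι] (d : ι → ℕ)
    (g h : ∀ i, Matrix (Fin (d i)) (Fin (d i)) k) (hgh : ∀ i, g i * h i = 1) {M : ℕ} (hM : M ≠ 0)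
    (c : ι → k) (hg : ∀ i, g i ^ M = c i • 1) (h0 : ∑ i, (g i).trace * (h i).trace = 0) (i : ι) :
    (g i).trace = 0 := by
  choose z s h1 h2 h3 using fun i => exists_trace_mul_trace (g i) (h i) (hgh i) hM (c i) (hg i)
  refine h3 i ?_
  have h4 : ∑ i, z i = 0 := by
    refine (algebraMap (algebraicClosure ℚ k) k).injective ?_
    rw [map_sum, map_zero, ← h0]
    exact Finset.sum_congr rfl fun i _ => h1 i
  have h5 : ∑ i, Complex.normSq (s i) = 0 := by
    have h6 := congrArg (algebraicEmbedding k) h4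
    rw [map_sum, map_zero, Finset.sum_congr rfl fun i _ => h2 i] at h6
    exact_mod_cast h6
  rw [Finset.sum_eq_zero_iff_of_nonneg fun i _ => Complex.normSq_nonneg _] at h5
  exact Complex.normSq_eq_zero.1 (h5 i (Finset.mem_univ i))

end Traces

/-! ### The antipode of a semisimple Hopf algebra -/

section LarsonRadford
variable {k H : Type*} [Field k] [Ring H] [HopfAlgebra k H] [FiniteDimensional k H]

/-- A finite-dimensional semisimple algebra over an algebraically closed field carries a
nondegenerate trace form, hence the twisted trace form `λ` with `λ(x y) = λ(y S²(x))` is of the form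
`τ(? u)`, and conjugation by `u` is the square of the antipode. -/
theorem exists_unit_antipodeSq {Λ : H} (hΛ : IsNormalizedIntegral k Λ) {ι : Type*} [Fintype ι]
    (d : ι → ℕ) (E : H ≃ₐ[k] (∀ i, Matrix (Fin (d i)) (Fin (d i)) k)) :
    ∃ u v : H, u * v = 1 ∧ v * u = 1 ∧ ∀ x, u * x = antipodeSq k H x * u := by
  let τ : H →ₗ[k] k := ∑ i, Matrix.traceLinearMap (Fin (d i)) k k ∘ₗ LinearMap.proj i ∘ₗ
    E.toLinearMap
  have hτ : ∀ x, τ x = ∑ i, (E x i).trace := fun x => by simp [τ]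
  have hcomm : ∀ x y, τ (x * y) = τ (y * x) := fun x y => by
    rw [hτ, hτ]
    refine Finset.sum_congr rfl fun i _ => ?_
    rw [map_mul, map_mul, Pi.mul_apply, Pi.mul_apply, Matrix.trace_mul_comm]
  have hnd : ∀ y, (∀ x, τ (x * y) = 0) → y = 0 := fun y hy => by
    classical
    refine E.injective ((funext fun i => ?_ : E y = 0).trans (map_zero E).symm)
    refine Matrix.ext_iff_trace_mul_left.2 fun X => ?_
    have h := hy (E.symm (Pi.single i X))
    rw [hτ, Finset.sum_eq_single i] at h
    · rw [map_mul, AlgEquiv.apply_symm_apply, Pi.mul_apply, Pi.single_eq_same] at h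
      rw [h]
      simp
    · intro j _ hj
      rw [map_mul, AlgEquiv.apply_symm_apply, Pi.mul_apply, Pi.single_eq_of_ne hj, zero_mul,
        Matrix.trace_zero]
    · simp
  obtain ⟨u, hu⟩ : ∃ u, ∀ x, traceForm k H x = τ (x * u) := by
    let T : H →ₗ[k] Module.Dual k H := (LinearMap.mul k H).flip.compr₂ τ
    have hT : Function.Injective T := (injective_iff_map_eq_zero T).2 fun c hc =>
      hnd c fun y => LinearMap.congr_fun hc y
    obtain ⟨c, hc⟩ := (LinearMap.injective_iff_surjective_of_finrank_eq_finrank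
      (Subspace.dual_finrank_eq (K := k) (V := H)).symm).1 hT (traceForm k H)
    exact ⟨c, fun x => (LinearMap.congr_fun hc x).symm⟩
  have h1 : ∀ x, u * x = antipodeSq k H x * u := fun x => by
    refine sub_eq_zero.1 (hnd _ fun y => ?_)
    rw [mul_sub, map_sub, sub_eq_zero, ← mul_assoc, hcomm, ← mul_assoc, ← hu, traceForm_mul, hu,
      mul_assoc]
  have h2 : ∀ z, u * z = 0 → z = 0 := fun z hz => by
    rw [h1] at hz
    have h3 : antipodeSq k H z = 0 := hΛ.eq_zero_of_traceForm _ fun y => by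
      rw [hu, mul_assoc, hz, mul_zero, map_zero]
    exact hΛ.antipode_injective (hΛ.antipode_injective (h3.trans (by simp)))
  obtain ⟨v, hv⟩ := (LinearMap.injective_iff_surjective (f := LinearMap.mulLeft k u)).1
    ((injective_iff_map_eq_zero _).2 h2) 1
  refine ⟨u, v, hv, sub_eq_zero.1 (h2 _ ?_), h1⟩
  rw [mul_sub, ← mul_assoc, show u * v = 1 from hv, one_mul, mul_one, sub_self]

/-- Group-like elements are linearly independent, so a finite-dimensional Hopf algebra has only
finitely many of them, and the powers of one of them repeat. -/
theorem IsGroupLikeElem.exists_pow_eq_one {a : H} (ha : IsGroupLikeElem k a) :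
    ∃ n, n ≠ 0 ∧ a ^ n = 1 := by
  have hfin : {b : H | IsGroupLikeElem k b}.Finite :=
    (linearIndepOn_isGroupLikeElem (R := k) (A := H)).linearIndependent.setFinite
  obtain ⟨m, n, hmn, h⟩ := hfin.exists_lt_map_eq_of_forall_mem (f := fun n : ℕ => a ^ n)
    fun n => ha.pow
  refine ⟨n - m, (Nat.sub_pos_of_lt hmn).ne', ?_⟩
  have hu : IsUnit (a ^ m) := ha.isUnit.pow m
  refine hu.mul_left_cancel ?_
  rw [← pow_add, Nat.add_sub_of_le hmn.le, mul_one]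
  exact h.symm

/-- By Radford's formula, `S⁴` is the conjugation by the distinguished group-like element, which
has finite order. So the square of the antipode has finite order. -/
theorem iterate_antipodeSq_of_pow_eq_one {Λ : H} (hΛ : IsNormalizedIntegral k Λ) {n : ℕ}
    (hn : modularElt k Λ ^ n = 1) (y : H) :
    (antipodeSq k H ^ (2 * n)) y = y := by
  have ha := isGroupLikeElem_modularElt hΛ
  have h : ∀ m y, modularElt k Λ ^ m * (antipodeSq k H ^ (2 * m)) y = y * modularElt k Λ ^ m := by
    intro m
    induction m with
    | zero => intro y; simp
    | succ m ih =>
      intro y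
      rw [mul_add, mul_one, pow_add (antipodeSq k H), pow_succ' (modularElt k Λ), mul_assoc]
      change modularElt k Λ * (_ * (antipodeSq k H ^ (2 * m))
        (antipodeSq k H (antipodeSq k H y))) = _
      rw [ih, ← mul_assoc, modularElt_mul_antipodeSq hΛ, mul_assoc, ← pow_succ']
  have h1 := h n y
  rwa [hn, one_mul, mul_one] at h1

/-- The trace of `S²` does not vanish. On the matrix blocks of `H` the map `S²` is the conjugation
by matrices `uᵢ` that have finite order up to scalars, so its trace `∑ Tr(uᵢ) Tr(uᵢ⁻¹)` is a sum of
squares of absolute values. If it vanished, then so would all `Tr(uᵢ⁻¹)`, and the integral `λ` with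
them. -/
theorem trace_antipodeSq_ne_zero [CharZero k] [IsAlgClosed k] [IsSemisimpleRing H] :
    traceForm k H 1 ≠ 0 := by
  intro h0
  obtain ⟨Λ, hΛ⟩ := exists_normalizedIntegral (k := k) (H := H)
  obtain ⟨N, d, -, ⟨E⟩⟩ := IsSemisimpleRing.exists_algEquiv_pi_matrix_of_isAlgClosed k H
  obtain ⟨u, v, huv, hvu, hu⟩ := exists_unit_antipodeSq hΛ d E
  have hv : ∀ x, antipodeSq k H x = u * x * v := fun x => by
    rw [hu, mul_assoc, huv, mul_one]
  have ht : ∀ z, traceForm k H z = ∑ i, (E (z * u) i).trace * (E v i).trace := fun z => by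
    rw [← trace_mulLeft_mulRight_pi_matrix, ← LinearMap.trace_conj' _ E.symm.toLinearEquiv,
      traceForm_apply]
    refine congrArg _ (LinearMap.ext fun x => ?_)
    refine Eq.trans ?_ (LinearEquiv.conj_apply_apply _ _ _).symm
    change z * antipodeSq k H x = E.symm (E (z * u) * (E x * E v))
    rw [← map_mul, ← map_mul, AlgEquiv.symm_apply_apply, hv, ← mul_assoc, ← mul_assoc, ← mul_assoc,
      mul_assoc (z * u)]
  obtain ⟨n, hn, han⟩ := IsGroupLikeElem.exists_pow_eq_one (isGroupLikeElem_modularElt hΛ)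
  have hpow : ∀ m x, u ^ m * x = (antipodeSq k H ^ m) x * u ^ m := by
    intro m
    induction m with
    | zero => intro x; simp
    | succ m ih =>
      intro x
      rw [pow_succ, mul_assoc, hu, ← mul_assoc, ih, mul_assoc, pow_succ (antipodeSq k H)]
      rfl
  have hpowv : ∀ x, v ^ (2 * n) * x = x * v ^ (2 * n) := fun x => by
    have h1 := hpow (2 * n) x
    rw [iterate_antipodeSq_of_pow_eq_one hΛ han] at h1
    have h2 : v ^ (2 * n) * u ^ (2 * n) = 1 := by
      rw [← (show Commute v u from hvu.trans huv.symm).mul_pow, hvu, one_pow]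
    have h3 : u ^ (2 * n) * v ^ (2 * n) = 1 := by
      rw [← (show Commute u v from huv.trans hvu.symm).mul_pow, huv, one_pow]
    calc v ^ (2 * n) * x = v ^ (2 * n) * (x * u ^ (2 * n)) * v ^ (2 * n) := by
          rw [mul_assoc, mul_assoc x, h3, mul_one]
      _ = x * v ^ (2 * n) := by rw [← h1, ← mul_assoc, h2, one_mul]
  -- A power of `v` is central, hence scalar on each matrix block.
  have hc : ∀ i, ∃ c : k, E v i ^ (2 * n) = c • 1 := fun i => by
    classical
    have h1 : E v i ^ (2 * n) ∈ Set.center (Matrix (Fin (d i)) (Fin (d i)) k) := by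
      rw [Semigroup.mem_center_iff]
      intro X
      have h2 := congrFun (congrArg E (hpowv (E.symm (Pi.single i X)))) i
      rw [map_mul, map_mul, AlgEquiv.apply_symm_apply, Pi.mul_apply, Pi.mul_apply,
        Pi.single_eq_same, map_pow, Pi.pow_apply] at h2
      exact h2.symm
    rw [Matrix.center_eq_range] at h1
    obtain ⟨c, hc⟩ := h1
    exact ⟨c, by rw [← hc, Matrix.smul_one_eq_diagonal]; rfl⟩
  choose c hc using hc
  have h1 : ∑ i, (E v i).trace * (E u i).trace = 0 := by
    rw [← h0, ht, one_mul]
    exact Finset.sum_congr rfl fun i _ => mul_comm _ _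
  have h2 := trace_eq_zero_of_sum_eq_zero d (E v) (E u)
    (fun i => by rw [← Pi.mul_apply, ← map_mul, hvu, map_one, Pi.one_apply])
    (mul_ne_zero two_ne_zero hn) c hc h1
  have h3 := hΛ.traceForm_eq_one
  rw [ht, Finset.sum_eq_zero fun i _ => by rw [h2 i, mul_zero]] at h3
  exact zero_ne_one h3

/-- Since `λ(1) = Tr S²` does not vanish, `λ(1) 1 = λ(1) a` shows that the distinguished group-like
element `a` is trivial, and Radford's formula becomes `S⁴ = 1`. -/
theorem antipodeSq_antipodeSq [CharZero k] [IsAlgClosed k] [IsSemisimpleRing H] (x : H) :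
    antipodeSq k H (antipodeSq k H x) = x := by
  obtain ⟨Λ, hΛ⟩ := exists_normalizedIntegral (k := k) (H := H)
  have h1 := hit_traceForm hΛ (1 : H)
  have h2 : hit (traceForm k H) (1 : H) = traceForm k H 1 • 1 := by
    rw [hit_apply, Bialgebra.comul_one]
    rfl
  rw [h2] at h1
  have ha := smul_right_injective H (trace_antipodeSq_ne_zero (k := k) (H := H)) h1
  have h3 := modularElt_mul_antipodeSq hΛ x
  rwa [← ha, one_mul, mul_one] at h3

/-- The character of the regular representation. -/
noncomputable def regularChar (k H : Type*) [Field k] [Ring H] [Algebra k H] : H →ₗ[k] k :=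
  LinearMap.trace k H ∘ₗ LinearMap.mul k H

omit [FiniteDimensional k H] in
theorem regularChar_apply (x : H) :
    regularChar k H x = LinearMap.trace k H (LinearMap.mulLeft k x) := rfl

theorem trace_mulLeft_tensor (t : H ⊗[k] H) : LinearMap.trace k _ (LinearMap.mulLeft k t) =
    LinearMap.mul' k k (TensorProduct.map (regularChar k H) (regularChar k H) t) := by
  have h : ∀ t : H ⊗[k] H, LinearMap.trace k _ (LinearMap.mulLeft k t) =
    (LinearMap.trace k _ ∘ₗ LinearMap.mul k (H ⊗[k] H)) t := fun _ => rfl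
  rw [h]
  induction t with
  | zero => simp
  | add x y hx hy => simp only [map_add, hx, hy]
  | tmul x y =>
    rw [← h]
    have e : LinearMap.mulLeft k (x ⊗ₜ[k] y) =
        TensorProduct.map (LinearMap.mulLeft k x) (LinearMap.mulLeft k y) :=
      TensorProduct.ext' fun _ _ => Algebra.TensorProduct.tmul_mul_tmul _ _ _ _
    rw [e, LinearMap.trace_tensorProduct']
    rfl

/-- The tensor square of the regular representation is a multiple of the regular representation. In
other words, the regular character `χ` satisfies `χ * χ = (dim H) χ` in `H^*`. -/
theorem regularChar_hit (x : H) :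
    regularChar k H (hit (regularChar k H) x) = (Module.finrank k H : k) * regularChar k H x := by
  -- The map `y ⊗ z ↦ y₍₁₎ ⊗ y₍₂₎ z` is bijective, with inverse `y ⊗ z ↦ y₍₁₎ ⊗ S(y₍₂₎) z`. It
  -- intertwines the action of `x` on the first factor with the diagonal action.
  let Φ : Module.End k (H ⊗[k] H) := TensorProduct.lift
    ((LinearMap.mul k (H ⊗[k] H)).compl₁₂ Coalgebra.comul (TensorProduct.mk k H H 1))
  let Ψ : Module.End k (H ⊗[k] H) := TensorProduct.lift
    ((LinearMap.mul k (H ⊗[k] H)).compl₁₂ ((HopfAlgebra.antipode k).lTensor H ∘ₗ Coalgebra.comul)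
      (TensorProduct.mk k H H 1))
  have hΨΦ : Ψ * Φ = 1 := by
    refine TensorProduct.ext' fun y z => ?_
    let K : H ⊗[k] (H ⊗[k] H) →ₗ[k] H ⊗[k] H := LinearMap.mulRight k (1 ⊗ₜ[k] z) ∘ₗ
      TensorProduct.map LinearMap.id (LinearMap.mul' k H ∘ₗ (HopfAlgebra.antipode k).rTensor H)
    have h1 : ∀ t : H ⊗[k] H, Ψ (t * (1 ⊗ₜ z)) =
        K (TensorProduct.assoc k H H H (Coalgebra.comul.rTensor H t)) := by
      intro t
      induction t with
      | zero => simp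
      | add x y hx hy => simp only [map_add, add_mul, hx, hy]
      | tmul a b =>
        rw [Algebra.TensorProduct.tmul_mul_tmul, mul_one, LinearMap.rTensor_tmul]
        change (HopfAlgebra.antipode k).lTensor H (Coalgebra.comul a) * ((1 : H) ⊗ₜ[k] (b * z)) = _
        generalize Coalgebra.comul (R := k) a = t
        induction t with
        | zero => simp
        | add x y hx hy => simp only [map_add, add_mul, TensorProduct.add_tmul, hx, hy]
        | tmul a c => simp [K, mul_assoc]
    have h2 : ∀ t : H ⊗[k] H, K (Coalgebra.comul.lTensor H t) =
        TensorProduct.rid k H (Coalgebra.counit.lTensor H t) ⊗ₜ z := by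
      intro t
      induction t with
      | zero => simp
      | add x y hx hy => simp only [map_add, TensorProduct.add_tmul, hx, hy]
      | tmul a b =>
        change (a ⊗ₜ[k] LinearMap.mul' k H ((HopfAlgebra.antipode k).rTensor H
          (Coalgebra.comul b))) * ((1 : H) ⊗ₜ[k] z) = _
        rw [HopfAlgebra.mul_antipode_rTensor_comul_apply]
        simp [Algebra.algebraMap_eq_smul_one, TensorProduct.smul_tmul']
    change Ψ (Coalgebra.comul y * (1 ⊗ₜ z)) = y ⊗ₜ z
    rw [h1, Coalgebra.coassoc_apply, h2, Coalgebra.lTensor_counit_comul, TensorProduct.rid_tmul,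
      one_smul]
  have hΦΨ : Φ * Ψ = 1 := mul_eq_one_comm.1 hΨΦ
  have h1 : LinearMap.mulLeft k (Coalgebra.comul x) * Φ =
      Φ * TensorProduct.map (LinearMap.mulLeft k x) LinearMap.id := by
    refine TensorProduct.ext' fun y z => ?_
    change Coalgebra.comul x * (Coalgebra.comul y * ((1 : H) ⊗ₜ[k] z)) =
      Coalgebra.comul (x * y) * ((1 : H) ⊗ₜ[k] z)
    rw [Bialgebra.comul_mul, mul_assoc]
  have h2 : LinearMap.trace k _ (LinearMap.mulLeft k (Coalgebra.comul (R := k) x)) =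
      (Module.finrank k H : k) * regularChar k H x := by
    rw [← mul_one (LinearMap.mulLeft k (Coalgebra.comul (R := k) x)), ← hΦΨ, ← mul_assoc, h1,
      LinearMap.trace_mul_comm, ← mul_assoc, hΨΦ, one_mul, LinearMap.trace_tensorProduct',
      LinearMap.trace_id, mul_comm]
    rfl
  rw [← h2, trace_mulLeft_tensor, hit_apply]
  generalize Coalgebra.comul (R := k) x = t
  induction t with
  | zero => simp
  | add x y hx hy => simp only [map_add, hx, hy]
  | tmul a b => simp

omit [FiniteDimensional k H] in
/-- The form `f ↦ Tr(S² ∘ hit f)` on `H^*` is an integral: it is the analogue for `H^*` of the form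
`traceForm` on `H`. -/
theorem trace_antipodeSq_hit_mulLeft (f : H →ₗ[k] k) (x : H) :
    LinearMap.trace k H ((antipodeSq k H).toLinearMap * hit (f ∘ₗ LinearMap.mulLeft k x)) =
      Coalgebra.counit (R := k) x *
        LinearMap.trace k H ((antipodeSq k H).toLinearMap * hit f) := by
  let σ := (antipodeSq k H).toLinearMap
  let Ξ : H ⊗[k] H →ₗ[k] Module.End k H := TensorProduct.lift
    ((LinearMap.mul k (Module.End k H)).flip.compl₁₂
      (LinearMap.mulLeft k (σ * hit f) ∘ₗ LinearMap.mul k H)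
      (LinearMap.mul k H ∘ₗ HopfAlgebra.antipode k))
  have hΞ : ∀ a b, Ξ (a ⊗ₜ b) = LinearMap.mulLeft k (HopfAlgebra.antipode k b) *
    (σ * hit f * LinearMap.mulLeft k a) := fun _ _ => rfl
  have h1 : ∀ t : H ⊗[k] H, LinearMap.trace k H (Ξ t) = LinearMap.trace k H (σ * hit f *
      LinearMap.mulLeft k (LinearMap.mul' k H ((HopfAlgebra.antipode k).lTensor H t))) := by
    have e : ∀ y, LinearMap.mulLeft k y = LinearMap.mul k H y := fun _ => rfl
    intro t
    induction t with
    | zero => simp [e]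
    | add x y hx hy => simp only [e, map_add, mul_add] at hx hy ⊢; rw [hx, hy]
    | tmul a b =>
      have e' : LinearMap.mulLeft k a * LinearMap.mulLeft k (HopfAlgebra.antipode k b) =
          LinearMap.mulLeft k (a * HopfAlgebra.antipode k b) := (LinearMap.mulLeft_mul ..).symm
      rw [hΞ, LinearMap.trace_mul_comm, mul_assoc, e']
      rfl
  have h2 : Ξ (Coalgebra.comul x) = σ * hit (f ∘ₗ LinearMap.mulLeft k x) := by
    refine LinearMap.ext fun y => ?_
    let P : H ⊗[k] H →ₗ[k] H := (TensorProduct.lid k H).toLinearMap ∘ₗ TensorProduct.map f σ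
    let m : H ⊗[k] H →ₗ[k] H := LinearMap.mul' k H ∘ₗ (TensorProduct.comm k H H).toLinearMap ∘ₗ
      TensorProduct.map σ (HopfAlgebra.antipode k)
    have hm : ∀ z, m (Coalgebra.comul z) = algebraMap k H (Coalgebra.counit z) := by
      have e : ∀ t : H ⊗[k] H, m t = HopfAlgebra.antipode k
          (LinearMap.mul' k H ((HopfAlgebra.antipode k).rTensor H t)) := by
        intro t
        induction t with
        | zero => simp
        | add x y hx hy => simp only [map_add, hx, hy]
        | tmul a b =>
          exact (HopfAlgebra.antipode_mul_antidistrib (R := k) (HopfAlgebra.antipode k a) b).symm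
      intro z
      rw [e, HopfAlgebra.mul_antipode_rTensor_comul_apply, Algebra.algebraMap_eq_smul_one,
        map_smul, HopfAlgebra.antipode_one]
    let K : H ⊗[k] (H ⊗[k] H) →ₗ[k] H := TensorProduct.lift
      ((LinearMap.mul k H).flip.compl₁₂
        (P ∘ₗ LinearMap.mulRight k (Coalgebra.comul y) ∘ₗ (TensorProduct.mk k H H).flip 1) m)
    have hK : ∀ a v, K (a ⊗ₜ v) = m v * P ((a ⊗ₜ 1) * Coalgebra.comul y) := fun _ _ => rfl
    have e1 : ∀ t : H ⊗[k] H, Ξ t y =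
        K (TensorProduct.assoc k H H H (Coalgebra.comul.rTensor H t)) := by
      intro t
      induction t with
      | zero => simp
      | add x y hx hy => simp only [map_add, LinearMap.add_apply, hx, hy]
      | tmul a c =>
        rw [hΞ, LinearMap.rTensor_tmul]
        change HopfAlgebra.antipode k c * σ (hit f (a * y)) = _
        rw [hit_apply, Bialgebra.comul_mul]
        generalize Coalgebra.comul (R := k) a = u
        induction u with
        | zero => simp
        | add p q hp hq => simp only [map_add, add_mul, mul_add, TensorProduct.add_tmul, hp, hq]
        | tmul a b =>
          rw [TensorProduct.assoc_tmul, hK]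
          change _ = (HopfAlgebra.antipode k c * σ b) * _
          generalize Coalgebra.comul (R := k) y = v
          induction v with
          | zero => simp
          | add p q hp hq => simp only [map_add, mul_add, hp, hq]
          | tmul p q => simp [P, σ, mul_assoc]
    have e2 : ∀ t : H ⊗[k] H, K (Coalgebra.comul.lTensor H t) =
        P ((TensorProduct.rid k H (Coalgebra.counit.lTensor H t) ⊗ₜ 1) * Coalgebra.comul y) := by
      intro t
      induction t with
      | zero => simp
      | add p q hp hq => simp only [map_add, TensorProduct.add_tmul, add_mul, hp, hq]
      | tmul a z =>
        rw [LinearMap.lTensor_tmul, hK, hm]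
        simp [Algebra.algebraMap_eq_smul_one, ← TensorProduct.smul_tmul']
    rw [e1, Coalgebra.coassoc_apply, e2, Coalgebra.lTensor_counit_comul, TensorProduct.rid_tmul,
      one_smul, Module.End.mul_apply, hit_apply]
    generalize Coalgebra.comul (R := k) y = v
    induction v with
    | zero => simp
    | add p q hp hq => simp only [map_add, mul_add, hp, hq]
    | tmul p q => simp [P]
  have h3 : ∀ r : k, LinearMap.mulLeft k (algebraMap k H r) = r • (1 : Module.End k H) :=
    fun r => LinearMap.ext fun y => (Algebra.smul_def r y).symm
  rw [← h2, h1, HopfAlgebra.mul_antipode_lTensor_comul_apply, h3, mul_smul_comm, mul_one, map_smul,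
    smul_eq_mul]

/-- As `χ(Λ ?) = ε` for the regular character `χ` and the normalized integral `Λ`, the operators
`hit χ` and `hit ε = 1` have the same trace against `S²`. -/
theorem trace_antipodeSq_hit_regularChar {Λ : H} (hΛ : IsNormalizedIntegral k Λ) :
    LinearMap.trace k H ((antipodeSq k H).toLinearMap * hit (regularChar k H)) =
      LinearMap.trace k H (antipodeSq k H).toLinearMap := by
  have h1 : regularChar k H Λ = 1 := by
    have e : LinearMap.mulLeft k Λ = (Coalgebra.counit (R := k) (A := H)).smulRight Λ :=
      LinearMap.ext fun y => hΛ.mul_right y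
    rw [regularChar_apply, e, LinearMap.trace_smulRight, hΛ.counit_eq_one]
  have h2 : regularChar k H ∘ₗ LinearMap.mulLeft k Λ = Coalgebra.counit (R := k) := by
    refine LinearMap.ext fun y => ?_
    change regularChar k H (Λ * y) = _
    rw [hΛ.mul_right, map_smul, h1, smul_eq_mul, mul_one]
  have h3 : hit (Coalgebra.counit (R := k) (A := H)) = 1 := LinearMap.ext hit_counit
  have h4 := trace_antipodeSq_hit_mulLeft (regularChar k H) Λ
  rw [h2, h3, mul_one, hΛ.counit_eq_one, one_mul] at h4
  exact h4.symm

/-- An idempotent has a natural number as its trace. -/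
theorem exists_trace_eq_natCast {M : Type*} [AddCommGroup M] [Module k M] [FiniteDimensional k M]
    {e : Module.End k M} (he : IsIdempotentElem e) : ∃ n : ℕ, LinearMap.trace k M e = n :=
  ⟨_, (LinearMap.IsIdempotentElem.isProj_range e he).trace⟩

/-- An involution `T` whose nonzero trace is divisible by the dimension in the following sense:
`P` is a multiple by `dim M` of a projection commuting with `T`, and `Tr(T P) = Tr T`. -/
theorem eq_one_or_eq_neg_one_of_trace [CharZero k] {M : Type*} [AddCommGroup M] [Module k M]
    [FiniteDimensional k M] (T P : Module.End k M) (hT : T * T = 1)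
    (hn : (Module.finrank k M : k) ≠ 0) (hP : P * P = (Module.finrank k M : k) • P)
    (hTP : Commute T P) (h : LinearMap.trace k M (T * P) = LinearMap.trace k M T)
    (h0 : LinearMap.trace k M T ≠ 0) : T = 1 ∨ T = -1 := by
  set n := Module.finrank k M
  let e := (2⁻¹ : k) • (1 + T)
  let e' := (2⁻¹ : k) • (1 - T)
  let Q := (n : k)⁻¹ • P
  have two : (2 : k) ≠ 0 := two_ne_zero
  have he : IsIdempotentElem e := by
    change (2⁻¹ : k) • (1 + T) * ((2⁻¹ : k) • (1 + T)) = (2⁻¹ : k) • (1 + T)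
    have e1 : (1 + T) * (1 + T) = (2 : k) • (1 + T) := by
      rw [mul_add, add_mul, add_mul, hT, two_smul]; simp only [one_mul, mul_one]; abel
    rw [smul_mul_smul_comm, e1, smul_smul, mul_assoc, inv_mul_cancel₀ two, mul_one]
  have he' : IsIdempotentElem e' := by
    change (2⁻¹ : k) • (1 - T) * ((2⁻¹ : k) • (1 - T)) = (2⁻¹ : k) • (1 - T)
    have e1 : (1 - T) * (1 - T) = (2 : k) • (1 - T) := by
      rw [mul_sub, sub_mul, sub_mul, hT, two_smul]; simp only [one_mul, mul_one]; abel
    rw [smul_mul_smul_comm, e1, smul_smul, mul_assoc, inv_mul_cancel₀ two, mul_one]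
  have hQ : IsIdempotentElem Q := by
    change (n : k)⁻¹ • P * ((n : k)⁻¹ • P) = (n : k)⁻¹ • P
    rw [smul_mul_smul_comm, hP, smul_smul, mul_assoc, inv_mul_cancel₀ hn, mul_one]
  have hTQ : Commute T Q := hTP.smul_right _
  have hQe : IsIdempotentElem (Q * e) :=
    hQ.mul_of_commute (((Commute.one_right Q).add_right hTQ.symm).smul_right _) he
  have hQe' : IsIdempotentElem (Q * e') :=
    hQ.mul_of_commute (((Commute.one_right Q).sub_right hTQ.symm).smul_right _) he'
  -- With `p`, `q` the dimensions of the two eigenspaces of `T`, and `r`, `s` those of their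
  -- intersections with the image of `P`, one has `p + q = n` and `p - q = n (r - s) ≠ 0`. Hence
  -- `|p - q| ≥ p + q`, so that `p` or `q` vanishes.
  obtain ⟨p, hp⟩ := exists_trace_eq_natCast he
  obtain ⟨q, hq⟩ := exists_trace_eq_natCast he'
  obtain ⟨r, hr⟩ := exists_trace_eq_natCast hQe
  obtain ⟨s, hs⟩ := exists_trace_eq_natCast hQe'
  have e1 : e + e' = 1 := by
    change (2⁻¹ : k) • (1 + T) + (2⁻¹ : k) • (1 - T) = 1
    rw [← smul_add, add_add_sub_cancel, ← two_smul k (1 : Module.End k M), smul_smul,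
      inv_mul_cancel₀ two, one_smul]
  have e2 : e - e' = T := by
    change (2⁻¹ : k) • (1 + T) - (2⁻¹ : k) • (1 - T) = T
    rw [← smul_sub, add_sub_sub_cancel, ← two_smul k T, smul_smul,
      inv_mul_cancel₀ two, one_smul]
  have h1 : (p : k) + q = n := by
    rw [← hp, ← hq, ← map_add, e1, LinearMap.trace_one]
  have h2 : (p : k) - q = LinearMap.trace k M T := by
    rw [← hp, ← hq, ← map_sub, e2]
  have h3 : (n : k) * (r - s) = LinearMap.trace k M T := by
    rw [← hr, ← hs, ← map_sub, ← mul_sub, e2, ← h, hTP.eq]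
    change _ * LinearMap.trace k M ((n : k)⁻¹ • P * T) = _
    rw [smul_mul_assoc, map_smul, smul_eq_mul, mul_inv_cancel_left₀ hn]
  have h4 : (p : ℤ) + q = n := by exact_mod_cast h1
  have h5 : (n : ℤ) * (r - s) = p - q := by
    rw [← h2] at h3
    exact_mod_cast h3
  have h6 : (r : ℤ) - s ≠ 0 := by
    intro h7
    rw [h7, mul_zero] at h5
    apply h0
    rw [← h2]
    exact_mod_cast h5.symm
  have h7 : (p : ℤ) = 0 ∨ (q : ℤ) = 0 := by
    rcases lt_or_gt_of_ne h6 with h8 | h8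
    · left; nlinarith
    · right; nlinarith
  rcases h7 with h8 | h8
  · right
    have h9 : e = 0 := (LinearMap.IsIdempotentElem.trace_eq_zero_iff he).1 (by
      rw [hp]; exact_mod_cast h8)
    rw [← e2, ← e1, h9]; simp
  · left
    have h9 : e' = 0 := (LinearMap.IsIdempotentElem.trace_eq_zero_iff he').1 (by
      rw [hq]; exact_mod_cast h8)
    rw [← e2, ← e1, h9]; simp

/-- The Larson–Radford theorem: the antipode of a finite-dimensional semisimple Hopf algebra over an
algebraically closed field of characteristic zero is an involution. As `S⁴ = 1`, it is enough that
the trace of the involution `S²` is divisible by the dimension of `H` in the sense of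
`eq_one_or_eq_neg_one_of_trace`, with `P = hit χ` for the regular character `χ`. -/
theorem antipode_antipode [CharZero k] [IsAlgClosed k] [IsSemisimpleRing H] (x : H) :
    HopfAlgebra.antipode k (HopfAlgebra.antipode k x) = x := by
  obtain ⟨Λ, hΛ⟩ := exists_normalizedIntegral (k := k) (H := H)
  have : Nontrivial H := ⟨1, 0, fun h => by
    have h1 := congrArg (Coalgebra.counit (R := k)) h
    rw [Bialgebra.counit_one, map_zero] at h1
    exact one_ne_zero h1⟩
  have hT : (antipodeSq k H).toLinearMap * (antipodeSq k H).toLinearMap = 1 :=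
    LinearMap.ext antipodeSq_antipodeSq
  have hP : hit (regularChar k H) * hit (regularChar k H) =
      (Module.finrank k H : k) • hit (regularChar k H) := by
    refine LinearMap.ext fun y => ?_
    have e : regularChar k H ∘ₗ hit (regularChar k H) =
        (Module.finrank k H : k) • regularChar k H := LinearMap.ext regularChar_hit
    rw [Module.End.mul_apply, hit_hit, e, map_smul]
  have hχ : ∀ y, regularChar k H (antipodeSq k H y) = regularChar k H y := fun y => by
    have e : LinearMap.mulLeft k (antipodeSq k H y) =
        (antipodeSq k H).toLinearMap * (LinearMap.mulLeft k y * (antipodeSq k H).toLinearMap) := by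
      refine LinearMap.ext fun z => ?_
      change _ = antipodeSq k H (y * antipodeSq k H z)
      rw [map_mul, antipodeSq_antipodeSq]
      rfl
    rw [regularChar_apply, e, LinearMap.trace_mul_comm, mul_assoc, hT, mul_one]
    rfl
  have hTP : Commute (antipodeSq k H).toLinearMap (hit (regularChar k H)) := by
    refine LinearMap.ext fun y => ?_
    change antipodeSq k H (hit _ y) = hit _ (antipodeSq k H y)
    rw [hit_apply, hit_apply, comul_antipodeSq]
    generalize Coalgebra.comul (R := k) y = t
    induction t with
    | zero => simp
    | add x y hx hy => simp only [map_add, hx, hy]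
    | tmul x y => simp [hχ]
  have h0 : LinearMap.trace k H (antipodeSq k H).toLinearMap ≠ 0 := by
    have h1 := trace_antipodeSq_ne_zero (k := k) (H := H)
    rwa [traceForm_apply, LinearMap.mulLeft_one, ← Module.End.one_eq_id, one_mul] at h1
  rcases eq_one_or_eq_neg_one_of_trace _ _ hT
    (Nat.cast_ne_zero.2 Module.finrank_pos.ne') hP hTP (trace_antipodeSq_hit_regularChar hΛ) h0
    with h | h
  · exact LinearMap.congr_fun h x
  -- The case `S² = -1` is impossible, as `S²` preserves the unit.
  · have h1 : antipodeSq k H 1 = -1 := LinearMap.congr_fun h 1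
    rw [map_one] at h1
    have h2 : (2 : k) • (1 : H) = 0 := by
      rw [two_smul]
      nth_rewrite 2 [h1]
      exact add_neg_cancel 1
    exact absurd h2 (smul_ne_zero two_ne_zero one_ne_zero)

end LarsonRadford

/-! ### Operators at different vertices and in different plaquettes -/

/-- Bimodule operators commute if the four pairs of left and right actions do. -/
theorem BimoduleStructure.act_commute {k A A' M : Type*} [CommRing k] [Ring A] [Algebra k A]
    [Ring A'] [Algebra k A'] [AddCommGroup M] [Module k M] (β : BimoduleStructure k A M)
    (β' : BimoduleStructure k A' M) {a b : A} {a' b' : A'}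
    (hl : Commute (β.left a) (β'.left a')) (hlr : Commute (β.left a) (β'.right b').unop)
    (hrl : Commute (β.right b).unop (β'.left a')) (hr : Commute (β.right b) (β'.right b')) :
    Commute (β.act a b) (β'.act a' b') :=
  (hl.mul_right hlr).mul_left (hrl.mul_right hr.unop)

namespace VertexLabelling
variable {k : Type*} [Field k] {V E F : Type*} {Γ : CellDecomposition V E F}
  [Fintype E] [DecidableEq E] [DecidableEq V] {L : Labelling k Γ} (Z : VertexLabelling L)

theorem regularAct_commute {v w : V} (h : v ≠ w) (a : L.KAt v) (b : L.KAt w) :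
    Commute (L.regularAct v a) (L.regularAct w b) := by
  refine commute_piLift _ _ _ (fun d' y => ?_) b
  refine (commute_piLift _ _ _ (fun d x => ?_) a).symm
  exact L.halfEdgeMul_commute d'.1 d.1 (fun e => h (by rw [← d.2, ← d'.2, e])) y x

theorem vertexBimodule_act_commute {v w : V} (h : v ≠ w) (a b : L.KAt v) (a' b' : L.KAt w) :
    Commute ((Z.vertexBimodule v).act a b) ((Z.vertexBimodule w).act a' b') :=
  BimoduleStructure.act_commute _ _
    ((onFactor_commute (M := Z.Z) h (Z.vertexKAct v a) (Z.vertexKAct w a')).map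
      (postcomp k (⨂[k] e, L.K e) (⨂[k] v, Z.Z v)))
    (postcomp_precomp_commute _ _) (postcomp_precomp_commute _ _).symm
    ((regularAct_commute h b b').map (precomp k (⨂[k] e, L.K e) (⨂[k] v, Z.Z v)))

/-- To commute with the right action of a plaquette, it is enough to commute with the actions at
its edges and at its sites. -/
theorem commute_plaquetteRight (c : E × Bool) (T : (Module.End k Z.StateSpace)ᵐᵒᵖ)
    (he : ∀ i, i < Z.size c → ∀ f, Commute (Z.edgeRight ((Γ.next ^ (i + 1)) c) f) T)
    (hs : ∀ i, i + 1 < Z.size c → ∀ f, Commute (Z.siteRight ((Γ.next ^ (i + 1)) c) f) T)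
    (f : DualAlgebra k (L.H (Γ.face c))) : Commute (Z.plaquetteRight c f) T := by
  refine commute_convProd _ _ (fun r hr g => ?_) f
  obtain ⟨j, hj, rfl⟩ := List.mem_map.1 hr
  have hj := List.mem_range.1 hj
  rw [plaquetteItem, AlgHom.comp_apply]
  split_ifs with h
  · exact he _ (by omega) _
  · exact hs _ (by omega) _

theorem siteLeft_plaquetteRight_commute_of_face_ne {c c' : E × Bool} (h : Γ.face c ≠ Γ.face c')
    (f g) : Commute (Z.siteLeft c f) (Z.plaquetteRight c' g).unop := by
  have := Z.commute_plaquetteRight c' (MulOpposite.op (Z.siteLeft c f))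
    (fun i _ _ => (postcomp_precomp_commute _ _).symm.op)
    (fun i _ _ => (Z.siteLeft_commute _ _ (fun e => h (by rw [← e, Γ.face_next_pow])) _ _).op) g
  exact this.unop.symm

theorem plaquetteRight_commute_of_face_ne {c c' : E × Bool} (h : Γ.face c ≠ Γ.face c')
    (f g) : Commute (Z.plaquetteRight c f) (Z.plaquetteRight c' g) := by
  have hne : ∀ i j, (Γ.next ^ i) c ≠ (Γ.next ^ j) c' := fun i j e =>
    h (by rw [← Γ.face_next_pow c i, e, Γ.face_next_pow])
  refine Z.commute_plaquetteRight c _ (fun i _ f => ?_) (fun i _ f => ?_) f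
  · exact (Z.commute_plaquetteRight c' _ (fun j _ g => Z.edgeRight_commute _ _ (hne _ _).symm _ _)
      (fun j _ g => (Z.edgeRight_siteRight_commute _ _ _ _).symm) g).symm
  · exact (Z.commute_plaquetteRight c' _ (fun j _ g => Z.edgeRight_siteRight_commute _ _ _ _)
      (fun j _ g => Z.siteRight_commute _ _ (hne _ _).symm _ _) g).symm

theorem plaquetteBimodule_act_commute {c c' : E × Bool} (h : Γ.face c ≠ Γ.face c')
    (f g : DualAlgebra k (L.H (Γ.face c))) (f' g' : DualAlgebra k (L.H (Γ.face c'))) :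
    Commute ((Z.plaquetteBimodule c).act f g) ((Z.plaquetteBimodule c').act f' g') :=
  BimoduleStructure.act_commute _ _
    (Z.siteLeft_commute c c' (fun e => h (congrArg Γ.face e)) f f')
    (Z.siteLeft_plaquetteRight_commute_of_face_ne h f g')
    (Z.siteLeft_plaquetteRight_commute_of_face_ne h.symm f' g).symm
    (Z.plaquetteRight_commute_of_face_ne h g g')

end VertexLabelling

/-! ### The universal property of the crossed product -/

namespace CrossedProduct
variable {k B A K S : Type*} [CommRing k] [Ring B] [Bialgebra k B] [Ring A] [Algebra k A] [Ring K]
  [Algebra k K] [Ring S] [Algebra k S] (M : LeftModuleAlgebra k B A) (N : LeftComoduleAlgebra k B K)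

/-- The elements `x` of the comodule algebra that satisfy the straightening relation
`ψ x * φ a = φ (x₍₋₁₎.a) * ψ x₍₀₎` of the crossed product for all `a`. -/
def straightening (φ : A →ₐ[k] S) (ψ : K →ₐ[k] S) : Subalgebra k K where
  carrier := {x | ∀ a, ψ x * φ a = LinearMap.mul' k S (TensorProduct.map
    (φ.toLinearMap ∘ₗ M.act.toLinearMap.flip a) ψ.toLinearMap (N.coact x))}
  add_mem' {x y} hx hy a := by rw [map_add, add_mul, hx, hy, map_add, map_add, map_add]
  algebraMap_mem' r a := by
    simp [Algebra.algebraMap_eq_smul_one, Algebra.TensorProduct.one_def]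
  mul_mem' {x y} hx hy a := by
    have key : ∀ s t : B ⊗[k] K, (∀ a, ψ x * φ a = LinearMap.mul' k S (TensorProduct.map
        (φ.toLinearMap ∘ₗ M.act.toLinearMap.flip a) ψ.toLinearMap s)) →
        ψ x * LinearMap.mul' k S (TensorProduct.map
          (φ.toLinearMap ∘ₗ M.act.toLinearMap.flip a) ψ.toLinearMap t) =
        LinearMap.mul' k S (TensorProduct.map
          (φ.toLinearMap ∘ₗ M.act.toLinearMap.flip a) ψ.toLinearMap (s * t)) := by
      intro s t hs
      induction t with
      | zero => simp
      | add p q hp hq => simp only [map_add, mul_add, hp, hq]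
      | tmul b z =>
        change ψ x * (φ (M.act b a) * ψ z) = _
        rw [← mul_assoc, hs]
        clear hs
        induction s with
        | zero => simp
        | add p q hp hq => simp only [map_add, add_mul, hp, hq]
        | tmul c w =>
          simp [mul_assoc]
    rw [map_mul, mul_assoc, hy, key _ _ hx, ← map_mul]

/-- The straightening relation, for an explicit decomposition of the coaction. -/
theorem mem_straightening_of_sum {φ : A →ₐ[k] S} {ψ : K →ₐ[k] S} {x : K} {ι : Type*}
    (I : Finset ι) (b : ι → B) (y : ι → K) (hx : N.coact x = ∑ i ∈ I, b i ⊗ₜ y i)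
    (h : ∀ a, ψ x * φ a = ∑ i ∈ I, φ (M.act (b i) a) * ψ (y i)) :
    x ∈ straightening M N φ ψ := by
  intro a
  rw [h, hx, map_sum, map_sum]
  rfl

/-- The elements of the two factors generate the crossed product. -/
theorem ofTensor_eq (a : A) (x : K) :
    ofTensor M N (a ⊗ₜ x) = inclA M N a * inclK M N x := by
  change _ = ofTensor M N (a ⊗ₜ 1) * ofTensor M N (1 ⊗ₜ x)
  rw [ofTensor_mul_ofTensor, map_one N.coact, Algebra.TensorProduct.one_def,
    TensorProduct.map_tmul]
  simp

/-- The two inclusions satisfy the straightening relation. -/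
theorem inclK_mul_inclA (x : K) (a : A) : inclK M N x * inclA M N a =
    LinearMap.mul' k _ (TensorProduct.map ((inclA M N).toLinearMap ∘ₗ M.act.toLinearMap.flip a)
      (inclK M N).toLinearMap (N.coact x)) := by
  change ofTensor M N (1 ⊗ₜ x) * ofTensor M N (a ⊗ₜ 1) = _
  rw [ofTensor_mul_ofTensor]
  generalize N.coact x = t
  induction t with
  | zero => simp
  | add p q hp hq => simp only [map_add, hp, hq]
  | tmul b y =>
    rw [TensorProduct.map_tmul, TensorProduct.map_tmul, ofTensor_eq]
    simp

/-- The algebra morphism out of a crossed product determined by algebra morphisms out of its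
factors that satisfy the straightening relation. -/
noncomputable def lift (φ : A →ₐ[k] S) (ψ : K →ₐ[k] S) (h : ∀ x, x ∈ straightening M N φ ψ) :
    CrossedProduct M N →ₐ[k] S :=
  AlgHom.ofLinearMap
    (LinearMap.mul' k S ∘ₗ TensorProduct.map φ.toLinearMap ψ.toLinearMap ∘ₗ
      (ofTensor M N).symm.toLinearMap)
    (by
      change φ 1 * ψ 1 = 1
      rw [map_one, map_one, one_mul])
    (fun z w => by
      obtain ⟨z, rfl⟩ := (ofTensor M N).surjective z
      obtain ⟨w, rfl⟩ := (ofTensor M N).surjective w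
      simp only [LinearMap.comp_apply, LinearEquiv.coe_coe, LinearEquiv.symm_apply_apply]
      induction z with
      | zero => simp
      | add p q hp hq => simp only [map_add, add_mul, hp, hq]
      | tmul a x =>
        induction w with
        | zero => simp
        | add p q hp hq => simp only [map_add, mul_add, hp, hq]
        | tmul a' x' =>
          rw [ofTensor_mul_ofTensor, LinearEquiv.symm_apply_apply]
          change _ = φ a * ψ x * (φ a' * ψ x')
          rw [mul_assoc, ← mul_assoc (ψ x), h x]
          generalize N.coact x = t
          induction t with
          | zero => simp
          | add p q hp hq => simp only [map_add, add_mul, mul_add, hp, hq]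
          | tmul b y => simp [mul_assoc])

variable {M N}

theorem lift_ofTensor (φ : A →ₐ[k] S) (ψ : K →ₐ[k] S) (h : ∀ x, x ∈ straightening M N φ ψ)
    (a : A) (x : K) : lift M N φ ψ h (ofTensor M N (a ⊗ₜ x)) = φ a * ψ x := rfl

theorem lift_inclA (φ : A →ₐ[k] S) (ψ : K →ₐ[k] S) (h : ∀ x, x ∈ straightening M N φ ψ)
    (a : A) : lift M N φ ψ h (inclA M N a) = φ a := by
  change φ a * ψ 1 = φ a
  rw [map_one, mul_one]

theorem lift_inclK (φ : A →ₐ[k] S) (ψ : K →ₐ[k] S) (h : ∀ x, x ∈ straightening M N φ ψ)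
    (x : K) : lift M N φ ψ h (inclK M N x) = ψ x := by
  change φ 1 * ψ x = ψ x
  rw [map_one, one_mul]

end CrossedProduct

namespace LeftComoduleAlgebra
variable {k B B' B₁ B₂ K : Type*} [CommRing k] [Ring B] [Bialgebra k B] [Ring B'] [Bialgebra k B']
  [Ring B₁] [Bialgebra k B₁] [Ring B₂] [Bialgebra k B₂] [Ring K] [Algebra k K]

theorem push_coact (N : LeftComoduleAlgebra k B K) (f : B →ₐc[k] B') (x : K) :
    (N.push f).coact x = TensorProduct.map (f : B →ₗ[k] B') LinearMap.id (N.coact x) := rfl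

variable (N₁ : LeftComoduleAlgebra k B₁ K) (N₂ : LeftComoduleAlgebra k B₂ K)
    (h : ∀ x, TensorProduct.map LinearMap.id N₂.coact.toLinearMap (N₁.coact x) =
      TensorProduct.leftComm k B₂ B₁ K
        (TensorProduct.map LinearMap.id N₁.coact.toLinearMap (N₂.coact x)))

/-- Applying the counit of `B₁` to the coaction of `B₁ ⊗ B₂` gives the coaction of `B₂`. -/
theorem map_prod_coact_right (x : K) (g : B₁ ⊗[k] B₂ →ₗ[k] B) (g₂ : B₂ →ₗ[k] B)
    (hg : ∀ a b, g (a ⊗ₜ b) = Coalgebra.counit (R := k) a • g₂ b) :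
    TensorProduct.map g LinearMap.id ((N₁.prod N₂ h).coact x) =
      TensorProduct.map g₂ LinearMap.id (N₂.coact x) := by
  have h1 : ∀ t : B₁ ⊗[k] K, TensorProduct.map g LinearMap.id
      ((TensorProduct.assoc k B₁ B₂ K).symm
        (TensorProduct.map LinearMap.id N₂.coact.toLinearMap t)) =
      TensorProduct.map g₂ LinearMap.id (N₂.coact (TensorProduct.lid k K
        (TensorProduct.map Coalgebra.counit LinearMap.id t))) := by
    intro t
    induction t with
    | zero => simp
    | add p q hp hq => simp only [map_add, hp, hq]
    | tmul a y =>
      simp only [TensorProduct.map_tmul, LinearMap.id_apply, TensorProduct.lid_tmul, map_smul,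
        AlgHom.toLinearMap_apply]
      generalize N₂.coact y = u
      induction u with
      | zero => simp
      | add p q hp hq => simp only [map_add, TensorProduct.tmul_add, smul_add, hp, hq]
      | tmul b z => simp [hg, TensorProduct.smul_tmul']
  exact (h1 _).trans (congrArg (fun y => TensorProduct.map g₂ LinearMap.id (N₂.coact y))
    (N₁.counit x))

/-- Applying the counit of `B₂` to the coaction of `B₁ ⊗ B₂` gives the coaction of `B₁`. -/
theorem map_prod_coact_left (x : K) (g : B₁ ⊗[k] B₂ →ₗ[k] B) (g₁ : B₁ →ₗ[k] B)
    (hg : ∀ a b, g (a ⊗ₜ b) = Coalgebra.counit (R := k) b • g₁ a) :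
    TensorProduct.map g LinearMap.id ((N₁.prod N₂ h).coact x) =
      TensorProduct.map g₁ LinearMap.id (N₁.coact x) := by
  have h1 : ∀ t : B₁ ⊗[k] K, TensorProduct.map g LinearMap.id
      ((TensorProduct.assoc k B₁ B₂ K).symm
        (TensorProduct.map LinearMap.id N₂.coact.toLinearMap t)) =
      TensorProduct.map g₁ LinearMap.id t := by
    intro t
    induction t with
    | zero => simp
    | add p q hp hq => simp only [map_add, hp, hq]
    | tmul a y =>
      have h2 : ∀ u : B₂ ⊗[k] K, TensorProduct.map g LinearMap.id
          ((TensorProduct.assoc k B₁ B₂ K).symm (a ⊗ₜ u)) =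
          g₁ a ⊗ₜ TensorProduct.lid k K (TensorProduct.map Coalgebra.counit LinearMap.id u) := by
        intro u
        induction u with
        | zero => simp
        | add p q hp hq => simp only [map_add, TensorProduct.tmul_add, hp, hq]
        | tmul b z => simp [hg, TensorProduct.smul_tmul]
      exact (h2 _).trans (congrArg (g₁ a ⊗ₜ ·) (N₂.counit y))
  exact h1 _

/-- A map that factors through the counit turns a coaction into the trivial one. -/
theorem map_coact_of_counit (N : LeftComoduleAlgebra k B K) (x : K) (g : B →ₗ[k] B')
    (hg : ∀ b, g b = algebraMap k B' (Coalgebra.counit b)) :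
    TensorProduct.map g LinearMap.id (N.coact x) = 1 ⊗ₜ x := by
  have h1 : ∀ t : B ⊗[k] K, TensorProduct.map g LinearMap.id t = (1 : B') ⊗ₜ TensorProduct.lid k K
      (TensorProduct.map Coalgebra.counit LinearMap.id t) := by
    intro t
    induction t with
    | zero => simp
    | add p q hp hq => simp only [map_add, TensorProduct.tmul_add, hp, hq]
    | tmul b z => simp [hg, Algebra.algebraMap_eq_smul_one, TensorProduct.smul_tmul]
  rw [h1, N.counit]

end LeftComoduleAlgebra

/-! ### Convolution products and translations of linear forms -/

section Conv
variable {k : Type*} [CommRing k] {H : Type*} [Ring H] [HopfAlgebra k H]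

/-- The linear form `f(a ? b)`. -/
noncomputable def translate (a b : H) : Module.End k (DualAlgebra k H) :=
  (dualForm k H).symm.toLinearMap ∘ₗ
    LinearMap.lcomp k k (LinearMap.mulRight k b ∘ₗ LinearMap.mulLeft k a) ∘ₗ
      (dualForm k H).toLinearMap

theorem dualForm_translate (a b x : H) (f : DualAlgebra k H) :
    dualForm k H (translate a b f) x = dualForm k H f (a * x * b) := rfl

theorem translate_one_one : translate (k := k) (1 : H) 1 = LinearMap.id :=
  LinearMap.ext fun f => dualForm_ext fun x => by simp [dualForm_translate]

variable [Module.Finite k H] [Module.Free k H]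

theorem dualPair_ext {s t : DualAlgebra k H ⊗[k] DualAlgebra k H}
    (h : ∀ x y, dualPair k H s (x ⊗ₜ y) = dualPair k H t (x ⊗ₜ y)) : s = t :=
  (dualPair k H).injective (TensorProduct.ext' h)

theorem dualPair_map_translate (a b a' b' x y : H) (t : DualAlgebra k H ⊗[k] DualAlgebra k H) :
    dualPair k H (TensorProduct.map (translate a b) (translate a' b') t) (x ⊗ₜ y) =
      dualPair k H t ((a * x * b) ⊗ₜ (a' * y * b')) := by
  induction t with
  | zero => simp
  | add p q hp hq => simp only [map_add, LinearMap.add_apply, hp, hq]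
  | tmul f g => rfl

/-- A product `f(a x y b)` is obtained by translating the two outer legs of the coproduct. -/
theorem dualComul_translate (a b : H) (f : DualAlgebra k H) :
    dualComul k H (translate a b f) =
      TensorProduct.map (translate a 1) (translate 1 b) (dualComul k H f) := by
  refine dualPair_ext fun x y => ?_
  rw [dualPair_map_translate, dualPair_dualComul, dualPair_dualComul, dualForm_translate]
  simp only [mul_one, one_mul, mul_assoc]

variable {S : Type*} [Ring S] [Algebra k S]

theorem convProd_cons (r : DualAlgebra k H →ₐ[k] S) (l : List (DualAlgebra k H →ₐ[k] S))
    (f : DualAlgebra k H) : convProd (r :: l) f =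
      LinearMap.mul' k S (TensorProduct.map r.toLinearMap (convProd l) (dualComul k H f)) := rfl

theorem convProd_singleton (r : DualAlgebra k H →ₐ[k] S) (f : DualAlgebra k H) :
    convProd [r] f = r f := by
  have h1 : ∀ t, LinearMap.mul' k S (TensorProduct.map r.toLinearMap (convProd []) t) =
      r (TensorProduct.rid k _
        (TensorProduct.map LinearMap.id (dualCounit k H).toLinearMap t)) := by
    intro t
    induction t with
    | zero => simp
    | add p q hp hq => simp only [map_add, hp, hq]
    | tmul f g =>
      change r f * algebraMap k S (dualCounit k H g) = r (dualCounit k H g • f)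
      rw [map_smul, ← Algebra.commutes, Algebra.smul_def]
  rw [convProd_cons, h1]
  congr 1
  refine dualForm_ext fun x => ?_
  have h2 : ∀ t : DualAlgebra k H ⊗[k] DualAlgebra k H, dualForm k H (TensorProduct.rid k _
      (TensorProduct.map LinearMap.id (dualCounit k H).toLinearMap t)) x =
        dualPair k H t (x ⊗ₜ 1) := by
    intro t
    induction t with
    | zero => simp
    | add p q hp hq => simp only [map_add, LinearMap.add_apply, hp, hq]
    | tmul f g =>
      change dualForm k H g 1 * dualForm k H f x = _
      rw [dualPair_tmul, mul_comm]
  rw [h2, dualPair_dualComul, mul_one]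

/-- If an operator straightens past the first of several actions by left translations and its
components commute with the other ones, then it straightens past the convolution product. -/
theorem mul_convProd_cons {ι : Type*} {I : Finset ι} {s : S} {a : ι → H} {w : ι → S}
    {r : DualAlgebra k H →ₐ[k] S} {l : List (DualAlgebra k H →ₐ[k] S)}
    (hr : ∀ f, s * r f = ∑ i ∈ I, r (translate (a i) 1 f) * w i)
    (hw : ∀ i ∈ I, ∀ r' ∈ l, ∀ f, Commute (r' f) (w i)) (f : DualAlgebra k H) :
    s * convProd (r :: l) f = ∑ i ∈ I, convProd (r :: l) (translate (a i) 1 f) * w i := by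
  simp only [convProd_cons, dualComul_translate, translate_one_one]
  generalize dualComul k H f = t
  induction t with
  | zero => simp
  | add p q hp hq => simp only [map_add, mul_add, add_mul, hp, hq, Finset.sum_add_distrib]
  | tmul f g =>
    simp only [TensorProduct.map_tmul, LinearMap.mul'_apply, AlgHom.toLinearMap_apply,
      LinearMap.id_apply]
    rw [← mul_assoc, hr, Finset.sum_mul]
    refine Finset.sum_congr rfl fun i hi => ?_
    rw [mul_assoc, mul_assoc, (commute_convProd (w i) l (hw i hi) g).eq]

/-- If an operator straightens past the last of several actions by right translations and commutes
with the other ones, then it straightens past the convolution product. -/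
theorem mul_convProd_concat {ι : Type*} {I : Finset ι} {s : S} {b : ι → H} {w : ι → S}
    {r : DualAlgebra k H →ₐ[k] S}
    (hr : ∀ f, s * r f = ∑ i ∈ I, r (translate 1 (b i) f) * w i) :
    ∀ (l : List (DualAlgebra k H →ₐ[k] S)) (_ : ∀ r' ∈ l, ∀ f, Commute (r' f) s)
      (f : DualAlgebra k H), s * convProd (l ++ [r]) f =
        ∑ i ∈ I, convProd (l ++ [r]) (translate 1 (b i) f) * w i
  | [], _, f => by simp only [List.nil_append, convProd_singleton, hr]
  | r' :: l, hl, f => by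
    have ih := mul_convProd_concat hr l (fun r hr => hl r (List.mem_cons_of_mem _ hr))
    simp only [List.cons_append, convProd_cons, dualComul_translate, translate_one_one]
    generalize dualComul k H f = t
    induction t with
    | zero => simp
    | add p q hp hq => simp only [map_add, mul_add, add_mul, hp, hq, Finset.sum_add_distrib]
    | tmul f g =>
      simp only [TensorProduct.map_tmul, LinearMap.mul'_apply, AlgHom.toLinearMap_apply,
        LinearMap.id_apply]
      rw [← mul_assoc, ← (hl r' (by simp) f).eq, mul_assoc, ih, Finset.mul_sum]
      simp only [mul_assoc]

end Conv

/-! ### Straightening on the algebra of one edge -/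

section Local
variable {k : Type*} [CommRing k] {H K : Type*} [Ring H] [HopfAlgebra k H] [Ring K] [Algebra k K]
  {ι : Type*} {I : Finset ι}

/-- Coassociativity contracts `m(y₍₋₂₎ ⊗ y₍₋₁₎) ⊗ y₍₀₎` to `1 ⊗ y` whenever
`m(a₍₁₎ ⊗ a₍₂₎) = ε(a)`. The coaction of `y` is given by an explicit decomposition. -/
theorem LeftComoduleAlgebra.contract (N : LeftComoduleAlgebra k H K) (m : H ⊗[k] H →ₗ[k] H)
    (hm : ∀ a, m (Coalgebra.comul a) = algebraMap k H (Coalgebra.counit a)) {y : K} {b : ι → H}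
    {x : ι → K} (hy : N.coact y = ∑ i ∈ I, b i ⊗ₜ x i) :
    ∑ i ∈ I, TensorProduct.map m LinearMap.id
      ((TensorProduct.assoc k H H K).symm (b i ⊗ₜ N.coact (x i))) = 1 ⊗ₜ y := by
  have h1 : ∑ i ∈ I, TensorProduct.map m LinearMap.id
      ((TensorProduct.assoc k H H K).symm (b i ⊗ₜ N.coact (x i))) =
      TensorProduct.map m LinearMap.id ((TensorProduct.assoc k H H K).symm
        (TensorProduct.map LinearMap.id N.coact.toLinearMap (N.coact y))) := by
    simp [hy]
  rw [h1, ← N.coassoc, LinearEquiv.symm_apply_apply, ← LinearMap.comp_apply,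
    ← TensorProduct.map_comp]
  exact N.map_coact_of_counit y (m ∘ₗ Coalgebra.comul) hm

/-- Coassociativity contracts `y₍₀₎ ⊗ m(y₍₁₎ ⊗ y₍₂₎)` to `y ⊗ 1` whenever `m(a₍₁₎ ⊗ a₍₂₎) = ε(a)`.
-/
theorem RightComoduleAlgebra.contract (N : RightComoduleAlgebra k H K) (m : H ⊗[k] H →ₗ[k] H)
    (hm : ∀ a, m (Coalgebra.comul a) = algebraMap k H (Coalgebra.counit a)) {y : K} {b : ι → H}
    {x : ι → K} (hy : N.coact y = ∑ i ∈ I, x i ⊗ₜ b i) :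
    ∑ i ∈ I, TensorProduct.map LinearMap.id m
      (TensorProduct.assoc k K H H (N.coact (x i) ⊗ₜ b i)) = y ⊗ₜ 1 := by
  have h1 : ∑ i ∈ I, TensorProduct.map LinearMap.id m
      (TensorProduct.assoc k K H H (N.coact (x i) ⊗ₜ b i)) =
      TensorProduct.map LinearMap.id m (TensorProduct.assoc k K H H
        (TensorProduct.map N.coact.toLinearMap LinearMap.id (N.coact y))) := by
    simp [hy]
  have h2 : ∀ t : K ⊗[k] H, TensorProduct.map LinearMap.id (m ∘ₗ Coalgebra.comul) t =
      TensorProduct.rid k K (TensorProduct.map LinearMap.id Coalgebra.counit t) ⊗ₜ (1 : H) := by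
    intro t
    induction t with
    | zero => simp
    | add p q hp hq => simp only [map_add, TensorProduct.add_tmul, hp, hq]
    | tmul z a => simp [hm, Algebra.algebraMap_eq_smul_one, TensorProduct.smul_tmul]
  rw [h1, N.coassoc, ← LinearMap.comp_apply, ← TensorProduct.map_comp, LinearMap.id_comp, h2,
    N.counit]

/-- The map `a ⊗ b ↦ a S(b)`. -/
noncomputable def mulAntipode (k H : Type*) [CommRing k] [Ring H] [HopfAlgebra k H] :
    H ⊗[k] H →ₗ[k] H :=
  LinearMap.mul' k H ∘ₗ (HopfAlgebra.antipode k).lTensor H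

theorem mulAntipode_tmul (a b : H) :
    mulAntipode k H (a ⊗ₜ b) = a * HopfAlgebra.antipode k b := rfl

theorem mulAntipode_comul (a : H) :
    mulAntipode k H (Coalgebra.comul a) = algebraMap k H (Coalgebra.counit a) :=
  HopfAlgebra.mul_antipode_lTensor_comul_apply a

/-- The map `a ⊗ b ↦ S(b) a`. -/
noncomputable def antipodeMulSwap (k H : Type*) [CommRing k] [Ring H] [HopfAlgebra k H] :
    H ⊗[k] H →ₗ[k] H :=
  LinearMap.mul' k H ∘ₗ (TensorProduct.comm k H H).toLinearMap ∘ₗ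
    (HopfAlgebra.antipode k).lTensor H

theorem antipodeMulSwap_tmul (a b : H) :
    antipodeMulSwap k H (a ⊗ₜ b) = HopfAlgebra.antipode k b * a := rfl

/-- The identity `S(a₍₂₎) a₍₁₎ = ε(a)` holds in an involutory Hopf algebra, as the image under `S`
of `S(a₍₁₎) a₍₂₎ = ε(a)`. -/
theorem antipodeMulSwap_comul
    (hS : ∀ a : H, HopfAlgebra.antipode k (HopfAlgebra.antipode k a) = a) (a : H) :
    antipodeMulSwap k H (Coalgebra.comul a) = algebraMap k H (Coalgebra.counit a) := by
  have e : ∀ t : H ⊗[k] H, antipodeMulSwap k H t = HopfAlgebra.antipode k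
      (LinearMap.mul' k H ((HopfAlgebra.antipode k).rTensor H t)) := by
    intro t
    induction t with
    | zero => simp
    | add p q hp hq => simp only [map_add, hp, hq]
    | tmul a b =>
      rw [antipodeMulSwap_tmul, LinearMap.rTensor_tmul, LinearMap.mul'_apply,
        HopfAlgebra.antipode_mul_antidistrib, hS]
  rw [e, HopfAlgebra.mul_antipode_rTensor_comul_apply, Algebra.algebraMap_eq_smul_one, map_smul,
    HopfAlgebra.antipode_one]

theorem leftDualAct_apply (N : LeftComoduleAlgebra k H K) (f : DualAlgebra k H) (z : K) :
    leftDualAct N f z = TensorProduct.lid k K (TensorProduct.map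
      (dualForm k H f ∘ₗ HopfAlgebra.antipode k) LinearMap.id (N.coact z)) := rfl

theorem rightDualAct_apply (N : RightComoduleAlgebra k H K) (f : DualAlgebra k H) (z : K) :
    rightDualAct N f z = TensorProduct.rid k K (TensorProduct.map LinearMap.id
      (dualForm k H f) (N.coact z)) := rfl

/-- Left multiplication straightens past `f(S(z₍₋₁₎)) z₍₀₎` by a right translation of `f`:
`f(S(y₍₋₁₎ z₍₋₁₎) y₍₋₂₎) = f(S(z₍₋₁₎) S(y₍₋₁₎) y₍₋₂₎)`, where `S(a₍₂₎) a₍₁₎ = ε(a)` requires an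
involutory antipode. -/
theorem mulLeft_mul_leftDualAct (N : LeftComoduleAlgebra k H K)
    (hS : ∀ a : H, HopfAlgebra.antipode k (HopfAlgebra.antipode k a) = a) {y : K} {b : ι → H}
    {x : ι → K} (hy : N.coact y = ∑ i ∈ I, b i ⊗ₜ x i) (f : DualAlgebra k H) :
    LinearMap.mulLeft k y * leftDualAct N f =
      ∑ i ∈ I, leftDualAct N (translate 1 (b i) f) * LinearMap.mulLeft k (x i) := by
  refine LinearMap.ext fun z => ?_
  rw [LinearMap.sum_apply]
  simp only [Module.End.mul_apply, LinearMap.mulLeft_apply, leftDualAct_apply, map_mul]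
  generalize N.coact z = v
  induction v with
  | zero => simp
  | add p q hp hq => simp only [map_add, mul_add, hp, hq, Finset.sum_add_distrib]
  | tmul h w =>
    let Φ : H ⊗[k] K →ₗ[k] K := (TensorProduct.lid k K).toLinearMap ∘ₗ TensorProduct.map
      (dualForm k H f ∘ₗ LinearMap.mulLeft k (HopfAlgebra.antipode k h)) (LinearMap.mulRight k w)
    have e : ∀ (b : H) (u : H ⊗[k] K), TensorProduct.lid k K (TensorProduct.map
        (dualForm k H (translate 1 b f) ∘ₗ HopfAlgebra.antipode k) LinearMap.id (u * h ⊗ₜ w)) =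
        Φ (TensorProduct.map (antipodeMulSwap k H) LinearMap.id
          ((TensorProduct.assoc k H H K).symm (b ⊗ₜ u))) := by
      intro b u
      induction u with
      | zero => simp
      | add p q hp hq => simp only [map_add, add_mul, TensorProduct.tmul_add, hp, hq]
      | tmul c x =>
        simp [Φ, dualForm_translate, antipodeMulSwap_tmul, HopfAlgebra.antipode_mul_antidistrib,
          mul_assoc]
    simp only [e]
    rw [← map_sum, N.contract _ (antipodeMulSwap_comul hS) hy]
    simp [Φ]

/-- Right multiplication straightens past `f(S(z₍₋₁₎)) z₍₀₎` by a left translation of `f`, because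
of `a₍₁₎ S(a₍₂₎) = ε(a)`. -/
theorem mulRight_mul_leftDualAct (N : LeftComoduleAlgebra k H K) {y : K} {b : ι → H}
    {x : ι → K} (hy : N.coact y = ∑ i ∈ I, b i ⊗ₜ x i) (f : DualAlgebra k H) :
    LinearMap.mulRight k y * leftDualAct N f =
      ∑ i ∈ I, leftDualAct N (translate (b i) 1 f) * LinearMap.mulRight k (x i) := by
  refine LinearMap.ext fun z => ?_
  rw [LinearMap.sum_apply]
  simp only [Module.End.mul_apply, LinearMap.mulRight_apply, leftDualAct_apply, map_mul]
  generalize N.coact z = v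
  induction v with
  | zero => simp
  | add p q hp hq => simp only [map_add, add_mul, hp, hq, Finset.sum_add_distrib]
  | tmul h w =>
    let Φ : H ⊗[k] K →ₗ[k] K := (TensorProduct.lid k K).toLinearMap ∘ₗ TensorProduct.map
      (dualForm k H f ∘ₗ LinearMap.mulRight k (HopfAlgebra.antipode k h)) (LinearMap.mulLeft k w)
    have e : ∀ (b : H) (u : H ⊗[k] K), TensorProduct.lid k K (TensorProduct.map
        (dualForm k H (translate b 1 f) ∘ₗ HopfAlgebra.antipode k) LinearMap.id (h ⊗ₜ w * u)) =
        Φ (TensorProduct.map (mulAntipode k H) LinearMap.id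
          ((TensorProduct.assoc k H H K).symm (b ⊗ₜ u))) := by
      intro b u
      induction u with
      | zero => simp
      | add p q hp hq => simp only [map_add, mul_add, TensorProduct.tmul_add, hp, hq]
      | tmul c x =>
        simp [Φ, dualForm_translate, mulAntipode_tmul, HopfAlgebra.antipode_mul_antidistrib,
          mul_assoc]
    simp only [e]
    rw [← map_sum, N.contract _ mulAntipode_comul hy]
    simp [Φ]

/-- Right multiplication straightens past `z₍₀₎ f(z₍₁₎)` by a right translation of `f`, because of
`a₍₁₎ S(a₍₂₎) = ε(a)`. -/
theorem mulRight_mul_rightDualAct (N : RightComoduleAlgebra k H K) {y : K} {b : ι → H}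
    {x : ι → K} (hy : N.coact y = ∑ i ∈ I, x i ⊗ₜ b i) (f : DualAlgebra k H) :
    LinearMap.mulRight k y * rightDualAct N f = ∑ i ∈ I,
      rightDualAct N (translate 1 (HopfAlgebra.antipode k (b i)) f) *
        LinearMap.mulRight k (x i) := by
  refine LinearMap.ext fun z => ?_
  rw [LinearMap.sum_apply]
  simp only [Module.End.mul_apply, LinearMap.mulRight_apply, rightDualAct_apply, map_mul]
  generalize N.coact z = v
  induction v with
  | zero => simp
  | add p q hp hq => simp only [map_add, add_mul, hp, hq, Finset.sum_add_distrib]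
  | tmul w h =>
    let Φ : K ⊗[k] H →ₗ[k] K := (TensorProduct.rid k K).toLinearMap ∘ₗ TensorProduct.map
      (LinearMap.mulLeft k w) (dualForm k H f ∘ₗ LinearMap.mulLeft k h)
    have e : ∀ (b : H) (u : K ⊗[k] H), TensorProduct.rid k K (TensorProduct.map
        LinearMap.id (dualForm k H (translate 1 (HopfAlgebra.antipode k b) f)) (w ⊗ₜ h * u)) =
        Φ (TensorProduct.map LinearMap.id (mulAntipode k H)
          (TensorProduct.assoc k K H H (u ⊗ₜ b))) := by
      intro b u
      induction u with
      | zero => simp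
      | add p q hp hq => simp only [map_add, mul_add, TensorProduct.add_tmul, hp, hq]
      | tmul x c => simp [Φ, dualForm_translate, mulAntipode_tmul, mul_assoc]
    simp only [e]
    rw [← map_sum, N.contract _ mulAntipode_comul hy]
    simp [Φ]

/-- Left multiplication straightens past `z₍₀₎ f(z₍₁₎)` by a left translation of `f`, because of
`S(a₍₂₎) a₍₁₎ = ε(a)`, which requires an involutory antipode. -/
theorem mulLeft_mul_rightDualAct (N : RightComoduleAlgebra k H K)
    (hS : ∀ a : H, HopfAlgebra.antipode k (HopfAlgebra.antipode k a) = a) {y : K} {b : ι → H}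
    {x : ι → K} (hy : N.coact y = ∑ i ∈ I, x i ⊗ₜ b i) (f : DualAlgebra k H) :
    LinearMap.mulLeft k y * rightDualAct N f = ∑ i ∈ I,
      rightDualAct N (translate (HopfAlgebra.antipode k (b i)) 1 f) *
        LinearMap.mulLeft k (x i) := by
  refine LinearMap.ext fun z => ?_
  rw [LinearMap.sum_apply]
  simp only [Module.End.mul_apply, LinearMap.mulLeft_apply, rightDualAct_apply, map_mul]
  generalize N.coact z = v
  induction v with
  | zero => simp
  | add p q hp hq => simp only [map_add, mul_add, hp, hq, Finset.sum_add_distrib]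
  | tmul w h =>
    let Φ : K ⊗[k] H →ₗ[k] K := (TensorProduct.rid k K).toLinearMap ∘ₗ TensorProduct.map
      (LinearMap.mulRight k w) (dualForm k H f ∘ₗ LinearMap.mulRight k h)
    have e : ∀ (b : H) (u : K ⊗[k] H), TensorProduct.rid k K (TensorProduct.map
        LinearMap.id (dualForm k H (translate (HopfAlgebra.antipode k b) 1 f)) (u * w ⊗ₜ h)) =
        Φ (TensorProduct.map LinearMap.id (antipodeMulSwap k H)
          (TensorProduct.assoc k K H H (u ⊗ₜ b))) := by
      intro b u
      induction u with
      | zero => simp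
      | add p q hp hq => simp only [map_add, add_mul, TensorProduct.add_tmul, hp, hq]
      | tmul x c => simp [Φ, dualForm_translate, antipodeMulSwap_tmul, mul_assoc]
    simp only [e]
    rw [← map_sum, N.contract _ (antipodeMulSwap_comul hS) hy]
    simp [Φ]

end Local

/-! ### Coactions of a corner on the algebras of the half-edges -/

section TwLegs
variable {k : Type*} [CommRing k] {B K : Type*} [Ring B] [Bialgebra k B] [Ring K] [Algebra k K]

theorem BicomoduleAlgebra.legs_comm_symm {B' : Type*} [Ring B'] [Bialgebra k B']
    (X : BicomoduleAlgebra k B B' K) (o : Bool) (x : Tw o false K) :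
    TensorProduct.map LinearMap.id (X.right.toLeft o).coact.toLinearMap
        ((X.left.tw o).coact x) =
      TensorProduct.leftComm k _ _ _ (TensorProduct.map LinearMap.id
        (X.left.tw o).coact.toLinearMap ((X.right.toLeft o).coact x)) := by
  rw [X.legs_comm o x, leftComm_leftComm]

end TwLegs

namespace Labelling
variable {k : Type*} [Field k] {V E F : Type*} {Γ : CellDecomposition V E F} (L : Labelling k Γ)

/-- The coaction on the algebra of a half-edge of the face on its right. -/
noncomputable def rightLeg : ∀ d : E × Bool,
    LeftComoduleAlgebra k (L.CopFace d.2 (Γ.face (d.1, !d.2))) (L.HalfEdgeAlgebra d)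
  | (e, true) => (L.coact e).right.toLeft false
  | (e, false) => (L.coact e).left.tw true

/-- The coaction on the algebra of a half-edge of the face on its left. -/
noncomputable def leftLeg : ∀ d : E × Bool,
    LeftComoduleAlgebra k (L.SignedFace d.2 (Γ.face d)) (L.HalfEdgeAlgebra d)
  | (e, true) => (L.coact e).left.tw false
  | (e, false) => (L.coact e).right.toLeft true

/-- A map that factors through the counit of the face on the left of a half-edge only sees the
coaction of the face on its right. -/
theorem map_halfEdgeCoaction_right {B : Type*} [Ring B] [Bialgebra k B] (d : E × Bool)
    (y : L.HalfEdgeAlgebra d) (g : L.HalfEdgeBialgebra d →ₗ[k] B)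
    (g₁ : L.CopFace d.2 (Γ.face (d.1, !d.2)) →ₗ[k] B)
    (hg : ∀ a b, g (a ⊗ₜ b) = Coalgebra.counit (R := k) b • g₁ a) :
    TensorProduct.map g LinearMap.id ((L.halfEdgeCoaction d).coact y) =
      TensorProduct.map g₁ LinearMap.id ((L.rightLeg d).coact y) := by
  obtain ⟨e, _ | _⟩ := d
  · exact LeftComoduleAlgebra.map_prod_coact_left _ _ ((L.coact e).legs_comm_symm true)
       y g g₁ hg
  · exact LeftComoduleAlgebra.map_prod_coact_left _ _ ((L.coact e).legs_comm false)
       y g g₁ hg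

/-- A map that factors through the counit of the face on the right of a half-edge only sees the
coaction of the face on its left. -/
theorem map_halfEdgeCoaction_left {B : Type*} [Ring B] [Bialgebra k B] (d : E × Bool)
    (y : L.HalfEdgeAlgebra d) (g : L.HalfEdgeBialgebra d →ₗ[k] B)
    (g₂ : L.SignedFace d.2 (Γ.face d) →ₗ[k] B)
    (hg : ∀ a b, g (a ⊗ₜ b) = Coalgebra.counit (R := k) a • g₂ b) :
    TensorProduct.map g LinearMap.id ((L.halfEdgeCoaction d).coact y) =
      TensorProduct.map g₂ LinearMap.id ((L.leftLeg d).coact y) := by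
  obtain ⟨e, _ | _⟩ := d
  · exact LeftComoduleAlgebra.map_prod_coact_right _ _ ((L.coact e).legs_comm_symm true)
       y g g₂ hg
  · exact LeftComoduleAlgebra.map_prod_coact_right _ _ ((L.coact e).legs_comm false)
       y g g₂ hg

/-- Straightening of the multiplication by elements of a half-edge past the dual of the label of
the face on its left. -/
theorem halfEdgeMul_mul_edgeDualAct [CharZero k] [IsAlgClosed k] {ι : Type*} {I : Finset ι}
    (d : E × Bool) {y : L.HalfEdgeAlgebra d} {b : ι → L.SignedFace d.2 (Γ.face d)}
    {x : ι → L.HalfEdgeAlgebra d} (hy : (L.leftLeg d).coact y = ∑ i ∈ I, b i ⊗ₜ x i)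
    (f : DualAlgebra k (L.H (Γ.face d))) :
    L.halfEdgeMul d y * L.edgeDualAct d f = ∑ i ∈ I, L.edgeDualAct d (translate 1
      ((Tw.tw k false false).symm (signRight (k := k) (!d.2) (b i))) f) *
        L.halfEdgeMul d (x i) := by
  obtain ⟨e, _ | _⟩ := d
  · have hy' : (L.coact e).right.coact y = ∑ i ∈ I, (show L.K e from x i) ⊗ₜ
        (show L.H (Γ.face (e, false)) from b i) := by
      refine (TensorProduct.comm k _ _).injective ((Tw.twT (k := k) true true false).injective ?_)
      refine Eq.trans hy ?_
      rw [map_sum, map_sum]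
      rfl
    exact mulRight_mul_rightDualAct (L.coact e).right hy' f
  · have hy' : (L.coact e).left.coact y = ∑ i ∈ I,
        (show L.H (Γ.face (e, true)) from b i) ⊗ₜ (show L.K e from x i) := by
      refine (Tw.twT (k := k) false false false).injective (Eq.trans hy ?_)
      rw [map_sum]
      rfl
    exact mulLeft_mul_leftDualAct (L.coact e).left antipode_antipode hy' f

/-- Straightening of the multiplication by elements of a half-edge past the dual of the label of
the face on its right. -/
theorem halfEdgeMul_mul_edgeDualAct_opp [CharZero k] [IsAlgClosed k] {ι : Type*} {I : Finset ι}
    (d : E × Bool) {y : L.HalfEdgeAlgebra d} {b : ι → L.CopFace d.2 (Γ.face (d.1, !d.2))}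
    {x : ι → L.HalfEdgeAlgebra d} (hy : (L.rightLeg d).coact y = ∑ i ∈ I, b i ⊗ₜ x i)
    (f : DualAlgebra k (L.H (Γ.face (d.1, !d.2)))) :
    L.halfEdgeMul d y * L.edgeDualAct (d.1, !d.2) f = ∑ i ∈ I, L.edgeDualAct (d.1, !d.2)
      (translate ((Tw.tw k true false).symm (signLeft (k := k) (!d.2) (b i))) 1 f) *
        L.halfEdgeMul d (x i) := by
  obtain ⟨e, _ | _⟩ := d
  · have hy' : (L.coact e).left.coact y = ∑ i ∈ I,
        (show L.H (Γ.face (e, true)) from b i) ⊗ₜ (show L.K e from x i) := by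
      refine (Tw.twT (k := k) true false false).injective (Eq.trans hy ?_)
      rw [map_sum]
      rfl
    exact mulRight_mul_leftDualAct (L.coact e).left hy' f
  · have hy' : (L.coact e).right.coact y = ∑ i ∈ I, (show L.K e from x i) ⊗ₜ
        (show L.H (Γ.face (e, false)) from b i) := by
      refine (TensorProduct.comm k _ _).injective ((Tw.twT (k := k) false true false).injective ?_)
      refine Eq.trans hy ?_
      rw [map_sum, map_sum]
      rfl
    exact mulLeft_mul_rightDualAct (L.coact e).right antipode_antipode hy' f

/-- The half-edge on the right of a corner acts on the dual of the label of its face by right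
translations. -/
theorem balancingAt_cornerRight (s : E × Bool) (b : L.SignedFace s.2 (Γ.face s)) :
    (L.balancingAt s).act (L.cornerRight s b) =
      translate 1 ((Tw.tw k false false).symm (signRight (k := k) (!s.2) b)) := by
  refine LinearMap.ext fun f => dualForm_ext fun x => ?_
  refine (balancing_act (k := k) (!(Γ.rot s).2) (!s.2) 1 b f x).trans ?_
  rw [map_one]
  rfl

/-- The half-edge on the left of a corner acts on the dual of the label of its face by left
translations. -/
theorem balancingAt_cornerLeft (s : E × Bool) (a : L.CopFace (Γ.rot s).2 (Γ.face s)) :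
    (L.balancingAt s).act (L.cornerLeft s a) =
      translate ((Tw.tw k true false).symm (signLeft (k := k) (!(Γ.rot s).2) a)) 1 := by
  refine LinearMap.ext fun f => dualForm_ext fun x => ?_
  refine (balancing_act (k := k) (!(Γ.rot s).2) (!s.2) a 1 f x).trans ?_
  rw [map_one]
  rfl

theorem castDual_translate {f₁ f₂ : F} (h : f₁ = f₂) (h' : f₂ = f₁) (o : Bool)
    (a : Tw o (!o) (L.H f₂)) (f : DualAlgebra k (L.H f₁)) :
    L.castDual h (translate ((Tw.tw k true false).symm
      (signLeft (k := k) o (L.castBialg o (!o) h' a))) 1 f) =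
    translate ((Tw.tw k true false).symm (signLeft (k := k) o a)) 1 (L.castDual h f) := by
  subst h
  rfl

section Vertex
variable [Fintype E] [DecidableEq E] [DecidableEq V]

/-- The inclusion of the algebra of a half-edge at `v` into `K_v`. -/
noncomputable def kAtSingle (v : V) (d : Γ.At v) : L.HalfEdgeAlgebra d.1 →ₐ[k] L.KAt v :=
  PiTensorProduct.singleAlgHom (A := fun d : Γ.At v => L.HalfEdgeAlgebra d.1) d

/-- The algebras of the half-edges generate `K_v`. -/
theorem kAt_induction {v : V} (P : Subalgebra k (L.KAt v)) (h : ∀ d y, L.kAtSingle v d y ∈ P)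
    (x : L.KAt v) : x ∈ P :=
  pi_induction (A := fun d : Γ.At v => L.HalfEdgeAlgebra d.1) P h x

theorem cornerProj_cornerIncl (v : V) (s : Γ.At v) (b : L.CornerBialgebra s.1) :
    L.cornerProj v s (L.cornerIncl v s b) = b :=
  piProj_single_self (k := k) (A := fun s : Γ.At v => L.CornerBialgebra s.1) s b

theorem cornerProj_cornerIncl_of_ne (v : V) {s t : Γ.At v} (h : t ≠ s)
    (b : L.CornerBialgebra t.1) :
    L.cornerProj v s (L.cornerIncl v t b) = algebraMap k _ (Coalgebra.counit b) :=
  piProj_single_of_ne (k := k) (A := fun s : Γ.At v => L.CornerBialgebra s.1) h b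

theorem cornerProj_leftIncl (v : V) (s : Γ.At v) (b) :
    L.cornerProj v s (L.leftIncl v s b) = L.cornerRight s.1 b :=
  L.cornerProj_cornerIncl v s _

theorem cornerProj_leftIncl_of_ne (v : V) {s d : Γ.At v} (h : d ≠ s) (b) :
    L.cornerProj v s (L.leftIncl v d b) = algebraMap k _ (Coalgebra.counit b) :=
  (L.cornerProj_cornerIncl_of_ne v h _).trans
    (congrArg _ (CoalgHomClass.counit_comp_apply (L.cornerRight d.1) b))

theorem cornerProj_rightIncl (v : V) (s : Γ.At v) (a) :
    L.cornerProj v s (L.rightIncl v s (Γ.rotAt v s) rfl a) =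
      L.cornerLeft s.1 (L.castBialg _ _ (Γ.face_next s.1) a) :=
  L.cornerProj_cornerIncl v s _

theorem cornerProj_rightIncl_of_ne (v : V) {s t d : Γ.At v} (ht : Γ.rotAt v t = d) (h : t ≠ s)
    (a) : L.cornerProj v s (L.rightIncl v t d ht a) = algebraMap k _ (Coalgebra.counit a) := by
  obtain ⟨b, hb⟩ := L.rightIncl_apply v t d ht a
  rw [← CoalgHomClass.counit_comp_apply (L.rightIncl v t d ht) a, hb,
    L.cornerProj_cornerIncl_of_ne v h, CoalgHomClass.counit_comp_apply (L.cornerIncl v t)]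

theorem cornerProj_halfEdgeIncl (v : V) (s d : Γ.At v) (a b) :
    L.cornerProj v s (L.halfEdgeIncl v d (a ⊗ₜ b)) =
      L.cornerProj v s (L.rightIncl v ((Γ.rotAt v).symm d) d (Equiv.apply_symm_apply _ _) a) *
        L.cornerProj v s (L.leftIncl v d b) :=
  map_mul (L.cornerProj v s) _ _

theorem coact_kAtSingle (v : V) (s d : Γ.At v) (y : L.HalfEdgeAlgebra d.1) :
    ((L.coactAt v).push (L.cornerProj v s)).coact (L.kAtSingle v d y) =
      TensorProduct.map LinearMap.id (L.kAtSingle v d).toLinearMap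
        (TensorProduct.map ((L.cornerProj v s : L.VertexBialgebra v →ₗ[k] L.CornerBialgebra s.1) ∘ₗ
          (L.halfEdgeIncl v d : L.HalfEdgeBialgebra d.1 →ₗ[k] L.VertexBialgebra v)) LinearMap.id
            ((L.halfEdgeCoaction d.1).coact y)) := by
  have h := LeftComoduleAlgebra.piCoact_single (fun d : Γ.At v => L.halfEdgeCoaction d.1)
    (L.halfEdgeIncl v) (L.halfEdgeIncl_commute v) d y
  refine (congrArg (TensorProduct.map
    (L.cornerProj v s : L.VertexBialgebra v →ₗ[k] L.CornerBialgebra s.1) LinearMap.id) h).trans ?_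
  generalize (L.halfEdgeCoaction d.1).coact y = t
  induction t with
  | zero => simp only [map_zero]; rfl
  | add p q hp hq => simp only [map_add, hp, hq]; rfl
  | tmul b z => rfl

/-- A corner coacts trivially on the half-edges that do not bound it. -/
theorem coact_kAtSingle_of_ne (v : V) {s d : Γ.At v} (h : d ≠ s) (h' : d ≠ Γ.rotAt v s)
    (y : L.HalfEdgeAlgebra d.1) :
    ((L.coactAt v).push (L.cornerProj v s)).coact (L.kAtSingle v d y) =
      1 ⊗ₜ L.kAtSingle v d y := by
  rw [coact_kAtSingle, LeftComoduleAlgebra.map_coact_of_counit]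
  · rfl
  · intro t
    change L.cornerProj v s (L.halfEdgeIncl v d t) = _
    induction t using TensorProduct.induction_on with
    | zero => simp
    | add p q hp hq => simp only [map_add, hp, hq]
    | tmul a b =>
      rw [cornerProj_halfEdgeIncl, L.cornerProj_leftIncl_of_ne v h, L.cornerProj_rightIncl_of_ne v _
        (fun e => h' (by rw [← e, Equiv.apply_symm_apply])), ← map_mul, TensorProduct.counit_tmul,
        smul_eq_mul, mul_comm]

/-- On the half-edge on its right, a corner coacts through the face on the left of the
half-edge. -/
theorem coact_kAtSingle_self (v : V) {s : Γ.At v} (h : s ≠ Γ.rotAt v s)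
    (y : L.HalfEdgeAlgebra s.1) :
    ((L.coactAt v).push (L.cornerProj v s)).coact (L.kAtSingle v s y) =
      TensorProduct.map (L.cornerRight s.1 : _ →ₗ[k] L.CornerBialgebra s.1)
        (L.kAtSingle v s).toLinearMap ((L.leftLeg s.1).coact y) := by
  rw [coact_kAtSingle, L.map_halfEdgeCoaction_left s.1 y _
    (L.cornerRight s.1 : _ →ₗ[k] L.CornerBialgebra s.1), ← LinearMap.comp_apply,
    ← TensorProduct.map_comp]
  · rfl
  · intro a b
    change L.cornerProj v s (L.halfEdgeIncl v s (a ⊗ₜ b)) = _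
    rw [cornerProj_halfEdgeIncl, L.cornerProj_leftIncl, L.cornerProj_rightIncl_of_ne v _
        (fun e => h (by conv_lhs => rw [← Equiv.apply_symm_apply (Γ.rotAt v) s, e])),
        ← Algebra.smul_def]
    rfl

/-- The bialgebra of the face on the right of the half-edge on the left of a corner, included into
the bialgebra of the corner. -/
noncomputable def cornerLeftRot (v : V) (s : Γ.At v) :
    L.CopFace (Γ.rotAt v s).1.2 (Γ.face ((Γ.rotAt v s).1.1, !(Γ.rotAt v s).1.2)) →ₐc[k]
      L.CornerBialgebra s.1 :=
  (L.cornerLeft s.1).comp (L.castBialg _ _ (Γ.face_next s.1))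

/-- On the half-edge on its left, a corner coacts through the face on the right of the
half-edge. -/
theorem coact_kAtSingle_rot (v : V) {s : Γ.At v} (h : s ≠ Γ.rotAt v s)
    (y : L.HalfEdgeAlgebra (Γ.rotAt v s).1) :
    ((L.coactAt v).push (L.cornerProj v s)).coact (L.kAtSingle v (Γ.rotAt v s) y) =
      TensorProduct.map (L.cornerLeftRot v s : _ →ₗ[k] L.CornerBialgebra s.1)
        (L.kAtSingle v (Γ.rotAt v s)).toLinearMap ((L.rightLeg (Γ.rotAt v s).1).coact y) := by
  have e : ∀ t (ht : Γ.rotAt v t = Γ.rotAt v s) a, L.rightIncl v t (Γ.rotAt v s) ht a =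
      L.rightIncl v s (Γ.rotAt v s) rfl a := by
    intro t ht a
    obtain rfl := (Γ.rotAt v).injective ht
    rfl
  rw [coact_kAtSingle, L.map_halfEdgeCoaction_right (Γ.rotAt v s).1 y _
    (L.cornerLeftRot v s : _ →ₗ[k] L.CornerBialgebra s.1), ← LinearMap.comp_apply,
    ← TensorProduct.map_comp]
  · rfl
  · intro a b
    change L.cornerProj v s (L.halfEdgeIncl v (Γ.rotAt v s) (a ⊗ₜ b)) = _
    rw [cornerProj_halfEdgeIncl, L.cornerProj_leftIncl_of_ne v h.symm, e, cornerProj_rightIncl,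
      ← Algebra.commutes, ← Algebra.smul_def]
    rfl

end Vertex
end Labelling

/-! ### The action of the site algebra -/

namespace CellDecomposition
variable {V E F : Type*} {Γ : CellDecomposition V E F}

theorem next_rot_symm (Γ : CellDecomposition V E F) (d : E × Bool) :
    Γ.next (Γ.rot.symm d) = (d.1, !d.2) := by
  change Equiv.prodCongr (Equiv.refl E) Equiv.boolNot (Γ.rot (Γ.rot.symm d)) = _
  rw [Equiv.apply_symm_apply]
  rfl

theorem next_eq (Γ : CellDecomposition V E F) (d : E × Bool) :
    Γ.next d = ((Γ.rot d).1, !(Γ.rot d).2) := rfl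

theorem Regular.face_ne (h : Γ.Regular) (d : E × Bool) : Γ.face (d.1, !d.2) ≠ Γ.face d := by
  obtain ⟨e, _ | _⟩ := d
  · exact (h e).2
  · exact (h e).2.symm

/-- A vertex of valence one would make an edge a loop in the dual decomposition. -/
theorem Regular.rot_ne (h : Γ.Regular) (d : E × Bool) : Γ.rot d ≠ d := by
  intro e
  have := Γ.face_next d
  rw [next_eq, e] at this
  exact h.face_ne d this

/-- A half-edge at the vertex of a site `c` lies on an edge of the plaquette of `c` only if it is
one of the two half-edges that bound `c`, provided that the plaquette has no other site at this
vertex. -/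
theorem eq_of_fst_eq {c d d' : E × Bool}
    (hc : ∀ c', Γ.face c' = Γ.face c → Γ.vert c' = Γ.vert c → c' = c)
    (hd : Γ.vert d = Γ.vert c) (hd' : Γ.face d' = Γ.face c) (h : d'.1 = d.1) :
    d = c ∧ d' = c ∨ d = Γ.rot c ∧ d' = Γ.next c := by
  by_cases e : d' = d
  · have h1 := hc d (by rw [← e, hd']) hd
    exact Or.inl ⟨h1, e.trans h1⟩
  · have e' : d' = (d.1, !d.2) := by
      obtain ⟨x, b⟩ := d
      obtain ⟨x', b'⟩ := d'
      obtain rfl : x' = x := h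
      cases b <;> cases b' <;> simp_all
    have h1 : Γ.rot.symm d = c := by
      refine hc _ ?_ ?_
      · rw [← Γ.face_next, next_rot_symm, ← e', hd']
      · rw [← Γ.vert_rot, Equiv.apply_symm_apply, hd]
    exact Or.inr ⟨by rw [← h1, Equiv.apply_symm_apply], by rw [← h1, next_rot_symm, e']⟩

end CellDecomposition

namespace VertexLabelling
variable {k : Type*} [Field k] {V E F : Type*} {Γ : CellDecomposition V E F}
  [Fintype E] [DecidableEq E] [DecidableEq V] {L : Labelling k Γ} (Z : VertexLabelling L)

/-- The right action on the state space of the algebra of a half-edge. -/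
noncomputable def halfEdgeRight (d : E × Bool) :
    L.HalfEdgeAlgebra d →ₐ[k] (Module.End k Z.StateSpace)ᵐᵒᵖ :=
  (precomp k (⨂[k] e, L.K e) (⨂[k] v, Z.Z v)).comp
    ((onFactor (M := L.K) d.1).comp (L.halfEdgeMul d))

theorem regularAct_kAtSingle (L : Labelling k Γ) (v : V) (d : Γ.At v)
    (y : L.HalfEdgeAlgebra d.1) : L.regularAct v (L.kAtSingle v d y) =
      onFactor (M := L.K) d.1.1 (L.halfEdgeMul d.1 y) :=
  piLift_single (A := fun d : Γ.At v => L.HalfEdgeAlgebra d.1)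
    (fun d : Γ.At v => (onFactor (M := L.K) d.1.1).comp (L.halfEdgeMul d.1))
    (fun _ _ h _ _ => L.halfEdgeMul_commute _ _ (fun e => h (Subtype.ext e)) _ _) d y

theorem vertexBimodule_right_kAtSingle (v : V) (d : Γ.At v) (y : L.HalfEdgeAlgebra d.1) :
    (Z.vertexBimodule v).right (L.kAtSingle v d y) = Z.halfEdgeRight d.1 y :=
  congrArg (precomp k (⨂[k] e, L.K e) (⨂[k] v, Z.Z v)) (regularAct_kAtSingle L v d y)

theorem edgeRight_halfEdgeRight_commute {d d' : E × Bool} (h : d'.1 ≠ d.1) (f y) :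
    Commute (Z.edgeRight d' f) (Z.halfEdgeRight d y) :=
  (onFactor_commute (M := L.K) h _ _).map (precomp k (⨂[k] e, L.K e) (⨂[k] v, Z.Z v))

theorem siteRight_halfEdgeRight_commute (c d : E × Bool) (f y) :
    Commute (Z.siteRight c f) (Z.halfEdgeRight d y) :=
  (postcomp_precomp_commute _ _).op

theorem halfEdgeRight_mul_edgeRight [CharZero k] [IsAlgClosed k] {ι : Type*} {I : Finset ι}
    (d : E × Bool) {y : L.HalfEdgeAlgebra d} {b : ι → L.SignedFace d.2 (Γ.face d)}
    {x : ι → L.HalfEdgeAlgebra d} (hy : (L.leftLeg d).coact y = ∑ i ∈ I, b i ⊗ₜ x i)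
    (f : DualAlgebra k (L.H (Γ.face d))) :
    Z.halfEdgeRight d y * Z.edgeRight d f = ∑ i ∈ I, Z.edgeRight d (translate 1
      ((Tw.tw k false false).symm (signRight (k := k) (!d.2) (b i))) f) *
        Z.halfEdgeRight d (x i) := by
  have h := congrArg ((precomp k (⨂[k] e, L.K e) (⨂[k] v, Z.Z v)).comp
    (onFactor (M := L.K) d.1)) (L.halfEdgeMul_mul_edgeDualAct d hy f)
  rw [map_mul, map_sum] at h
  refine h.trans (Finset.sum_congr rfl fun i _ => ?_)
  rw [map_mul]
  rfl

theorem halfEdgeRight_mul_edgeRight_opp [CharZero k] [IsAlgClosed k] {ι : Type*} {I : Finset ι}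
    (d : E × Bool) {y : L.HalfEdgeAlgebra d} {b : ι → L.CopFace d.2 (Γ.face (d.1, !d.2))}
    {x : ι → L.HalfEdgeAlgebra d} (hy : (L.rightLeg d).coact y = ∑ i ∈ I, b i ⊗ₜ x i)
    (f : DualAlgebra k (L.H (Γ.face (d.1, !d.2)))) :
    Z.halfEdgeRight d y * Z.edgeRight (d.1, !d.2) f = ∑ i ∈ I, Z.edgeRight (d.1, !d.2)
      (translate ((Tw.tw k true false).symm (signLeft (k := k) (!d.2) (b i))) 1 f) *
        Z.halfEdgeRight d (x i) := by
  have h := congrArg ((precomp k (⨂[k] e, L.K e) (⨂[k] v, Z.Z v)).comp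
    (onFactor (M := L.K) d.1)) (L.halfEdgeMul_mul_edgeDualAct_opp d hy f)
  rw [map_mul, map_sum] at h
  refine h.trans (Finset.sum_congr rfl fun i _ => ?_)
  rw [map_mul]
  rfl

theorem size_pos (c : E × Bool) : 0 < Z.size c :=
  Function.minimalPeriod_pos_of_mem_periodicPts
    (Function.Injective.mem_periodicPts Γ.next.injective c)

theorem next_pow_size (c : E × Bool) : (Γ.next ^ Z.size c) c = c := by
  rw [← Equiv.Perm.iterate_eq_pow]
  exact Function.iterate_minimalPeriod

theorem edgeRight_castDual {c d : E × Bool} (h : d = c) (hf : Γ.face c = Γ.face d) (f) :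
    Z.edgeRight d (L.castDual hf f) = Z.edgeRight c f := by
  subst h
  rfl

theorem plaquetteItem_of_even (c : E × Bool) {j : ℕ} (hj : j % 2 = 0) (f) :
    Z.plaquetteItem c j f = Z.edgeRight ((Γ.next ^ (j / 2 + 1)) c)
      (L.castDual (Γ.face_next_pow c (j / 2 + 1)).symm f) := by
  rw [plaquetteItem, if_pos hj]
  rfl

/-- The first entry of the list of a plaquette is the edge of the half-edge on the left of the
site. -/
theorem plaquetteItem_zero (c : E × Bool) (f) : Z.plaquetteItem c 0 f =
    Z.edgeRight (Γ.next c) (L.castDual (Γ.face_next c).symm f) :=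
  Z.plaquetteItem_of_even c rfl f

/-- The last entry of the list of a plaquette is the edge of the half-edge on the right of the
site. -/
theorem plaquetteItem_last (c : E × Bool) (f) :
    Z.plaquetteItem c (2 * Z.size c - 2) f = Z.edgeRight c f := by
  have h := Z.size_pos c
  rw [Z.plaquetteItem_of_even c (by omega), Z.edgeRight_castDual]
  rw [show (2 * Z.size c - 2) / 2 + 1 = Z.size c by omega, Z.next_pow_size]

theorem plaquetteItem_halfEdgeRight_commute (c d : E × Bool) {j : ℕ}
    (h : j % 2 = 0 → ((Γ.next ^ (j / 2 + 1)) c).1 ≠ d.1) (f y) :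
    Commute (Z.plaquetteItem c j f) (Z.halfEdgeRight d y) := by
  rw [plaquetteItem, AlgHom.comp_apply]
  split_ifs with hj
  · exact Z.edgeRight_halfEdgeRight_commute (h hj) _ _
  · exact Z.siteRight_halfEdgeRight_commute _ _ _ _

theorem plaquetteItems_eq_cons (c : E × Bool) : Z.plaquetteItems c = Z.plaquetteItem c 0 ::
    (List.range (2 * Z.size c - 2)).map fun j => Z.plaquetteItem c (j + 1) := by
  have h := Z.size_pos c
  rw [plaquetteItems, show 2 * Z.size c - 1 = 2 * Z.size c - 2 + 1 by omega,
    List.range_succ_eq_map, List.map_cons, List.map_map]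
  rfl

theorem plaquetteItems_eq_concat (c : E × Bool) : Z.plaquetteItems c =
    (List.range (2 * Z.size c - 2)).map (Z.plaquetteItem c) ++
      [Z.plaquetteItem c (2 * Z.size c - 2)] := by
  have h := Z.size_pos c
  rw [plaquetteItems, show 2 * Z.size c - 1 = 2 * Z.size c - 2 + 1 by omega,
    List.range_succ, List.map_append, List.map_singleton]

section Site
variable (c : E × Bool)

/-- The right actions of `H_p^*` and `K_v` on the state space straighten as in the crossed product.
It is enough to check this for the elements of the half-edges at `v`. Those that do not bound the
site commute with the action of `H_p^*`. For the other two, the coaction of the label of the site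
translates the first or the last leg of the coproduct of `H_p^*`, which is the one that acts at the
edge of the half-edge. -/
theorem mem_straightening_right [CharZero k] [IsAlgClosed k] (hΓ : Γ.Regular)
    (hc : ∀ c', Γ.face c' = Γ.face c → Γ.vert c' = Γ.vert c → c' = c)
    (x : L.KAt (Γ.vert c)) :
    x ∈ CrossedProduct.straightening (S := (Module.End k Z.StateSpace)ᵐᵒᵖ) (L.balancingAt c)
      ((L.coactAt (Γ.vert c)).push (L.cornerProj (Γ.vert c) ⟨c, rfl⟩))
      (Z.plaquetteRight c) (Z.vertexBimodule (Γ.vert c)).right := by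
  have hsize := Z.size_pos c
  let s : Γ.At (Γ.vert c) := ⟨c, rfl⟩
  have hs : s ≠ Γ.rotAt (Γ.vert c) s := fun e => hΓ.rot_ne c (congrArg Subtype.val e).symm
  refine L.kAt_induction _ (fun d y => ?_) x
  by_cases h1 : d = s
  -- The half-edge on the right of the site acts at the last entry of the list.
  · subst h1
    obtain ⟨I, hI⟩ := TensorProduct.exists_finset ((L.leftLeg c).coact y)
    refine CrossedProduct.mem_straightening_of_sum _ _ I (fun i => L.cornerRight c i.1)
      (fun i => L.kAtSingle (Γ.vert c) s i.2) ?_ fun f => ?_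
    · rw [L.coact_kAtSingle_self _ hs]
      refine (congrArg _ hI).trans ?_
      rw [map_sum]
      rfl
    · simp only [vertexBimodule_right_kAtSingle, L.balancingAt_cornerRight]
      have h := mul_convProd_concat (r := Z.plaquetteItem c (2 * Z.size c - 2))
        (s := Z.halfEdgeRight c y) (I := I) (w := fun i => Z.halfEdgeRight c i.2)
        (b := fun i => (Tw.tw k false false).symm (signRight (k := k) (!c.2) i.1))
        (fun f => by
          simp only [plaquetteItem_last]
          exact Z.halfEdgeRight_mul_edgeRight c hI f)
        ((List.range (2 * Z.size c - 2)).map (Z.plaquetteItem c)) (fun r hr f => ?_) f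
      · rw [← plaquetteItems_eq_concat] at h
        exact h
      · obtain ⟨j, hj, rfl⟩ := List.mem_map.1 hr
        have hj := List.mem_range.1 hj
        refine Z.plaquetteItem_halfEdgeRight_commute c c (fun hj' e => ?_) f y
        obtain ⟨-, h⟩ | ⟨h, -⟩ :=
          CellDecomposition.eq_of_fst_eq hc rfl (Γ.face_next_pow c (j / 2 + 1)) e
        · exact Z.next_pow_ne c (j / 2) (by omega) h
        · exact hΓ.rot_ne c h.symm
  by_cases h2 : d = Γ.rotAt (Γ.vert c) s
  -- The half-edge on the left of the site acts at the first entry of the list.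
  · subst h2
    obtain ⟨I, hI⟩ := TensorProduct.exists_finset ((L.rightLeg (Γ.rotAt (Γ.vert c) s).1).coact y)
    refine CrossedProduct.mem_straightening_of_sum _ _ I
      (fun i => L.cornerLeftRot (Γ.vert c) s i.1)
      (fun i => L.kAtSingle (Γ.vert c) (Γ.rotAt (Γ.vert c) s) i.2) ?_ fun f => ?_
    · rw [L.coact_kAtSingle_rot _ hs]
      refine (congrArg _ hI).trans ?_
      rw [map_sum]
      rfl
    · have hact : ∀ a, (L.balancingAt c).act (L.cornerLeftRot (Γ.vert c) s a) = translate
          ((Tw.tw k true false).symm (signLeft (k := k) (!(Γ.rot c).2)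
            (L.castBialg _ _ (Γ.face_next c) a))) 1 :=
        fun a => L.balancingAt_cornerLeft c _
      rw [vertexBimodule_right_kAtSingle]
      have h := mul_convProd_cons (r := Z.plaquetteItem c 0)
        (l := (List.range (2 * Z.size c - 2)).map fun j => Z.plaquetteItem c (j + 1))
        (s := Z.halfEdgeRight (Γ.rot c) y) (I := I) (w := fun i => Z.halfEdgeRight (Γ.rot c) i.2)
        (a := fun i => (Tw.tw k true false).symm (signLeft (k := k) (!(Γ.rot c).2)
          (L.castBialg _ _ (Γ.face_next c) i.1)))
        (fun f => by
          simp only [plaquetteItem_zero]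
          refine (Z.halfEdgeRight_mul_edgeRight_opp (Γ.rot c) hI _).trans
            (Finset.sum_congr rfl fun i _ => ?_)
          exact congrArg (fun g => Z.edgeRight (Γ.next c) g * Z.halfEdgeRight (Γ.rot c) i.2)
            (L.castDual_translate (Γ.face_next c).symm (Γ.face_next c) _ _ _).symm)
        (fun i _ r hr f => ?_) f
      · rw [← plaquetteItems_eq_cons] at h
        refine h.trans (Finset.sum_congr rfl fun i _ => ?_)
        exact congrArg₂ (· * ·)
          (congrArg (Z.plaquetteRight c) (LinearMap.congr_fun (hact i.1) f).symm)
          (Z.vertexBimodule_right_kAtSingle _ _ i.2).symm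
      · obtain ⟨j, hj, rfl⟩ := List.mem_map.1 hr
        have hj := List.mem_range.1 hj
        refine Z.plaquetteItem_halfEdgeRight_commute c (Γ.rot c) (fun hj' e => ?_) f _
        obtain ⟨h, -⟩ | ⟨-, h⟩ := CellDecomposition.eq_of_fst_eq hc (Γ.vert_rot c)
          (Γ.face_next_pow c ((j + 1) / 2 + 1)) e
        · exact hΓ.rot_ne c h
        · exact Z.next_pow_ne_next_pow c ((j + 1) / 2) 0 (by omega) (by omega) hsize h
  · refine CrossedProduct.mem_straightening_of_sum _ _ {()} (fun _ => 1)
      (fun _ => L.kAtSingle (Γ.vert c) d y) ?_ fun f => ?_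
    · rw [L.coact_kAtSingle_of_ne _ h1 h2, Finset.sum_singleton]
    · rw [Finset.sum_singleton, map_one, vertexBimodule_right_kAtSingle]
      refine (Z.commute_plaquetteRight c _ (fun i _ f => ?_)
        (fun i _ f => Z.siteRight_halfEdgeRight_commute _ _ _ _) f).symm
      refine Z.edgeRight_halfEdgeRight_commute (fun e => ?_) _ _
      obtain ⟨h, -⟩ | ⟨h, -⟩ :=
        CellDecomposition.eq_of_fst_eq hc d.2 (Γ.face_next_pow c (i + 1)) e
      · exact h1 (Subtype.ext h)
      · exact h2 (Subtype.ext h)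

end Site
end VertexLabelling

namespace LeftModuleAlgebra
variable {k : Type*} [CommRing k] {ι : Type*} [DecidableEq ι] [Fintype ι] {D A : ι → Type*}
  [∀ i, Ring (D i)] [∀ i, Bialgebra k (D i)] [∀ i, Ring (A i)] [∀ i, Algebra k (A i)]
  (M : ∀ i, LeftModuleAlgebra k (D i) (A i))

/-- On a single factor, the factorwise action is given by the projection to this factor, since the
other factors act on `1` by the counit. -/
theorem piAct_apply_single (i : ι) (b : ⨂[k] i, D i) (f : A i) :
    piAct M b (PiTensorProduct.singleAlgHom i f) =
      PiTensorProduct.singleAlgHom i ((M i).act (piProj i b) f) := by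
  let P : Subalgebra k (⨂[k] i, D i) :=
    { carrier := {b | ∀ f, piAct M b (PiTensorProduct.singleAlgHom i f) =
        PiTensorProduct.singleAlgHom i ((M i).act (piProj i b) f)}
      add_mem' := fun {b c} hb hc f => by
        simp only [map_add, LinearMap.add_apply, hb f, hc f]
      algebraMap_mem' := fun r f => by
        have h : piProj i (algebraMap k (⨂[k] i, D i) r) = algebraMap k (D i) r :=
          AlgHomClass.commutes (piProj (k := k) (A := D) i) r
        rw [h, AlgHom.commutes, AlgHom.commutes, Module.algebraMap_end_apply,
          Module.algebraMap_end_apply, map_smul]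
      mul_mem' := fun {b c} hb hc f => by
        rw [map_mul, map_mul, map_mul, Module.End.mul_apply, Module.End.mul_apply, hc f, hb] }
  refine pi_induction P (fun j b f => ?_) b f
  rw [piAct_single, PiTensorProduct.singleAlgHom_apply, onFactor_tprod,
    PiTensorProduct.singleAlgHom_apply i, MonoidHom.mulSingle_apply, MonoidHom.mulSingle_apply]
  by_cases h : j = i
  · subst h
    rw [piProj_single_self, Pi.mulSingle_eq_same, Pi.mulSingle, Function.update_idem]
    rfl
  · rw [piProj_single_of_ne h, Pi.mulSingle_eq_of_ne h, (M j).act_one, AlgHom.commutes,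
      Module.algebraMap_end_apply]
    have e : ∀ r : k, algebraMap k (A j) r = r • (1 : A j) := Algebra.algebraMap_eq_smul_one
    rw [e, MultilinearMap.map_update_smul, Function.update_eq_self_iff.2
      (Pi.mulSingle_eq_of_ne h f).symm]
    exact (map_smul (PiTensorProduct.singleAlgHom (R := k) (A := A) i) _ f).symm

end LeftModuleAlgebra

namespace VertexLabelling
variable {k : Type*} [Field k] {V E F : Type*} {Γ : CellDecomposition V E F}
  [Fintype E] [DecidableEq E] [DecidableEq V] {L : Labelling k Γ} (Z : VertexLabelling L)

/-- The vertex bialgebra acts on the factor of a site through the projection to the corner of this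
site. -/
theorem actAt_hAtSingle (L : Labelling k Γ) (v : V) (s : Γ.At v) (b : L.VertexBialgebra v) (f) :
    (L.actAt v).act b (L.hAtSingle v s f) =
      L.hAtSingle v s ((L.balancingAt s.1).act (L.cornerProj v s b) f) :=
  LeftModuleAlgebra.piAct_apply_single (fun s : Γ.At v => L.balancingAt s.1) s b f

/-- The inclusions of `H_p^*` and of `K_v` into the vertex algebra straighten as in the crossed
product. -/
theorem mem_straightening_vertexAlgebra (L : Labelling k Γ) (v : V) (s : Γ.At v) (x : L.KAt v) :
    x ∈ CrossedProduct.straightening (S := L.VertexAlgebra v) (L.balancingAt s.1)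
      ((L.coactAt v).push (L.cornerProj v s))
      ((CrossedProduct.inclA (L.actAt v) (L.coactAt v)).comp (L.hAtSingle v s))
      (CrossedProduct.inclK (L.actAt v) (L.coactAt v)) := by
  intro f
  refine (CrossedProduct.inclK_mul_inclA _ _ x (L.hAtSingle v s f)).trans (congrArg _ ?_)
  rw [LeftComoduleAlgebra.push_coact]
  generalize (L.coactAt v).coact x = t
  induction t with
  | zero => simp
  | add p q hp hq => simp only [map_add, hp, hq]
  | tmul b y =>
    exact congrArg (fun a => CrossedProduct.inclA (L.actAt v) (L.coactAt v) a ⊗ₜ[k]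
      CrossedProduct.inclK (L.actAt v) (L.coactAt v) y) (actAt_hAtSingle L v s b f)

/-- The action of the site algebra on `Z_v`, through the vertex algebra. -/
noncomputable def siteAct (c : E × Bool) : L.SiteAlgebra c →ₐ[k] Module.End k (Z.Z (Γ.vert c)) :=
  (Z.act (Γ.vert c)).comp (CrossedProduct.lift _ _ _ _
    (mem_straightening_vertexAlgebra L (Γ.vert c) ⟨c, rfl⟩))

/-- The left action of the site algebra on the state space. -/
noncomputable def siteAlgebraLeft (c : E × Bool) :
    L.SiteAlgebra c →ₐ[k] Module.End k Z.StateSpace :=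
  (postcomp k (⨂[k] e, L.K e) (⨂[k] v, Z.Z v)).comp
    ((onFactor (M := Z.Z) (Γ.vert c)).comp (Z.siteAct c))

theorem siteAlgebraLeft_ofTensor (c : E × Bool) (f : DualAlgebra k (L.H (Γ.face c)))
    (a : L.KAt (Γ.vert c)) :
    Z.siteAlgebraLeft c (CrossedProduct.ofTensor _ _ (f ⊗ₜ a)) =
      Z.siteLeft c f * (Z.vertexBimodule (Γ.vert c)).left a := by
  rw [CrossedProduct.ofTensor_eq, map_mul]
  congr 1
  · exact congrArg (fun w => postcomp k (⨂[k] e, L.K e) (⨂[k] v, Z.Z v)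
      (onFactor (M := Z.Z) (Γ.vert c) (Z.act (Γ.vert c) w)))
      (CrossedProduct.lift_inclA _ _ (mem_straightening_vertexAlgebra L (Γ.vert c) ⟨c, rfl⟩) f)
  · exact congrArg (fun w => postcomp k (⨂[k] e, L.K e) (⨂[k] v, Z.Z v)
      (onFactor (M := Z.Z) (Γ.vert c) (Z.act (Γ.vert c) w)))
      (CrossedProduct.lift_inclK _ _ (mem_straightening_vertexAlgebra L (Γ.vert c) ⟨c, rfl⟩) a)

/-- The right action of a plaquette acts on the modules of its other sites, which lie at other
vertices if the plaquette has no other site at the vertex. -/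
theorem vertexLeft_plaquetteRight_commute (c : E × Bool)
    (hc : ∀ c', Γ.face c' = Γ.face c → Γ.vert c' = Γ.vert c → c' = c) (a : L.KAt (Γ.vert c)) (f) :
    Commute ((Z.vertexBimodule (Γ.vert c)).left a) (Z.plaquetteRight c f).unop := by
  have h := Z.commute_plaquetteRight c (MulOpposite.op ((Z.vertexBimodule (Γ.vert c)).left a))
    (fun i _ _ => (postcomp_precomp_commute _ _).symm.op)
    (fun i hi g => by
      have hv : Γ.vert ((Γ.next ^ (i + 1)) c) ≠ Γ.vert c := fun e =>
        Z.next_pow_ne c i hi (hc _ (Γ.face_next_pow c (i + 1)) e)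
      exact ((onFactor_commute (M := Z.Z) hv _ _).map
        (postcomp k (⨂[k] e, L.K e) (⨂[k] v, Z.Z v))).op) f
  exact h.unop.symm

section Site
variable [CharZero k] [IsAlgClosed k] (hΓ : Γ.Regular) (c : E × Bool)
  (hc : ∀ c', Γ.face c' = Γ.face c → Γ.vert c' = Γ.vert c → c' = c)

/-- The bimodule structure on the state space over the site algebra, composed of the bimodule
structures of the plaquette and of the vertex of the site. -/
noncomputable def siteBimodule : BimoduleStructure k (L.SiteAlgebra c) Z.StateSpace where
  left := Z.siteAlgebraLeft c
  right := CrossedProduct.lift (S := (Module.End k Z.StateSpace)ᵐᵒᵖ) _ _ (Z.plaquetteRight c)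
    (Z.vertexBimodule (Γ.vert c)).right (Z.mem_straightening_right c hΓ hc)
  comm z w := by
    obtain ⟨z, rfl⟩ := (CrossedProduct.ofTensor _ _).surjective z
    obtain ⟨w, rfl⟩ := (CrossedProduct.ofTensor _ _).surjective w
    induction z with
    | zero => rw [map_zero, map_zero]; exact Commute.zero_left _
    | add p q hp hq => rw [map_add, map_add]; exact hp.add_left hq
    | tmul f a =>
      induction w with
      | zero => rw [map_zero, map_zero]; exact Commute.zero_right _
      | add p q hp hq => rw [map_add, map_add]; exact hp.add_right hq
      | tmul f' a' =>
        rw [siteAlgebraLeft_ofTensor, CrossedProduct.lift_ofTensor, MulOpposite.unop_mul]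
        refine Commute.mul_left (Commute.mul_right ?_ ?_) (Commute.mul_right ?_ ?_)
        · exact postcomp_precomp_commute _ _
        · exact Z.siteLeft_plaquetteRight_commute c f f'
        · exact postcomp_precomp_commute _ _
        · exact Z.vertexLeft_plaquetteRight_commute c hc a f'

theorem siteBimodule_act (f f' : DualAlgebra k (L.H (Γ.face c))) (a a' : L.KAt (Γ.vert c)) :
    (Z.siteBimodule hΓ c hc).act (CrossedProduct.ofTensor _ _ (f ⊗ₜ[k] a))
        (CrossedProduct.inclK _ _ a' * CrossedProduct.inclA _ _ f') =
      (Z.plaquetteBimodule c).act f f' * (Z.vertexBimodule (Γ.vert c)).act a a' := by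
  have hl : (Z.siteBimodule hΓ c hc).left (CrossedProduct.ofTensor _ _ (f ⊗ₜ[k] a)) =
      Z.siteLeft c f * (Z.vertexBimodule (Γ.vert c)).left a := Z.siteAlgebraLeft_ofTensor c f a
  have hr : (Z.siteBimodule hΓ c hc).right
      (CrossedProduct.inclK _ _ a' * CrossedProduct.inclA _ _ f') =
      (Z.vertexBimodule (Γ.vert c)).right a' * Z.plaquetteRight c f' := by
    rw [map_mul]
    exact congrArg₂ (· * ·)
      (CrossedProduct.lift_inclK _ _ (Z.mem_straightening_right c hΓ hc) a')
      (CrossedProduct.lift_inclA _ _ (Z.mem_straightening_right c hΓ hc) f')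
  rw [BimoduleStructure.act, hl, hr, MulOpposite.unop_mul]
  exact (Z.vertexLeft_plaquetteRight_commute c hc a f').mul_mul_mul_comm _ _

end Site
end VertexLabelling
end Kitaev

theorem mainTheorem2 {k : Type*} [Field k] [IsAlgClosed k] [CharZero k] {V E F : Type*}
    [Fintype E] [DecidableEq E] [DecidableEq V] (Γ : Kitaev.CellDecomposition V E F)
    (L : Kitaev.Labelling k Γ) (Z : Kitaev.VertexLabelling L) :
    (∀ v₁ v₂ : V, v₁ ≠ v₂ → ∀ (a b : L.KAt v₁) (a' b' : L.KAt v₂),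
      Commute ((Z.vertexBimodule v₁).act a b) ((Z.vertexBimodule v₂).act a' b')) ∧
    (∀ c₁ c₂ : E × Bool, Γ.face c₁ ∉ Γ.bdry → Γ.face c₂ ∉ Γ.bdry → Γ.face c₁ ≠ Γ.face c₂ →
      ∀ (f g : Kitaev.DualAlgebra k (L.H (Γ.face c₁)))
        (f' g' : Kitaev.DualAlgebra k (L.H (Γ.face c₂))),
        Commute ((Z.plaquetteBimodule c₁).act f g) ((Z.plaquetteBimodule c₂).act f' g')) ∧
    (Γ.Regular → ∀ c : E × Bool, Γ.face c ∉ Γ.bdry →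
      (∀ c' : E × Bool, Γ.face c' = Γ.face c → Γ.vert c' = Γ.vert c → c' = c) →
      ∃ β : Kitaev.BimoduleStructure k (L.SiteAlgebra c) Z.StateSpace,
        ∀ (f f' : Kitaev.DualAlgebra k (L.H (Γ.face c))) (a a' : L.KAt (Γ.vert c)),
          β.act (Kitaev.CrossedProduct.ofTensor _ _ (f ⊗ₜ[k] a))
              (Kitaev.CrossedProduct.inclK _ _ a' * Kitaev.CrossedProduct.inclA _ _ f') =
            (Z.plaquetteBimodule c).act f f' * (Z.vertexBimodule (Γ.vert c)).act a a') := by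
  refine ⟨fun v₁ v₂ h a b a' b' => Z.vertexBimodule_act_commute h a b a' b',
    fun c₁ c₂ _ _ h f g f' g' => Z.plaquetteBimodule_act_commute h f g f' g',
    fun hΓ c _ hc => ⟨Z.siteBimodule hΓ c hc, fun f f' a a' => ?_⟩⟩
  exact Z.siteBimodule_act hΓ c hc f f' a a'
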